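/- Let $\kappa>0$, let $Z$ be a standard Gaussian random variable, put $p(\kappa)=\Pr[|Z|\le\kappa]$ and $\alpha_c(\kappa)=-\log 2/\log p(\kappa)$, and let $0<\alpha<\alpha_c(\kappa)$. For $N\ge 1$ let $\Sigma_N=\{\pm1\}^N$ with Hamming distance $\mathrm{dist}$, let $X_1,X_2,\dots$ be i.i.d. standard Gaussian vectors in $\mathbb{R}^N$, and let $$S=\bigcap_{i=1}^{\lfloor\alpha N\rfloor}\{\sigma\in\Sigma_N:\ |\langle X_i,\sigma\rangle|\le\kappa\sqrt N\}$$ be the solution space of the symmetric Ising perceptron with rectangular activation. For $\beta\in[0,1]$ let $$F_\alpha(\beta)=-\beta\log\beta-(1-\beta)\log(1-\beta)+\alpha\log q_\kappa(\beta),\qquad q_\kappa(\beta)=\Pr[|Z_1|\le\kappa,\ |Z_2|\le\kappa],$$ where $(Z_1,Z_2)$ is jointly Gaussian with means $0$, variances $1$ and covariance $2\beta-1$. Assume (Assumption 1) that, if $F_\alpha''(1/2)<0$, then $F_\alpha$ has exactly one critical point in $(0,1/2)$. Then there is a unique $\beta_c=\beta_c(\kappa,\alpha)\in(0,1/2)$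 with $F_\alpha(\beta_c)-\alpha\log p(\kappa)=0$. Let the instance $(X_i)$ be conditioned on the event $S\ne\emptyset$ and, given the instance, let $\sigma$ be uniformly distributed on $S$. Then, for every $\delta\in(0,\beta_c)$, with probability $1-o(1)$ as $N\to\infty$, $$\{\sigma'\in S:\ \mathrm{dist}(\sigma,\sigma')\le(\beta_c-\delta)N\}=\{\sigma\}.$$ In particular $\sigma$ is completely frozen with probability $1-o(1)$: there is a constant $c>0$, depending only on $\kappa$ and $\alpha$, such that with probability $1-o(1)$ flipping any single coordinate of $\sigma$ leaves $S$, and every solution other than $\sigma$ is at Hamming distance more than $cN$ from $\sigma$. -/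

import Mathlib

open MeasureTheory ProbabilityTheory Filter Topology

noncomputable section

namespace SymPerceptron

/-- The Hamming cube `Σ_N = {±1}^N`. -/
abbrev Cube (N : ℕ) : Type := Fin N → ℤˣ

/-- The measurable structure of `{±1}` is the discrete one. -/
instance : MeasurableSingletonClass ℤˣ where
  measurableSet_singleton u :=
    ⟨{(u : ℤ)}, measurableSet_singleton _, by ext v; simp [Units.ext_iff]⟩

/-- The law of `m` i.i.d. standard Gaussian vectors in `ℝ^N`. -/
def disorder (N m : ℕ) : Measure (Fin m → Fin N → ℝ) :=
  Measure.pi fun _ => Measure.pi fun _ => gaussianReal 0 1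

/-- The inner product `⟨x, σ⟩ = ∑ j, x j * σ j` for `x ∈ ℝ^N` and `σ ∈ {±1}^N`. -/
def innerCube {N : ℕ} (x : Fin N → ℝ) (σ : Cube N) : ℝ :=
  ∑ j, x j * (((σ j : ℤˣ) : ℤ) : ℝ)

/-- The constraint set `H_κ(x) = {σ : |⟨x, σ⟩| ≤ κ √N}`. -/
def constraintSet (κ : ℝ) {N : ℕ} (x : Fin N → ℝ) : Set (Cube N) :=
  {σ | |innerCube x σ| ≤ κ * √(N : ℝ)}

/-- The solution space `S = ⋂ i, H_κ(X_i)`. -/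
def solutions (κ : ℝ) {N m : ℕ} (X : Fin m → Fin N → ℝ) : Set (Cube N) :=
  ⋂ i, constraintSet κ (X i)

theorem measurableSet_mem_solutions (κ : ℝ) {N m : ℕ} (σ : Cube N) :
    MeasurableSet {X : Fin m → Fin N → ℝ | σ ∈ solutions κ X} := by
  have h : {X : Fin m → Fin N → ℝ | σ ∈ solutions κ X} =
      ⋂ i, {X | |innerCube (X i) σ| ≤ κ * √(N : ℝ)} := by
    ext X; simp [solutions, constraintSet]
  rw [h]
  refine MeasurableSet.iInter fun i => measurableSet_le ?_ measurable_const
  unfold innerCube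
  fun_prop

/-- The solution set is a random element of the (finite) set of all subsets of the cube. -/
theorem measurableSet_solutions_eq (κ : ℝ) {N m : ℕ} (U : Set (Cube N)) :
    MeasurableSet {X : Fin m → Fin N → ℝ | solutions κ X = U} := by
  have h : {X : Fin m → Fin N → ℝ | solutions κ X = U} =
      ⋂ σ, {X | σ ∈ solutions κ X ↔ σ ∈ U} := by
    ext X; simp [Set.ext_iff]
  rw [h]
  refine MeasurableSet.iInter fun σ => ?_
  by_cases hU : σ ∈ U
  · simpa [hU] using measurableSet_mem_solutions κ σ
  · simp only [hU, iff_false]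
    exact (measurableSet_mem_solutions κ σ).compl

/-- Given the disorder `X`, the uniform distribution on the solution space
(the zero measure when the solution space is empty). -/
def uniformSolution (κ : ℝ) (N m : ℕ) : Kernel (Fin m → Fin N → ℝ) (Cube N) where
  toFun X := uniformOn (solutions κ X)
  measurable' := by
    intro T _
    have h : ((fun X : Fin m → Fin N → ℝ => uniformOn (solutions κ X)) ⁻¹' T) =
        ⋃ U ∈ {U : Set (Cube N) | uniformOn U ∈ T}, {X | solutions κ X = U} := by
      ext X; simp
    rw [h]
    exact MeasurableSet.biUnion (Set.to_countable _)
      fun U _ => measurableSet_solutions_eq κ U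

instance (κ : ℝ) (N m : ℕ) : IsFiniteKernel (uniformSolution κ N m) where
  exists_univ_le := ⟨1, ENNReal.one_lt_top, fun X => by
    change uniformOn (solutions κ X) Set.univ ≤ 1
    exact prob_le_one⟩

/-- The joint law of `(X, σ)`: the disorder `X` is conditioned on the event that the solution
space is non-empty, and then `σ` is drawn uniformly from the solution space. -/
def randomModel (κ : ℝ) (N m : ℕ) : Measure ((Fin m → Fin N → ℝ) × Cube N) :=
  (disorder N m)[|{X | (solutions κ X).Nonempty}] ⊗ₘ uniformSolution κ N m

/-- `p(κ) = P(|Z| ≤ κ)` for a standard Gaussian `Z`. -/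
def gaussProb (κ : ℝ) : ℝ := (gaussianReal 0 1).real {z | |z| ≤ κ}

/-- The critical capacity density `α_c(κ) = - log 2 / log p(κ)`. -/
def criticalDensity (κ : ℝ) : ℝ := -Real.log 2 / Real.log (gaussProb κ)

/-- `q_κ(β) = P(|Z₁| ≤ κ, |Z₂| ≤ κ)` where `(Z₁, Z₂)` is a centred Gaussian vector with
variances `1` and covariance `2 β - 1`; meaningful for `β ∈ [0, 1]`. -/
def pairProb (κ β : ℝ) : ℝ :=
  (multivariateGaussian 0 !![1, 2 * β - 1; 2 * β - 1, 1]).real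
    {z : EuclideanSpace ℝ (Fin 2) | |z 0| ≤ κ ∧ |z 1| ≤ κ}

/-- `F_α(β) = H(β) + α log q_κ(β)`, with `H` the Shannon entropy in natural units. -/
def rate (κ α β : ℝ) : ℝ := Real.binEntropy β + α * Real.log (pairProb κ β)

/-- If `F_α''(1/2) < 0` then `F_α` has a single critical point in `(0, 1/2)`. -/
def SingleCriticalPoint (κ α : ℝ) : Prop :=
  deriv (deriv (rate κ α)) (1 / 2) < 0 →
    ∃! β : ℝ, β ∈ Set.Ioo (0 : ℝ) (1 / 2) ∧ HasDerivAt (rate κ α) 0 β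

/-- `β` lies in `(0, 1/2)` and solves `F_α(β) - α log p(κ) = 0`. -/
def IsCriticalDistance (κ α β : ℝ) : Prop :=
  β ∈ Set.Ioo (0 : ℝ) (1 / 2) ∧ rate κ α β - α * Real.log (gaussProb κ) = 0

/-- The coordinate `i` is frozen in the solution `σ` if flipping it does not give a solution. -/
def IsFrozenCoord {N : ℕ} (S : Set (Cube N)) (σ : Cube N) (i : Fin N) : Prop :=
  Function.update σ i (-σ i) ∉ S

/-- The solution `σ` is completely frozen, at linear scale `c`: every coordinate is frozen, and
`σ` forms a cluster of size one, at Hamming distance more than `c N` from every other solution. -/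
structure IsCompletelyFrozen (c : ℝ) {N : ℕ} (S : Set (Cube N)) (σ : Cube N) : Prop where
  mem : σ ∈ S
  frozen : ∀ i, IsFrozenCoord S σ i
  isolated : ∀ σ' ∈ S, σ' ≠ σ → c * (N : ℝ) < (hammingDist σ σ' : ℝ)

end SymPerceptron

end

/-!
Write `p` for `gaussProb κ`, `q β` for `pairProb κ β`, and `F` for `rate κ α`. The statement rests
on two facts about `F` and on a lower bound for the number of solutions.

*The rate function.* Differentiating `q` in the correlation gives an elementary formula
(`hasDerivAt_pairProb`), so that `F` has the derivative `rateDeriv`, which is of order `-1 / √β`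
at `0`, and `F''(1/2)` is explicit. That `F''(1/2) < 0` for every density below the critical one
amounts to the numerical inequality `capacityGap_pos`. The condition of a single critical point then
applies and makes `F` decrease and then increase on `[0, 1/2]`. Since
`F(0) = α log p < F(1/2)`, this gives the critical distance and, below it,
`F(β) - α log p ≤ -c √β` (`exists_criticalDistance`), as well as the quadratic gap
`F(β) ≤ F(1/2) - c (2 β - 1) ^ 2` (`rate_quadratic_gap`).

*First moments.* There are at most `exp (N H(d / N))` points at distance `d` from a given one. Hence
the expected number of pairs of distinct solutions at distance at most `(βc - δ) N` is at most
`exp (-c √N)`, up to polynomial factors, times the expected number `2 ^ N * p ^ m` of solutions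
(`expect_pairSum_close_le`). It remains to see that the number of solutions is, with probability
tending to one, at least `exp (-o(√N))` times its mean. This also gives `S ≠ ∅`, so the conditioning
is harmless, and the proportion of solutions with a close neighbour tends to zero
(`tendsto_randomModel_isolated`).

*The number of solutions.* Its second moment exceeds the square of its mean by a constant factor, so
Chebyshev's inequality is not enough. Instead the constraints are added one at a time, and the
expected decrease of the logarithm of `M`, the number of solutions divided by its mean, is
followed; the logarithm is truncated, as `log (M + τ)`.

* Adding a constraint to a set `T` loses, to second order, the relative variance of the proportion
  of `T` that satisfies it. This variance is at most a constant times the mean squared overlap of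
  two points of `T` (`pairProb_le_add`).
* By the Gibbs variational inequality the mean squared overlap is at most
  `(log N - 2 log M) / (c N)`, up to a term of bounded mean coming from the moment of
  `exp (c N ρ ^ 2)`, where `ρ` is the overlap of two points (`pairSum_overlap_sq_le`). The first
  moment of that sum over pairs is bounded by the quadratic gap of `F`
  (`expect_pairSum_exp_le`).
* The second-order expansion fails when the constraint removes nearly all of `T`. That is
  unlikely: `k` random points of `T` would then all violate the constraint with probability close to
  one, while nearly orthogonal points violate it almost independently, as one sees by adding a
  small Gaussian noise that makes them exactly independent (`prob_all_fail_le`,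
  `prob_small_fraction_le`).

Summing the losses with a discrete Grönwall argument (`logDefect_le`) shows that
`-E log (M + τ)` is small compared with `N ^ (1 / 4)` for `τ = exp (-N ^ (1 / 4))`, and Markov's
inequality gives `M ≥ τ` with probability tending to one (`tendsto_expect_small`).
-/

noncomputable section

namespace SymPerceptron

/-! ### Gaussian laws -/

/-- The law of a single standard Gaussian vector in `ℝ^N`. -/
def rowLaw (N : ℕ) : Measure (Fin N → ℝ) := Measure.pi fun _ => gaussianReal 0 1

instance (N : ℕ) : IsProbabilityMeasure (rowLaw N) := by
  unfold rowLaw; infer_instance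

/-- The image of a standard Gaussian vector under the matrix `V` is the centred Gaussian vector of
covariance `V Vᵀ`. -/
theorem map_mulVec_pi_gaussianReal {ι J : Type*} [Fintype ι] [DecidableEq ι] [Fintype J]
    (V : Matrix ι J ℝ) :
    (Measure.pi fun _ : J => gaussianReal 0 1).map (fun x => WithLp.toLp 2 (V.mulVec x)) =
      multivariateGaussian 0 (V * V.transpose) := by
  classical
  have hm : Measurable fun x : J → ℝ => WithLp.toLp 2 (V.mulVec x) := by
    refine (PiLp.continuous_toLp 2 _).measurable.comp ?_
    exact (Continuous.matrix_mulVec continuous_const continuous_id).measurable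
  have hm2 : Measurable (WithLp.toLp 2 : (J → ℝ) → EuclideanSpace ℝ J) :=
    (PiLp.continuous_toLp 2 _).measurable
  have hpos : (V * V.transpose).PosSemidef := by
    simpa using Matrix.posSemidef_self_mul_conjTranspose V
  have : IsProbabilityMeasure ((Measure.pi fun _ : J => gaussianReal 0 1).map
      (fun x => WithLp.toLp 2 (V.mulVec x))) :=
    Measure.isProbabilityMeasure_map hm.aemeasurable
  apply Measure.ext_of_charFun (E := EuclideanSpace ℝ ι)
  ext t
  rw [charFun_multivariateGaussian hpos, charFun_apply,
    integral_map hm.aemeasurable (Measurable.aestronglyMeasurable (by fun_prop))]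
  have h1 : charFun (stdGaussian (EuclideanSpace ℝ J))
      (WithLp.toLp 2 (V.transpose.mulVec t.ofLp)) =
      ∫ x : J → ℝ, Complex.exp (inner ℝ (WithLp.toLp 2 (V.mulVec x)) t * Complex.I)
        ∂(Measure.pi fun _ : J => gaussianReal 0 1) := by
    rw [← map_pi_eq_stdGaussian, charFun_apply,
      integral_map hm2.aemeasurable (Measurable.aestronglyMeasurable (by fun_prop))]
    refine integral_congr_ae (ae_of_all _ fun x => ?_)
    simp only [EuclideanSpace.inner_eq_star_dotProduct, star_trivial]
    rw [Matrix.mulVec_transpose, ← Matrix.dotProduct_mulVec]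
  rw [← h1, charFun_stdGaussian]
  congr 1
  simp only [inner_zero_right, Complex.ofReal_zero, zero_mul, zero_sub, neg_div]
  congr 2
  rw [← Complex.ofReal_pow, EuclideanSpace.real_norm_sq_eq]
  congr 1
  rw [← Matrix.mulVec_mulVec, Matrix.dotProduct_mulVec, ← Matrix.mulVec_transpose]
  simp [dotProduct, sq]

/-- The Cholesky decomposition of the covariance of a pair of correlation `a`. -/
theorem pairCov_eq {a : ℝ} (ha : a ^ 2 ≤ 1) :
    (!![1, a; a, 1] : Matrix (Fin 2) (Fin 2) ℝ) =
      !![1, 0; a, √(1 - a ^ 2)] * (!![1, 0; a, √(1 - a ^ 2)] : Matrix _ _ ℝ).transpose := by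
  have h : √(1 - a ^ 2) * √(1 - a ^ 2) = 1 - a ^ 2 := Real.mul_self_sqrt (by linarith)
  ext i j
  fin_cases i <;> fin_cases j <;> simp [Matrix.mul_apply, Fin.sum_univ_two]; nlinarith

theorem measurableSet_square (κ : ℝ) :
    MeasurableSet {z : EuclideanSpace ℝ (Fin 2) | |z 0| ≤ κ ∧ |z 1| ≤ κ} := by
  exact (measurableSet_le (f := fun z : EuclideanSpace ℝ (Fin 2) => |z 0|) (by fun_prop)
    measurable_const).inter (measurableSet_le (f := fun z : EuclideanSpace ℝ (Fin 2) => |z 1|)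
    (by fun_prop) measurable_const)

/-- The two constraints for a pair of correlation `2 β - 1`, in independent coordinates. -/
theorem pairProb_eq_prod (κ : ℝ) {β : ℝ} (hβ : β ∈ Set.Icc (0 : ℝ) 1) :
    pairProb κ β = ((gaussianReal 0 1).prod (gaussianReal 0 1)).real
      {z | |z.1| ≤ κ ∧ |(2 * β - 1) * z.1 + √(1 - (2 * β - 1) ^ 2) * z.2| ≤ κ} := by
  have ha : (2 * β - 1) ^ 2 ≤ 1 := by nlinarith [hβ.1, hβ.2]
  rw [pairProb, pairCov_eq ha, ← map_mulVec_pi_gaussianReal]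
  have h2 := (measurePreserving_finTwoArrow_vec (gaussianReal 0 1) (gaussianReal 0 1)).symm
  have hm : Measurable fun x : Fin 2 → ℝ => WithLp.toLp 2
      ((!![1, 0; 2 * β - 1, √(1 - (2 * β - 1) ^ 2)] : Matrix (Fin 2) (Fin 2) ℝ).mulVec x) := by
    refine (PiLp.continuous_toLp 2 _).measurable.comp ?_
    exact (Continuous.matrix_mulVec continuous_const continuous_id).measurable
  rw [map_measureReal_apply hm (measurableSet_square κ)]
  have h3 : (fun _ : Fin 2 => gaussianReal 0 1) = ![gaussianReal 0 1, gaussianReal 0 1] := by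
    ext i; fin_cases i <;> rfl
  rw [h3, ← h2.map_eq, map_measureReal_apply h2.measurable (hm (measurableSet_square κ))]
  congr 1
  ext z
  simp [dotProduct, Fin.sum_univ_two]

theorem measurableSet_pair (κ a b : ℝ) :
    MeasurableSet {z : ℝ × ℝ | |z.1| ≤ κ ∧ |a * z.1 + b * z.2| ≤ κ} := by
  exact (measurableSet_le (f := fun z : ℝ × ℝ => |z.1|) (by fun_prop)
    measurable_const).inter (measurableSet_le (f := fun z : ℝ × ℝ => |a * z.1 + b * z.2|)
    (by fun_prop) measurable_const)

theorem pairProb_one_sub (κ : ℝ) {β : ℝ} (hβ : β ∈ Set.Icc (0 : ℝ) 1) :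
    pairProb κ (1 - β) = pairProb κ β := by
  have hβ' : 1 - β ∈ Set.Icc (0 : ℝ) 1 := ⟨by linarith [hβ.2], by linarith [hβ.1]⟩
  rw [pairProb_eq_prod κ hβ, pairProb_eq_prod κ hβ']
  have hneg : MeasurePreserving (fun x : ℝ => -x) (gaussianReal 0 1) (gaussianReal 0 1) :=
    ⟨by fun_prop, by simp [gaussianReal_map_neg]⟩
  have hp := (MeasurePreserving.id (gaussianReal 0 1)).prod hneg
  rw [← hp.map_eq, map_measureReal_apply hp.measurable (measurableSet_pair _ _ _), hp.map_eq]
  congr 1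
  ext z
  simp only [Set.preimage_ofPred_eq, Set.mem_ofPred_eq, Prod.map_fst, Prod.map_snd, id]
  have e1 : (2 * (1 - β) - 1) = -(2 * β - 1) := by ring
  rw [e1, neg_sq, ← abs_neg (-(2 * β - 1) * z.1 + _)]
  ring_nf

theorem pairProb_one (κ : ℝ) : pairProb κ 1 = gaussProb κ := by
  rw [pairProb_eq_prod κ (by simp), gaussProb]
  have : {z : ℝ × ℝ | |z.1| ≤ κ ∧ |(2 * 1 - 1) * z.1 + √(1 - (2 * 1 - 1) ^ 2) * z.2| ≤ κ}
      = {z : ℝ | |z| ≤ κ} ×ˢ Set.univ := by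
    ext z; norm_num
  rw [this, measureReal_prod_prod]
  simp

theorem pairProb_zero (κ : ℝ) : pairProb κ 0 = gaussProb κ := by
  rw [← pairProb_one, ← pairProb_one_sub κ (β := 1) (by simp)]; simp

theorem pairProb_half (κ : ℝ) : pairProb κ (1 / 2) = gaussProb κ ^ 2 := by
  rw [pairProb_eq_prod κ (by norm_num), gaussProb]
  have : {z : ℝ × ℝ | |z.1| ≤ κ ∧
      |(2 * (1 / 2) - 1) * z.1 + √(1 - (2 * (1 / 2) - 1) ^ 2) * z.2| ≤ κ}
      = {z : ℝ | |z| ≤ κ} ×ˢ {z : ℝ | |z| ≤ κ} := by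
    ext z; norm_num
  rw [this, measureReal_prod_prod, sq]

theorem pairProb_nonneg (κ β : ℝ) : 0 ≤ pairProb κ β := measureReal_nonneg

theorem measurableSet_abs_le (κ : ℝ) : MeasurableSet {z : ℝ | |z| ≤ κ} :=
  measurableSet_le (by fun_prop) measurable_const

theorem pairProb_le_gaussProb (κ : ℝ) {β : ℝ} (hβ : β ∈ Set.Icc (0 : ℝ) 1) :
    pairProb κ β ≤ gaussProb κ := by
  rw [pairProb_eq_prod κ hβ, gaussProb]
  have : (gaussianReal 0 1).real {z : ℝ | |z| ≤ κ} =
      ((gaussianReal 0 1).prod (gaussianReal 0 1)).real ({z : ℝ | |z| ≤ κ} ×ˢ Set.univ) := by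
    rw [measureReal_prod_prod]; simp
  rw [this]
  exact measureReal_mono (fun z hz => ⟨hz.1, trivial⟩)

theorem gaussProb_pos {κ : ℝ} (hκ : 0 < κ) : 0 < gaussProb κ := by
  have : Measure.IsOpenPosMeasure (gaussianReal 0 1) := by
    have h := gaussianReal_absolutelyContinuous' 0 (v := 1) one_ne_zero
    exact h.isOpenPosMeasure
  refine lt_of_lt_of_le ?_ (measureReal_mono (s₁ := Set.Ioo (-κ) κ) (fun z hz => ?_))
  · exact ENNReal.toReal_pos (isOpen_Ioo.measure_pos _ ⟨0, by simp [hκ]⟩).ne' (measure_ne_top _ _)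
  · exact abs_le.2 ⟨hz.1.le, hz.2.le⟩

theorem gaussProb_lt_one (κ : ℝ) : gaussProb κ < 1 := by
  have : Measure.IsOpenPosMeasure (gaussianReal 0 1) :=
    (gaussianReal_absolutelyContinuous' 0 (v := 1) one_ne_zero).isOpenPosMeasure
  have h := measureReal_add_measureReal_compl (μ := gaussianReal 0 1) (measurableSet_abs_le κ)
  have h2 : 0 < (gaussianReal 0 1).real {z : ℝ | |z| ≤ κ}ᶜ := by
    refine ENNReal.toReal_pos (IsOpen.measure_pos _ ?_ ⟨|κ| + 1, ?_⟩).ne' (measure_ne_top _ _)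
    · exact (isClosed_le (by fun_prop) continuous_const).isOpen_compl
    · simp only [Set.mem_compl_iff, Set.mem_ofPred_eq, not_le]
      rw [abs_of_pos (by positivity)]
      linarith [le_abs_self κ]
  rw [probReal_univ] at h
  unfold gaussProb
  linarith

/-- Continuity includes the endpoints, where the pair is degenerate. -/
theorem continuousOn_pairProb (κ : ℝ) : ContinuousOn (pairProb κ) (Set.Icc 0 1) := by
  set μ := (gaussianReal 0 1).prod (gaussianReal 0 1)
  let f : ℝ → ℝ × ℝ → ℝ := fun β => Set.indicator
    {z : ℝ × ℝ | |z.1| ≤ κ ∧ |(2 * β - 1) * z.1 + √(1 - (2 * β - 1) ^ 2) * z.2| ≤ κ} 1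
  have hf : ∀ β ∈ Set.Icc (0 : ℝ) 1, pairProb κ β = ∫ z, f β z ∂μ := fun β hβ => by
    rw [integral_indicator_one (measurableSet_pair _ _ _), pairProb_eq_prod κ hβ]
  refine ContinuousOn.congr ?_ hf
  intro β₀ hβ₀
  refine tendsto_integral_filter_of_dominated_convergence (fun _ => 1) ?_ ?_ (by simp) ?_
  · exact Eventually.of_forall fun β =>
      (measurable_const.indicator (measurableSet_pair _ _ _)).aestronglyMeasurable
  · refine Eventually.of_forall fun β => ae_of_all _ fun z => ?_
    simp only [f, Set.indicator_apply]
    split_ifs <;> simp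
  · -- The second linear form has a standard Gaussian law, so it a.s. avoids `± κ`.
    have hnull : ∀ᵐ z ∂μ,
        |(2 * β₀ - 1) * z.1 + √(1 - (2 * β₀ - 1) ^ 2) * z.2| ≠ κ := by
      have h1 : (1 - (2 * β₀ - 1) ^ 2) ≥ 0 := by nlinarith [hβ₀.1, hβ₀.2]
      have hna : NullSingletonClass (gaussianReal 0 1) := nullSingletonClass_gaussianReal one_ne_zero
      have hfin : ∀ᵐ x ∂gaussianReal 0 1, ∀ c ∈ ({-κ, κ} : Set ℝ), x ≠ c := by
        have : ∀ᵐ x ∂gaussianReal 0 1, x ∉ ({-κ, κ} : Set ℝ) :=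
          (Set.toFinite _).countable.ae_notMem _
        filter_upwards [this] with x hx c hc h
        exact hx (h ▸ hc)
      rcases h1.lt_or_eq with h | h
      · have hs : 0 < √(1 - (2 * β₀ - 1) ^ 2) := Real.sqrt_pos.2 h
        rw [Measure.ae_prod_iff_ae_ae]
        · refine ae_of_all _ fun x => ?_
          have : ∀ᵐ y ∂gaussianReal 0 1, y ∉ ({(-κ - (2 * β₀ - 1) * x) / √(1 - (2 * β₀ - 1) ^ 2),
              (κ - (2 * β₀ - 1) * x) / √(1 - (2 * β₀ - 1) ^ 2)} : Set ℝ) :=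
            (Set.toFinite _).countable.ae_notMem _
          filter_upwards [this] with y hy h
          apply hy
          simp only [Set.mem_insert_iff, Set.mem_singleton_iff, eq_div_iff hs.ne']
          rcases abs_eq_abs.1 (h.trans (abs_of_nonneg ((abs_nonneg _).trans h.le)).symm) with h | h
          · right; linarith
          · left; linarith
        · refine MeasurableSet.compl (measurableSet_eq_fun (by fun_prop) measurable_const)
      · have hs : √(1 - (2 * β₀ - 1) ^ 2) = 0 := by rw [← h]; simp
        have hsq : |2 * β₀ - 1| = 1 := by
          rw [← Real.sqrt_sq_eq_abs, show (2 * β₀ - 1) ^ 2 = 1 by linarith, Real.sqrt_one]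
        have := (Measure.quasiMeasurePreserving_fst (μ := gaussianReal 0 1)
          (ν := gaussianReal 0 1)).ae hfin
        filter_upwards [this] with z hz h
        rw [hs, zero_mul, add_zero, abs_mul, hsq, one_mul] at h
        rcases abs_eq_abs.1 (h.trans (abs_of_nonneg ((abs_nonneg _).trans h.le)).symm) with h | h
        · exact hz κ (by simp) h
        · exact hz (-κ) (by simp) h
    filter_upwards [hnull] with z hz
    have hc : Continuous fun β : ℝ => |(2 * β - 1) * z.1 + √(1 - (2 * β - 1) ^ 2) * z.2| := by
      fun_prop
    refine tendsto_const_nhds.congr' ?_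
    refine Filter.Eventually.filter_mono nhdsWithin_le_nhds ?_
    rcases hz.lt_or_gt with h | h
    · filter_upwards [hc.continuousAt.eventually_lt continuousAt_const h] with β hβ
      simp only [f, Set.indicator_apply, Set.mem_ofPred_eq, h.le, hβ.le]
    · filter_upwards [continuousAt_const.eventually_lt hc.continuousAt h] with β hβ
      simp only [f, Set.indicator_apply, Set.mem_ofPred_eq, h.not_ge, hβ.not_ge]

/-! ### Constraints at points of prescribed overlap -/

/-- The normalised overlap `⟨σ, τ⟩ / N` of two points of the cube, written through their Hamming
distance; see `sum_mul_eq_overlap`. -/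
def overlap {N : ℕ} (σ τ : Cube N) : ℝ := 1 - 2 * (hammingDist σ τ / N : ℝ)

theorem sum_mul_eq_sub_hammingDist {N : ℕ} (σ τ : Cube N) :
    ∑ j, (((σ j : ℤˣ) : ℤ) : ℝ) * (((τ j : ℤˣ) : ℤ) : ℝ) = N - 2 * hammingDist σ τ := by
  have h : ∀ j, (((σ j : ℤˣ) : ℤ) : ℝ) * (((τ j : ℤˣ) : ℤ) : ℝ) =
      1 - 2 * (if σ j ≠ τ j then 1 else 0) := by
    intro j
    rcases Int.units_eq_one_or (σ j) with h1 | h1 <;>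
      rcases Int.units_eq_one_or (τ j) with h2 | h2 <;> simp [h1, h2] <;> norm_num
  simp_rw [h]
  rw [Finset.sum_sub_distrib, ← Finset.mul_sum, Finset.sum_boole]
  simp [hammingDist]

theorem sum_mul_eq_overlap {N : ℕ} (hN : 0 < N) (σ τ : Cube N) :
    ∑ j, (((σ j : ℤˣ) : ℤ) : ℝ) * (((τ j : ℤˣ) : ℤ) : ℝ) = N * overlap σ τ := by
  have : (N : ℝ) ≠ 0 := by positivity
  rw [sum_mul_eq_sub_hammingDist, overlap]
  field_simp

theorem overlap_self {N : ℕ} (σ : Cube N) : overlap σ σ = 1 := by simp [overlap]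

/-- The matrix of the normalised linear forms `x ↦ ⟨x, σ⟩ / √N`. -/
def formMatrix {N : ℕ} {ι : Type*} (s : ι → Cube N) : Matrix ι (Fin N) ℝ :=
  Matrix.of fun i j => (((s i j : ℤˣ) : ℤ) : ℝ) / √(N : ℝ)

theorem formMatrix_mul_transpose {N : ℕ} (hN : 0 < N) {ι : Type*} [Fintype ι] (s : ι → Cube N) :
    formMatrix s * (formMatrix s).transpose = Matrix.of fun i j => overlap (s i) (s j) := by
  have h : (N : ℝ) ≠ 0 := by positivity
  ext i j
  simp only [Matrix.mul_apply, formMatrix, Matrix.transpose_apply, Matrix.of_apply]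
  have h2 : ∀ l, (((s i l : ℤˣ) : ℤ) : ℝ) / √(N : ℝ) * ((((s j l : ℤˣ) : ℤ) : ℝ) / √(N : ℝ)) =
      (((s i l : ℤˣ) : ℤ) : ℝ) * (((s j l : ℤˣ) : ℤ) : ℝ) / N := fun l => by
    rw [div_mul_div_comm, Real.mul_self_sqrt (by positivity)]
  simp_rw [h2]
  rw [← Finset.sum_div, sum_mul_eq_overlap hN]
  field_simp

theorem mem_constraintSet_iff {N : ℕ} (hN : 0 < N) {ι : Type*} (s : ι → Cube N)
    (κ : ℝ) (x : Fin N → ℝ) (i : ι) :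
    s i ∈ constraintSet κ x ↔ |(formMatrix s).mulVec x i| ≤ κ := by
  have h : 0 < √(N : ℝ) := by positivity
  have h2 : (formMatrix s).mulVec x i = innerCube x (s i) / √(N : ℝ) := by
    simp only [Matrix.mulVec, dotProduct, formMatrix, Matrix.of_apply, innerCube, Finset.sum_div]
    exact Finset.sum_congr rfl fun j _ => by ring
  rw [h2, abs_div, abs_of_pos h, div_le_iff₀ h]
  rfl

theorem measurableSet_mem_constraintSet (κ : ℝ) {N : ℕ} (σ : Cube N) :
    MeasurableSet {x : Fin N → ℝ | σ ∈ constraintSet κ x} := by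
  change MeasurableSet {x : Fin N → ℝ | |innerCube x σ| ≤ κ * √(N : ℝ)}
  refine measurableSet_le ?_ measurable_const
  unfold innerCube
  fun_prop

theorem measurable_formMatrix {N : ℕ} {ι : Type*} [Fintype ι] (s : ι → Cube N) :
    Measurable fun x : Fin N → ℝ => WithLp.toLp 2 ((formMatrix s).mulVec x) := by
  refine (PiLp.continuous_toLp 2 _).measurable.comp ?_
  exact (Continuous.matrix_mulVec continuous_const continuous_id).measurable

/-- The probability that a pair of points satisfies a random constraint. -/
theorem prob_pair {N : ℕ} (hN : 0 < N) (κ : ℝ) (σ τ : Cube N) :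
    (rowLaw N).real {x | σ ∈ constraintSet κ x ∧ τ ∈ constraintSet κ x} =
      pairProb κ (1 - hammingDist σ τ / N) := by
  have hc : (!![1, 2 * (1 - (hammingDist σ τ : ℝ) / N) - 1;
      2 * (1 - (hammingDist σ τ : ℝ) / N) - 1, 1] : Matrix (Fin 2) (Fin 2) ℝ) =
      formMatrix ![σ, τ] * (formMatrix ![σ, τ]).transpose := by
    rw [formMatrix_mul_transpose hN]
    ext i j
    fin_cases i <;> fin_cases j <;> simp [overlap, hammingDist_comm τ σ] <;> ring
  rw [pairProb, hc, ← map_mulVec_pi_gaussianReal,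
    map_measureReal_apply (measurable_formMatrix _) (measurableSet_square κ)]
  unfold rowLaw
  congr 1
  ext x
  have h0 := mem_constraintSet_iff hN ![σ, τ] κ x 0
  have h1 := mem_constraintSet_iff hN ![σ, τ] κ x 1
  simp only [Matrix.cons_val_zero, Matrix.cons_val_one] at h0 h1
  simp only [Set.mem_ofPred_eq, Set.mem_preimage, h0, h1]

theorem prob_single {N : ℕ} (hN : 0 < N) (κ : ℝ) (σ : Cube N) :
    (rowLaw N).real {x | σ ∈ constraintSet κ x} = gaussProb κ := by
  have := prob_pair hN κ σ σ
  simpa [pairProb_one] using this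

/-- A correlation matrix with off-diagonal entries at most `η` is at most `1 + k η`. -/
theorem posSemidef_smul_one_sub {k : ℕ} {η : ℝ} (hη : 0 ≤ η) {C : Matrix (Fin k) (Fin k) ℝ}
    (hC : C.IsHermitian) (hd : ∀ i, C i i = 1) (ho : ∀ i j, i ≠ j → |C i j| ≤ η) :
    ((1 + k * η) • (1 : Matrix (Fin k) (Fin k) ℝ) - C).PosSemidef := by
  refine Matrix.PosSemidef.of_dotProduct_mulVec_nonneg ?_ fun x => ?_
  · refine Matrix.IsHermitian.sub ?_ hC
    rw [Matrix.IsHermitian, Matrix.conjTranspose_smul, Matrix.conjTranspose_one, star_trivial]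
  · have h1 : star x ⬝ᵥ ((1 + k * η) • (1 : Matrix (Fin k) (Fin k) ℝ) - C).mulVec x =
        k * η * ∑ i, x i ^ 2 - ∑ i, ∑ j, x i * (if i = j then 0 else C i j) * x j := by
      have e : ∀ i j, x i * (if i = j then 0 else C i j) * x j =
          x i * C i j * x j - if i = j then x i * x i else 0 := by
        intro i j
        split_ifs with h
        · subst h; rw [hd]; ring
        · ring
      simp_rw [e, Finset.sum_sub_distrib, Finset.sum_ite_eq, Finset.mem_univ, if_true]
      rw [Matrix.sub_mulVec, dotProduct_sub, Matrix.smul_mulVec, Matrix.one_mulVec]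
      simp only [dotProduct, star_trivial, Pi.smul_apply, smul_eq_mul, Matrix.mulVec]
      have e2 : ∑ i, x i * ((1 + k * η) * x i) = (1 + k * η) * ∑ i, x i ^ 2 := by
        rw [Finset.mul_sum]; exact Finset.sum_congr rfl fun i _ => by ring
      have e3 : ∑ i, x i * ∑ j, C i j * x j = ∑ i, ∑ j, x i * C i j * x j := by
        refine Finset.sum_congr rfl fun i _ => ?_
        rw [Finset.mul_sum]; exact Finset.sum_congr rfl fun j _ => by ring
      have e4 : ∑ i, x i * x i = ∑ i, x i ^ 2 := Finset.sum_congr rfl fun i _ => by ring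
      rw [e2, e3, e4]; ring
    rw [h1]
    have h2 : ∑ i, ∑ j, x i * (if i = j then 0 else C i j) * x j ≤
        η * (∑ i, |x i|) ^ 2 := by
      rw [sq, Finset.sum_mul_sum, Finset.mul_sum]
      refine Finset.sum_le_sum fun i _ => ?_
      rw [Finset.mul_sum]
      refine Finset.sum_le_sum fun j _ => ?_
      refine (le_abs_self _).trans ?_
      rw [abs_mul, abs_mul]
      have : |if i = j then 0 else C i j| ≤ η := by
        split_ifs with h
        · simpa using hη
        · exact ho i j h
      calc |x i| * |if i = j then 0 else C i j| * |x j| ≤ |x i| * η * |x j| := by gcongr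
        _ = η * (|x i| * |x j|) := by ring
    have h3 : (∑ i, |x i|) ^ 2 ≤ k * ∑ i, x i ^ 2 := by
      have := sq_sum_le_card_mul_sum_sq (s := Finset.univ) (f := fun i => |x i|)
      simpa using this
    nlinarith [mul_le_mul_of_nonneg_left h3 hη]

theorem multivariateGaussian_conv {ι : Type*} [Fintype ι] [DecidableEq ι] {A B : Matrix ι ι ℝ}
    (hA : A.PosSemidef) (hB : B.PosSemidef) :
    (multivariateGaussian 0 A).conv (multivariateGaussian 0 B) =
      multivariateGaussian 0 (A + B) := by
  apply Measure.ext_of_charFun (E := EuclideanSpace ℝ ι)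
  ext t
  rw [charFun_conv, charFun_multivariateGaussian hA, charFun_multivariateGaussian hB,
    charFun_multivariateGaussian (hA.add hB), ← Complex.exp_add, Matrix.add_mulVec, dotProduct_add]
  congr 1
  push_cast
  simp
  ring

theorem multivariateGaussian_smul_one {ι : Type*} [Fintype ι] [DecidableEq ι] {c : ℝ}
    (hc : 0 ≤ c) :
    multivariateGaussian 0 (c • (1 : Matrix ι ι ℝ)) =
      (Measure.pi fun _ : ι => gaussianReal 0 1).map fun x => WithLp.toLp 2 (√c • x) := by
  have h : c • (1 : Matrix ι ι ℝ) = (√c • 1) * (√c • (1 : Matrix ι ι ℝ)).transpose := by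
    rw [Matrix.transpose_smul, Matrix.transpose_one, Matrix.smul_mul, Matrix.mul_smul, smul_smul,
      Real.mul_self_sqrt hc, Matrix.mul_one]
  rw [h, ← map_mulVec_pi_gaussianReal]
  simp [Matrix.smul_mulVec]

theorem gaussProb_mono {a b : ℝ} (h : a ≤ b) : gaussProb a ≤ gaussProb b :=
  measureReal_mono fun _ hz => le_trans hz h

theorem measurableSet_forall_lt {k : ℕ} (a : ℝ) :
    MeasurableSet {z : EuclideanSpace ℝ (Fin k) | ∀ i, a < |z i|} := by
  have : {z : EuclideanSpace ℝ (Fin k) | ∀ i, a < |z i|} = ⋂ i, {z | a < |z i|} := by ext; simp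
  rw [this]
  exact MeasurableSet.iInter fun i => measurableSet_lt measurable_const (by fun_prop)

/-- Nearly orthogonal points fail a random constraint nearly independently. Adding an independent
Gaussian noise of small variance `k η` turns the linear forms into independent ones of
variance `1 + k η`; the noise is too small to spoil the failures. -/
theorem prob_all_fail_le {κ : ℝ} (hκ : 0 < κ) {N k : ℕ} (hN : 0 < N) (s : Fin k → Cube N)
    {η : ℝ} (hη : 0 ≤ η) (hη1 : k * η ≤ 1) (hηκ : 8 * (k : ℝ) ^ 2 * η ≤ κ ^ 2)
    (hs : ∀ i j, i ≠ j → |overlap (s i) (s j)| ≤ η) :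
    (rowLaw N).real {x | ∀ i, s i ∉ constraintSet κ x} ≤ 2 * (1 - gaussProb (κ / 4)) ^ k := by
  set C : Matrix (Fin k) (Fin k) ℝ := Matrix.of fun i j => overlap (s i) (s j) with hCdef
  have hCV := formMatrix_mul_transpose hN s
  have hCpos : C.PosSemidef := by
    rw [hCdef, ← hCV]; simpa using Matrix.posSemidef_self_mul_conjTranspose (formMatrix s)
  have hDpos : ((1 + k * η) • (1 : Matrix (Fin k) (Fin k) ℝ) - C).PosSemidef :=
    posSemidef_smul_one_sub hη hCpos.1 (fun i => overlap_self _) hs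
  set D := (1 + k * η) • (1 : Matrix (Fin k) (Fin k) ℝ) - C with hD
  have hconv := multivariateGaussian_conv hCpos hDpos
  have hkη : 0 ≤ k * η := by positivity
  rw [hD, add_sub_cancel, multivariateGaussian_smul_one (by positivity), ← hD] at hconv
  set G := multivariateGaussian 0 C with hG
  set H := multivariateGaussian 0 D with hH
  have hGlaw : (rowLaw N).real {x | ∀ i, s i ∉ constraintSet κ x} =
      G.real {z | ∀ i, κ < |z i|} := by
    rw [hG, hCdef, ← hCV, ← map_mulVec_pi_gaussianReal,
      map_measureReal_apply (measurable_formMatrix _) (measurableSet_forall_lt κ)]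
    unfold rowLaw
    congr 1
    ext x
    simp only [Set.mem_ofPred_eq, Set.mem_preimage, mem_constraintSet_iff hN, not_le]
  have hHlaw : 1 / 2 ≤ H.real {z | ∀ i, |z i| ≤ κ / 2} := by
    have hcompl : {z : EuclideanSpace ℝ (Fin k) | ∀ i, |z i| ≤ κ / 2} =
        (⋃ i, {z | κ / 2 < |z i|})ᶜ := by
      ext z; simp
    have hmeas : ∀ i : Fin k, MeasurableSet {z : EuclideanSpace ℝ (Fin k) | κ / 2 < |z i|} :=
      fun i => measurableSet_lt measurable_const (by fun_prop)
    rw [hcompl, probReal_compl_eq_one_sub (MeasurableSet.iUnion hmeas)]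
    have hi : ∀ i, H.real {z | κ / 2 < |z i|} ≤ k * η / (κ / 2) ^ 2 := by
      intro i
      have hmp := measurePreserving_eval_multivariateGaussian (μ := 0) hDpos (i := i)
      have hDii : D i i = k * η := by simp [hD, hCdef, overlap_self]
      rw [hDii] at hmp
      have hch := meas_ge_le_variance_div_sq (μ := gaussianReal (0 : ℝ) (k * η).toNNReal)
        (X := id) (memLp_id_gaussianReal 2) (c := κ / 2) (by positivity)
      have hset : {z : EuclideanSpace ℝ (Fin k) | κ / 2 < |z i|} =
        (fun z : EuclideanSpace ℝ (Fin k) => z i) ⁻¹' {y : ℝ | κ / 2 < |y|} := rfl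
      have hm : MeasurableSet {y : ℝ | κ / 2 < |y|} :=
        measurableSet_lt measurable_const (by fun_prop)
      rw [hset, ← map_measureReal_apply hmp.measurable hm, hmp.map_eq, measureReal_def]
      refine ENNReal.toReal_le_of_le_ofReal (by positivity) ?_
      rw [variance_id_gaussianReal, Real.coe_toNNReal _ hkη] at hch
      refine le_trans (measure_mono fun y hy => ?_) hch
      have hy' : κ / 2 < |y| := hy
      simpa using hy'.le
    have hle : H.real (⋃ i, {z | κ / 2 < |z i|}) ≤ ∑ i : Fin k, k * η / (κ / 2) ^ 2 :=
      (measureReal_iUnion_fintype_le _).trans (Finset.sum_le_sum fun i _ => hi i)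
    have : ∑ i : Fin k, (k : ℝ) * η / (κ / 2) ^ 2 ≤ 1 / 2 := by
      rw [Finset.sum_const, Finset.card_univ, Fintype.card_fin, nsmul_eq_mul, ← mul_div_assoc,
        div_le_iff₀ (by positivity)]
      nlinarith
    linarith
  have hprod : G.real {z | ∀ i, κ < |z i|} * H.real {z | ∀ i, |z i| ≤ κ / 2} ≤
      (G.conv H).real {z | ∀ i, κ / 2 < |z i|} := by
    rw [Measure.conv, map_measureReal_apply (by fun_prop) (measurableSet_forall_lt _),
      ← measureReal_prod_prod]
    refine measureReal_mono ?_
    rintro ⟨a, b⟩ ⟨ha, hb⟩ i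
    have h1 := ha i
    have h2 := hb i
    simp only [PiLp.add_apply]
    have h3 : |a i| ≤ |a i + b i| + |b i| := by
      have := abs_sub (a i + b i) (b i); simpa using this
    linarith
  have hpi : (G.conv H).real {z | ∀ i, κ / 2 < |z i|} ≤ (1 - gaussProb (κ / 4)) ^ k := by
    have hmeas : Measurable fun x : Fin k → ℝ =>
        (WithLp.toLp 2 (√(1 + k * η) • x) : EuclideanSpace ℝ (Fin k)) :=
      (PiLp.continuous_toLp 2 _).measurable.comp (by fun_prop)
    rw [hconv, map_measureReal_apply hmeas (measurableSet_forall_lt _)]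
    have hsq : √(1 + k * η) ≤ 2 := Real.sqrt_le_iff.2 ⟨by norm_num, by linarith⟩
    refine (measureReal_mono (s₂ := Set.univ.pi fun _ => {y : ℝ | |y| ≤ κ / 4}ᶜ) ?_).trans ?_
    · intro x hx i _
      have h1 : κ / 2 < |√(1 + k * η) * x i| := hx i
      rw [abs_mul, abs_of_nonneg (Real.sqrt_nonneg _)] at h1
      simp only [Set.mem_compl_iff, Set.mem_ofPred_eq, not_le]
      nlinarith [abs_nonneg (x i)]
    · rw [measureReal_def, Measure.pi_pi, ENNReal.toReal_prod]
      simp only [← measureReal_def]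
      rw [probReal_compl_eq_one_sub (measurableSet_abs_le _)]
      simp [gaussProb]
  rw [hGlaw]
  have hGn : 0 ≤ G.real {z | ∀ i, κ < |z i|} := measureReal_nonneg
  nlinarith

/-! ### The derivative of the pair probability -/

/-- The standard Gaussian density. -/
def phi (x : ℝ) : ℝ := gaussianPDFReal 0 1 x

theorem phi_eq (x : ℝ) : phi x = (√(2 * Real.pi))⁻¹ * Real.exp (-x ^ 2 / 2) := by
  simp [phi, gaussianPDFReal_def]

theorem continuous_phi : Continuous phi := by
  simp_rw [funext phi_eq]; fun_prop

theorem phi_nonneg (x : ℝ) : 0 ≤ phi x := gaussianPDFReal_nonneg _ _ _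

theorem phi_mul_phi (x y : ℝ) :
    phi x * phi y = 1 / (2 * Real.pi) * Real.exp (-(x ^ 2 + y ^ 2) / 2) := by
  have h : √(2 * Real.pi) * √(2 * Real.pi) = 2 * Real.pi := Real.mul_self_sqrt (by positivity)
  rw [phi_eq, phi_eq, mul_mul_mul_comm, ← Real.exp_add, ← mul_inv, h, one_div]
  ring_nf

theorem phi_le_one (x : ℝ) : phi x ≤ 1 := by
  rw [phi_eq]
  have h1 : (√(2 * Real.pi))⁻¹ ≤ 1 := inv_le_one_of_one_le₀ (by
    rw [Real.one_le_sqrt]; nlinarith [Real.pi_gt_three])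
  have h2 : Real.exp (-x ^ 2 / 2) ≤ 1 := Real.exp_le_one_iff.2 (by nlinarith [sq_nonneg x])
  exact mul_le_one₀ h1 (Real.exp_nonneg _) h2

/-- The primitive of the Gaussian density vanishing at `0`. -/
def phiPrim (y : ℝ) : ℝ := ∫ t in (0 : ℝ)..y, phi t

theorem hasDerivAt_phiPrim (y : ℝ) : HasDerivAt phiPrim (phi y) y :=
  intervalIntegral.integral_hasDerivAt_right (continuous_phi.intervalIntegrable _ _)
    (continuous_phi.stronglyMeasurableAtFilter _ _) continuous_phi.continuousAt

theorem continuous_phiPrim : Continuous phiPrim :=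
  continuous_iff_continuousAt.2 fun y => (hasDerivAt_phiPrim y).continuousAt

theorem gaussian_real_Icc {a b : ℝ} (hab : a ≤ b) :
    (gaussianReal 0 1).real (Set.Icc a b) = phiPrim b - phiPrim a := by
  rw [measureReal_def, gaussianReal_apply_eq_integral 0 one_ne_zero,
    ENNReal.toReal_ofReal (integral_nonneg fun x => gaussianPDFReal_nonneg _ _ _),
    integral_Icc_eq_integral_Ioc, ← intervalIntegral.integral_of_le hab, phiPrim, phiPrim,
    intervalIntegral.integral_interval_sub_left (continuous_phi.intervalIntegrable _ _)
      (continuous_phi.intervalIntegrable _ _)]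
  rfl

theorem phiPrim_neg (y : ℝ) : phiPrim (-y) = -phiPrim y := by
  have h : ∀ t, phi (-t) = phi t := fun t => by simp [phi_eq]
  have := intervalIntegral.integral_comp_neg (a := 0) (b := -y) phi
  simp only [h, neg_neg, neg_zero] at this
  rw [phiPrim, this, phiPrim, intervalIntegral.integral_symm]

theorem abs_le_set_eq (κ : ℝ) : {z : ℝ | |z| ≤ κ} = Set.Icc (-κ) κ := by
  ext z; simp [abs_le]

theorem gaussProb_eq {κ : ℝ} (hκ : 0 ≤ κ) : gaussProb κ = 2 * phiPrim κ := by
  rw [gaussProb, abs_le_set_eq, gaussian_real_Icc (by linarith), phiPrim_neg]; ring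

/-- The integrand of the pair probability after integrating out the second coordinate. -/
def pairIntegrand (κ ρ x : ℝ) : ℝ :=
  phi x * (phiPrim ((κ - ρ * x) / √(1 - ρ ^ 2)) - phiPrim ((-κ - ρ * x) / √(1 - ρ ^ 2)))

theorem pairProb_eq_integral {κ : ℝ} (hκ : 0 ≤ κ) {ρ : ℝ} (hρ : ρ ∈ Set.Ioo (-1 : ℝ) 1) :
    pairProb κ ((1 + ρ) / 2) = ∫ x in (-κ)..κ, pairIntegrand κ ρ x := by
  have hs : 0 < √(1 - ρ ^ 2) := Real.sqrt_pos.2 (by nlinarith [hρ.1, hρ.2])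
  rw [pairProb_eq_prod κ ⟨by linarith [hρ.1], by linarith [hρ.2]⟩]
  have hr : 2 * ((1 + ρ) / 2) - 1 = ρ := by ring
  rw [hr, ← integral_indicator_one (measurableSet_pair _ _ _), integral_prod]
  · have h1 : ∀ x, ∫ y, Set.indicator {z : ℝ × ℝ | |z.1| ≤ κ ∧ |ρ * z.1 + √(1 - ρ ^ 2) * z.2| ≤ κ}
        (1 : ℝ × ℝ → ℝ) (x, y) ∂gaussianReal 0 1 = Set.indicator (Set.Icc (-κ) κ)
        (fun x => phiPrim ((κ - ρ * x) / √(1 - ρ ^ 2)) -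
          phiPrim ((-κ - ρ * x) / √(1 - ρ ^ 2))) x := by
      intro x
      by_cases hx : x ∈ Set.Icc (-κ) κ
      · rw [Set.indicator_of_mem hx, ← gaussian_real_Icc (by gcongr; linarith),
          ← integral_indicator_one measurableSet_Icc]
        refine integral_congr_ae (ae_of_all _ fun y => ?_)
        simp only [Set.indicator_apply, Set.mem_ofPred_eq, Set.mem_Icc, div_le_iff₀ hs,
          le_div_iff₀ hs, Pi.one_apply]
        congr 1
        rw [abs_le, abs_le]
        simp only [eq_iff_iff]
        constructor
        · rintro ⟨-, h2, h3⟩; constructor <;> linarith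
        · rintro ⟨h2, h3⟩; exact ⟨hx, by linarith, by linarith⟩
      · rw [Set.indicator_of_notMem hx]
        refine integral_eq_zero_of_ae (ae_of_all _ fun y => ?_)
        refine Set.indicator_of_notMem (fun h => hx ?_) _
        exact abs_le.1 h.1
    simp_rw [h1]
    rw [integral_gaussianReal_eq_integral_smul one_ne_zero,
      intervalIntegral.integral_of_le (by linarith), ← integral_Icc_eq_integral_Ioc,
      ← integral_indicator measurableSet_Icc]
    refine integral_congr_ae (ae_of_all _ fun x => ?_)
    simp only [Set.indicator_apply, pairIntegrand, smul_eq_mul, phi]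
    split_ifs <;> simp
  · exact (integrable_indicator_iff (measurableSet_pair _ _ _)).2 (integrable_const _).integrableOn

/-- The derivative of `pairIntegrand` in the correlation. -/
def pairIntegrandDeriv (κ ρ x : ℝ) : ℝ :=
  phi x * (phi ((κ - ρ * x) / √(1 - ρ ^ 2)) * ((κ * ρ - x) / √(1 - ρ ^ 2) ^ 3) -
    phi ((-κ - ρ * x) / √(1 - ρ ^ 2)) * ((-κ * ρ - x) / √(1 - ρ ^ 2) ^ 3))

theorem hasDerivAt_linear_div_sqrt (c x : ℝ) {ρ : ℝ} (hρ : ρ ∈ Set.Ioo (-1 : ℝ) 1) :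
    HasDerivAt (fun r : ℝ => (c - r * x) / √(1 - r ^ 2)) ((c * ρ - x) / √(1 - ρ ^ 2) ^ 3) ρ := by
  have h0 : 0 < 1 - ρ ^ 2 := by nlinarith [hρ.1, hρ.2]
  have hs : 0 < √(1 - ρ ^ 2) := Real.sqrt_pos.2 h0
  have h1 : HasDerivAt (fun r : ℝ => c - r * x) (-x) ρ := by
    simpa using ((hasDerivAt_id ρ).mul_const x).const_sub c
  have h2 : HasDerivAt (fun r : ℝ => 1 - r ^ 2) (-(2 * ρ)) ρ := by
    simpa using (hasDerivAt_pow 2 ρ).const_sub 1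
  have h3 := h1.div (h2.sqrt h0.ne') hs.ne'
  refine h3.congr_deriv ?_
  have hsq : √(1 - ρ ^ 2) ^ 2 = 1 - ρ ^ 2 := Real.sq_sqrt h0.le
  rw [div_eq_div_iff (by positivity) (by positivity)]
  field_simp
  rw [hsq]
  ring

theorem hasDerivAt_pairIntegrand (κ x : ℝ) {ρ : ℝ} (hρ : ρ ∈ Set.Ioo (-1 : ℝ) 1) :
    HasDerivAt (fun r => pairIntegrand κ r x) (pairIntegrandDeriv κ ρ x) ρ := by
  have h1 := (hasDerivAt_phiPrim _).comp ρ (hasDerivAt_linear_div_sqrt κ x hρ)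
  have h2 := (hasDerivAt_phiPrim _).comp ρ (hasDerivAt_linear_div_sqrt (-κ) x hρ)
  exact (h1.sub h2).const_mul (phi x)

/-- The boundary term produced by the correlation derivative, see
`intervalIntegral_pairIntegrandDeriv`. -/
theorem hasDerivAt_phi_mul_phi (c x : ℝ) {ρ : ℝ} (hρ : ρ ∈ Set.Ioo (-1 : ℝ) 1) :
    HasDerivAt (fun x => phi x * phi ((c - ρ * x) / √(1 - ρ ^ 2)) / √(1 - ρ ^ 2))
      (phi x * (phi ((c - ρ * x) / √(1 - ρ ^ 2)) * ((c * ρ - x) / √(1 - ρ ^ 2) ^ 3))) x := by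
  have h0 : 0 < 1 - ρ ^ 2 := by nlinarith [hρ.1, hρ.2]
  have hs : 0 < √(1 - ρ ^ 2) := Real.sqrt_pos.2 h0
  have hsq : √(1 - ρ ^ 2) ^ 2 = 1 - ρ ^ 2 := Real.sq_sqrt h0.le
  have h1 : HasDerivAt (fun x : ℝ => (c - ρ * x) / √(1 - ρ ^ 2)) (-ρ / √(1 - ρ ^ 2)) x := by
    simpa using (((hasDerivAt_id x).const_mul ρ).const_sub c).div_const √(1 - ρ ^ 2)
  have h2 : HasDerivAt (fun x : ℝ => -(x ^ 2 + ((c - ρ * x) / √(1 - ρ ^ 2)) ^ 2) / 2)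
      (-(2 * x + 2 * ((c - ρ * x) / √(1 - ρ ^ 2)) * (-ρ / √(1 - ρ ^ 2))) / 2) x := by
    simpa using (((hasDerivAt_pow 2 x).add (h1.pow 2)).neg).div_const 2
  have h3 := (h2.exp.const_mul (1 / (2 * Real.pi))).div_const √(1 - ρ ^ 2)
  simp_rw [phi_mul_phi, ← mul_assoc, phi_mul_phi]
  refine h3.congr_deriv ?_
  rw [mul_assoc, mul_div_assoc, mul_div_assoc, mul_assoc]
  congr 2
  field_simp
  rw [hsq]
  ring

/-- The correlation derivative of the integrand is an exact derivative in `x`, so that its integral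
reduces to boundary terms. -/
theorem intervalIntegral_pairIntegrandDeriv (κ : ℝ) {ρ : ℝ} (hρ : ρ ∈ Set.Ioo (-1 : ℝ) 1) :
    ∫ x in (-κ)..κ, pairIntegrandDeriv κ ρ x = 1 / (Real.pi * √(1 - ρ ^ 2)) *
      (Real.exp (-κ ^ 2 / (1 + ρ)) - Real.exp (-κ ^ 2 / (1 - ρ))) := by
  have h0 : 0 < 1 - ρ ^ 2 := by nlinarith [hρ.1, hρ.2]
  have hs : 0 < √(1 - ρ ^ 2) := Real.sqrt_pos.2 h0
  have hsq : √(1 - ρ ^ 2) ^ 2 = 1 - ρ ^ 2 := Real.sq_sqrt h0.le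
  have hp : 1 + ρ ≠ 0 := by linarith [hρ.1]
  have hm : 1 - ρ ≠ 0 := by linarith [hρ.2]
  have hc := continuous_phi
  rw [intervalIntegral.integral_eq_sub_of_hasDerivAt
    (f := fun x => phi x * phi ((κ - ρ * x) / √(1 - ρ ^ 2)) / √(1 - ρ ^ 2) -
      phi x * phi ((-κ - ρ * x) / √(1 - ρ ^ 2)) / √(1 - ρ ^ 2))]
  · simp only [phi_mul_phi]
    have e1 : -(κ ^ 2 + ((κ - ρ * κ) / √(1 - ρ ^ 2)) ^ 2) / 2 = -κ ^ 2 / (1 + ρ) := by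
      rw [div_pow, hsq]
      have : 1 - ρ ^ 2 = (1 - ρ) * (1 + ρ) := by ring
      rw [this]; field_simp; ring
    have e2 : -(κ ^ 2 + ((-κ - ρ * κ) / √(1 - ρ ^ 2)) ^ 2) / 2 = -κ ^ 2 / (1 - ρ) := by
      rw [div_pow, hsq]
      have : 1 - ρ ^ 2 = (1 - ρ) * (1 + ρ) := by ring
      rw [this]; field_simp; ring
    have e3 : -((-κ) ^ 2 + ((κ - ρ * -κ) / √(1 - ρ ^ 2)) ^ 2) / 2 = -κ ^ 2 / (1 - ρ) := by
      rw [← e2]; ring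
    have e4 : -((-κ) ^ 2 + ((-κ - ρ * -κ) / √(1 - ρ ^ 2)) ^ 2) / 2 = -κ ^ 2 / (1 + ρ) := by
      rw [← e1]; ring
    rw [e1, e2, e3, e4]
    field_simp
    ring
  · intro x _
    have h1 := (hasDerivAt_phi_mul_phi κ x hρ).sub (hasDerivAt_phi_mul_phi (-κ) x hρ)
    refine h1.congr_deriv ?_
    rw [pairIntegrandDeriv]; ring
  · unfold pairIntegrandDeriv
    exact Continuous.intervalIntegrable (by fun_prop) _ _

/-- The derivative of the pair probability with respect to the correlation. -/
def pairDeriv (κ ρ : ℝ) : ℝ :=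
  1 / (Real.pi * √(1 - ρ ^ 2)) * (Real.exp (-κ ^ 2 / (1 + ρ)) - Real.exp (-κ ^ 2 / (1 - ρ)))

theorem hasDerivAt_pairProb_corr {κ : ℝ} (hκ : 0 ≤ κ) {ρ : ℝ} (hρ : ρ ∈ Set.Ioo (-1 : ℝ) 1) :
    HasDerivAt (fun r => pairProb κ ((1 + r) / 2)) (pairDeriv κ ρ) ρ := by
  have hU : Set.Ioo (-1 : ℝ) 1 ∈ 𝓝 ρ := Ioo_mem_nhds hρ.1 hρ.2
  have hcongr : (fun r => ∫ x in (-κ)..κ, pairIntegrand κ r x) =ᶠ[𝓝 ρ]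
      fun r => pairProb κ ((1 + r) / 2) := by
    filter_upwards [hU] with r hr using (pairProb_eq_integral hκ hr).symm
  refine HasDerivAt.congr_of_eventuallyEq ?_ hcongr.symm
  rw [pairDeriv, ← intervalIntegral_pairIntegrandDeriv κ hρ]
  have hc := continuous_phi
  have hcp := continuous_phiPrim
  have hρ2 : ρ ^ 2 < 1 := by nlinarith [hρ.1, hρ.2]
  -- On the neighbourhood `r ^ 2 < (1 + ρ ^ 2) / 2` of `ρ`, the standard deviation `√(1 - r ^ 2)` is
  -- at least `s₀`.
  set s₀ := √((1 - ρ ^ 2) / 2) with hs₀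
  have hs₀pos : 0 < s₀ := Real.sqrt_pos.2 (by linarith)
  have hU2 : {r : ℝ | r ^ 2 < (1 + ρ ^ 2) / 2} ∈ 𝓝 ρ :=
    (isOpen_lt (by fun_prop) continuous_const).mem_nhds (show ρ ^ 2 < (1 + ρ ^ 2) / 2 by linarith)
  refine (intervalIntegral.hasDerivAt_integral_of_dominated_loc_of_deriv_le
    (bound := fun _ => 4 * κ / s₀ ^ 3) hU2 ?_ ?_ ?_ ?_ ?_ ?_).2
  · refine Eventually.of_forall fun r => Continuous.aestronglyMeasurable ?_
    unfold pairIntegrand; fun_prop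
  · refine Continuous.intervalIntegrable ?_ _ _
    unfold pairIntegrand; fun_prop
  · refine Continuous.aestronglyMeasurable ?_
    unfold pairIntegrandDeriv; fun_prop
  · refine ae_of_all _ fun x hx r hr => ?_
    have hr' : r ^ 2 < (1 + ρ ^ 2) / 2 := hr
    rw [Set.uIoc_of_le (by linarith)] at hx
    have hx' : |x| ≤ κ := abs_le.2 ⟨hx.1.le, hx.2⟩
    have hr1 : |r| ≤ 1 := by rw [← sq_le_one_iff_abs_le_one]; linarith
    have hss : s₀ ≤ √(1 - r ^ 2) := Real.sqrt_le_sqrt (by linarith)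
    have hpos : 0 < √(1 - r ^ 2) := hs₀pos.trans_le hss
    have key : ∀ c : ℝ, |c| = κ →
        |phi ((c - r * x) / √(1 - r ^ 2)) * ((c * r - x) / √(1 - r ^ 2) ^ 3)| ≤
          2 * κ / s₀ ^ 3 := by
      intro c hcκ
      rw [abs_mul, abs_of_nonneg (phi_nonneg _), abs_div, abs_of_pos (pow_pos hpos 3)]
      have h1 : |c * r - x| ≤ 2 * κ := by
        calc |c * r - x| ≤ |c * r| + |x| := abs_sub _ _
          _ ≤ κ * 1 + κ := by rw [abs_mul, hcκ]; gcongr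
          _ = 2 * κ := by ring
      calc _ ≤ 1 * (2 * κ / s₀ ^ 3) := by
            gcongr
            exact phi_le_one _
        _ = _ := one_mul _
    rw [pairIntegrandDeriv, Real.norm_eq_abs, abs_mul, abs_of_nonneg (phi_nonneg _)]
    have h1 := key κ (abs_of_nonneg hκ)
    have h2 := key (-κ) (by rw [abs_neg, abs_of_nonneg hκ])
    calc _ ≤ 1 * (2 * κ / s₀ ^ 3 + 2 * κ / s₀ ^ 3) := by
          gcongr
          · exact phi_le_one _
          · exact (abs_sub _ _).trans (add_le_add h1 h2)
      _ = 4 * κ / s₀ ^ 3 := by ring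
  · simp
  · refine ae_of_all _ fun x _ r hr => hasDerivAt_pairIntegrand κ x ?_
    have hr' : r ^ 2 < (1 + ρ ^ 2) / 2 := hr
    exact abs_lt.1 (by rw [← sq_lt_one_iff_abs_lt_one]; linarith)

theorem hasDerivAt_pairProb {κ : ℝ} (hκ : 0 ≤ κ) {β : ℝ} (hβ : β ∈ Set.Ioo (0 : ℝ) 1) :
    HasDerivAt (pairProb κ) (2 * pairDeriv κ (2 * β - 1)) β := by
  have h1 : HasDerivAt (fun b : ℝ => 2 * b - 1) 2 β := by
    simpa using ((hasDerivAt_id β).const_mul 2).sub_const 1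
  have h2 := (hasDerivAt_pairProb_corr hκ (ρ := 2 * β - 1)
    ⟨by linarith [hβ.1], by linarith [hβ.2]⟩).comp β h1
  have h3 : (fun r => pairProb κ ((1 + r) / 2)) ∘ (fun b => 2 * b - 1) = pairProb κ := by
    funext b
    change pairProb κ ((1 + (2 * b - 1)) / 2) = pairProb κ b
    congr 1; ring
  rw [h3] at h2
  exact h2.congr_deriv (mul_comm _ _)

/-! ### A numerical inequality for the Gaussian mass of an interval -/

theorem hasDerivAt_phi (x : ℝ) : HasDerivAt phi (-x * phi x) x := by
  have h1 : HasDerivAt (fun x : ℝ => -x ^ 2 / 2) (-x) x := by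
    have := (hasDerivAt_pow 2 x).neg.div_const 2
    refine this.congr_deriv ?_
    push_cast; ring
  have h2 := h1.exp.const_mul (√(2 * Real.pi))⁻¹
  rw [funext phi_eq]
  exact h2.congr_deriv (by ring)

theorem phi_pos (x : ℝ) : 0 < phi x := gaussianPDFReal_pos _ _ _ one_ne_zero

theorem phiPrim_zero : phiPrim 0 = 0 := intervalIntegral.integral_same

theorem phiPrim_pos {κ : ℝ} (hκ : 0 < κ) : 0 < phiPrim κ := by
  have := gaussProb_pos hκ
  rw [gaussProb_eq hκ.le] at this
  linarith

/-- The truncated series of `phiPrim κ / (κ * phi κ)`, a power series in `t = κ ^ 2` with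
coefficients `1 / (2 j + 1)!!`. -/
def ratioLower (t : ℝ) : ℝ := 1 + t / 3 + t ^ 2 / 15 + t ^ 3 / 105 + t ^ 4 / 945 + t ^ 5 / 10395

/-- An upper bound of the series of `phiPrim κ / (κ * phi κ)` for `t = κ ^ 2 ≤ 3.24`. The factor
`1.34` in the last term absorbs the tail, as `1.34 * (1 - 3.24 / 13) ≥ 1`. -/
def ratioUpper (t : ℝ) : ℝ := ratioLower t + 1.34 * t ^ 6 / 135135

theorem phi_mul_ratioLower_le {κ : ℝ} (hκ : 0 ≤ κ) :
    phi κ * (κ * ratioLower (κ ^ 2)) ≤ phiPrim κ := by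
  have hd : ∀ x, HasDerivAt (fun x => phiPrim x - phi x * (x * ratioLower (x ^ 2)))
      (phi x * (x ^ 12 / 10395)) x := by
    intro x
    have h1 : HasDerivAt (fun x : ℝ => x * ratioLower (x ^ 2))
        (1 + x ^ 2 + x ^ 4 / 3 + x ^ 6 / 15 + x ^ 8 / 105 + x ^ 10 / 945) x := by
      have hp : ∀ n : ℕ, HasDerivAt (fun x : ℝ => x ^ n) (n * x ^ (n - 1)) x :=
        fun n => hasDerivAt_pow n x
      have := (((((hasDerivAt_id x).add ((hp 3).div_const 3)).add ((hp 5).div_const 15)).add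
        ((hp 7).div_const 105)).add ((hp 9).div_const 945)).add ((hp 11).div_const 10395)
      have e : (fun x : ℝ => x * ratioLower (x ^ 2)) = (((((id + fun x => x ^ 3 / 3) +
          fun x => x ^ 5 / 15) + fun x => x ^ 7 / 105) + fun x => x ^ 9 / 945) +
          fun x => x ^ 11 / 10395) := by
        funext x; simp only [ratioLower, Pi.add_apply, id]; ring
      rw [e]
      refine this.congr_deriv ?_
      push_cast; ring
    refine ((hasDerivAt_phiPrim x).sub ((hasDerivAt_phi x).mul h1)).congr_deriv ?_
    rw [ratioLower]; ring
  have hmono := monotone_of_hasDerivAt_nonneg hd fun x =>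
    mul_nonneg (phi_nonneg x) (by positivity)
  have := hmono hκ
  simp only [phiPrim_zero, zero_mul, mul_zero, sub_zero] at this
  linarith

theorem phiPrim_le_phi_mul_ratioUpper {κ : ℝ} (hκ : 0 ≤ κ) (hκ2 : κ ≤ 1.8) :
    phiPrim κ ≤ phi κ * (κ * ratioUpper (κ ^ 2)) := by
  have hd : ∀ x, HasDerivAt (fun x => phi x * (x * ratioUpper (x ^ 2)) - phiPrim x)
      (phi x * (1.34 * (x ^ 12 / 10395 - x ^ 14 / 135135) - x ^ 12 / 10395)) x := by
    intro x
    have h1 : HasDerivAt (fun x : ℝ => x * ratioUpper (x ^ 2))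
        (1 + x ^ 2 + x ^ 4 / 3 + x ^ 6 / 15 + x ^ 8 / 105 + x ^ 10 / 945
          + 1.34 * x ^ 12 / 10395) x := by
      have hp : ∀ n : ℕ, HasDerivAt (fun x : ℝ => x ^ n) (n * x ^ (n - 1)) x :=
        fun n => hasDerivAt_pow n x
      have := ((((((hasDerivAt_id x).add ((hp 3).div_const 3)).add ((hp 5).div_const 15)).add
        ((hp 7).div_const 105)).add ((hp 9).div_const 945)).add ((hp 11).div_const 10395)).add
        ((hp 13).const_mul (1.34 / 135135))
      have e : (fun x : ℝ => x * ratioUpper (x ^ 2)) = ((((((id + fun x => x ^ 3 / 3) +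
          fun x => x ^ 5 / 15) + fun x => x ^ 7 / 105) + fun x => x ^ 9 / 945) +
          fun x => x ^ 11 / 10395) + fun x => 1.34 / 135135 * x ^ 13) := by
        funext x; simp only [ratioUpper, ratioLower, Pi.add_apply, id]; ring
      rw [e]
      refine this.congr_deriv ?_
      push_cast; ring
    refine (((hasDerivAt_phi x).mul h1).sub (hasDerivAt_phiPrim x)).congr_deriv ?_
    rw [ratioUpper, ratioLower]; ring
  have hmono : MonotoneOn (fun x => phi x * (x * ratioUpper (x ^ 2)) - phiPrim x)
      (Set.Icc 0 1.8) := by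
    refine monotoneOn_of_deriv_nonneg (convex_Icc _ _)
      (fun x _ => (hd x).continuousAt.continuousWithinAt)
      (fun x _ => (hd x).differentiableAt.differentiableWithinAt) fun x hx => ?_
    rw [interior_Icc] at hx
    rw [(hd x).deriv]
    refine mul_nonneg (phi_nonneg x) ?_
    have h2 : x ^ 2 ≤ 3.24 := by nlinarith [hx.1, hx.2]
    have h12 : 0 ≤ x ^ 12 := by positivity
    have : x ^ 14 = x ^ 12 * x ^ 2 := by ring
    rw [this]
    nlinarith
  have := hmono ⟨le_rfl, by norm_num⟩ ⟨hκ, hκ2⟩ hκ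
  simp only [phiPrim_zero, zero_mul, mul_zero, sub_zero] at this
  linarith

/-- The sign of this function, at `b = phiPrim κ / (κ * phi κ)` and `t = κ ^ 2`, is the opposite of
that of the derivative of `capacityGap` at `κ`. -/
def gapSlope (t b : ℝ) : ℝ := b ^ 2 - 2 * Real.log 2 * ((t - 1) * b + 1)

/-- Up to `κ = 1.37`, where `1.37 ^ 2 = 1.8769`, the gap decreases. -/
theorem gapSlope_nonneg {t b : ℝ} (ht : 0 ≤ t) (ht2 : t ≤ 1.8769) (hb : ratioLower t ≤ b) :
    0 ≤ gapSlope t b := by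
  have hc := Real.log_two_lt_d9
  have hc0 := Real.log_two_gt_d9
  set c := Real.log 2
  have hR : 1 + t / 3 ≤ ratioLower t := by
    rw [ratioLower]
    have : 0 ≤ t ^ 2 / 15 + t ^ 3 / 105 + t ^ 4 / 945 + t ^ 5 / 10395 := by positivity
    linarith
  have h1 : gapSlope t (ratioLower t) ≤ gapSlope t b := by
    have e : gapSlope t b - gapSlope t (ratioLower t) =
      (b - ratioLower t) * (b + ratioLower t - 2 * c * (t - 1)) := by rw [gapSlope, gapSlope]; ring
    have : 0 ≤ b + ratioLower t - 2 * c * (t - 1) := by nlinarith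
    nlinarith [mul_nonneg (sub_nonneg.2 hb) this]
  refine le_trans ?_ h1
  have h2 : 0 ≤ (t - 1) * ratioLower t + 1 := by
    rw [ratioLower]
    have : (t - 1) * (1 + t / 3 + t ^ 2 / 15 + t ^ 3 / 105 + t ^ 4 / 945 + t ^ 5 / 10395) + 1 =
      2 * t / 3 + 4 * t ^ 2 / 15 + 6 * t ^ 3 / 105 + 8 * t ^ 4 / 945 + 10 * t ^ 5 / 10395 +
      t ^ 6 / 10395 := by ring
    rw [this]; positivity
  have h3 : ratioLower t ^ 2 - 2 * 0.69315 * ((t - 1) * ratioLower t + 1) ≤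
      gapSlope t (ratioLower t) := by
    rw [gapSlope]; nlinarith
  refine le_trans ?_ h3
  -- In powers of `s`, the polynomial inequality follows linearly from `0 ≤ s` and `s ≤ 1.8769`.
  obtain ⟨s, rfl⟩ : ∃ s, t = 1.8769 - s := ⟨1.8769 - t, by ring⟩
  have hs : 0 ≤ s := by linarith
  have hs2 : s ≤ 1.8769 := by linarith
  have hk : ∀ k : ℕ, s ^ (k + 1) ≤ 1.8769 * s ^ k := fun k => by
    rw [pow_succ']; gcongr
  have hp : ∀ k : ℕ, 0 ≤ s ^ k := fun k => by positivity
  rw [ratioLower]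
  linarith [hk 0, hk 1, hk 2, hk 3, hk 4, hk 5, hk 6, hk 7, hk 8, hk 9, hp 1, hp 2, hp 3, hp 4,
    hp 5, hp 6, hp 7, hp 8, hp 9, hp 10]

/-- Between `κ = 1.37` and `κ = 1.8`, the gap decreases only slowly. -/
theorem gapSlope_le {t b : ℝ} (ht : 1.8769 ≤ t) (ht2 : t ≤ 3.24) (hb : ratioLower t ≤ b)
    (hb2 : b ≤ ratioUpper t) : gapSlope t b ≤ 0.02 := by
  have hc := Real.log_two_lt_d9
  have hc0 := Real.log_two_gt_d9
  set c := Real.log 2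
  have hR : 1 + t / 3 ≤ ratioLower t := by
    rw [ratioLower]
    have : 0 ≤ t ^ 2 / 15 + t ^ 3 / 105 + t ^ 4 / 945 + t ^ 5 / 10395 := by positivity
    linarith
  have h1 : gapSlope t b ≤ gapSlope t (ratioUpper t) := by
    have e : gapSlope t (ratioUpper t) - gapSlope t b =
      (ratioUpper t - b) * (b + ratioUpper t - 2 * c * (t - 1)) := by rw [gapSlope, gapSlope]; ring
    have : 0 ≤ b + ratioUpper t - 2 * c * (t - 1) := by nlinarith
    nlinarith [mul_nonneg (sub_nonneg.2 hb2) this]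
  refine h1.trans ?_
  have h3 : gapSlope t (ratioUpper t) ≤
      ratioUpper t ^ 2 - 2 * 0.69314 * ((t - 1) * ratioUpper t + 1) := by
    have h4 : 0 ≤ (t - 1) * ratioUpper t + 1 := by nlinarith
    rw [gapSlope]
    nlinarith
  refine h3.trans ?_
  -- In powers of `s`, the polynomial inequality follows linearly from `0 ≤ s` and `s ≤ 1.3631`.
  obtain ⟨s, rfl⟩ : ∃ s, t = 1.8769 + s := ⟨t - 1.8769, by ring⟩
  have hs : 0 ≤ s := by linarith
  have hs2 : s ≤ 1.3631 := by linarith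
  have hk : ∀ k : ℕ, s ^ (k + 1) ≤ 1.3631 * s ^ k := fun k => by
    rw [pow_succ']; gcongr
  have hp : ∀ k : ℕ, 0 ≤ s ^ k := fun k => by positivity
  rw [ratioUpper, ratioLower]
  linarith [hk 0, hk 1, hk 2, hk 3, hk 4, hk 5, hk 6, hk 7, hk 8, hk 9, hk 10, hk 11, hp 1, hp 2,
    hp 3, hp 4, hp 5, hp 6, hp 7, hp 8, hp 9, hp 10, hp 11, hp 12]

/-- The quantity whose positivity is the local stability condition `F_α''(1/2) < 0` at the critical
density. -/
def capacityGap (κ : ℝ) : ℝ :=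
  -Real.log (2 * phiPrim κ) - Real.log 2 * (κ * phi κ / phiPrim κ) ^ 2

theorem hasDerivAt_capacityGap {κ : ℝ} (hκ : 0 < κ) :
    HasDerivAt capacityGap (-(phi κ / phiPrim κ) * (κ * phi κ / phiPrim κ) ^ 2 *
      gapSlope (κ ^ 2) (phiPrim κ / (κ * phi κ))) κ := by
  have hP := phiPrim_pos hκ
  have hf := phi_pos κ
  have h1 := (((hasDerivAt_phiPrim κ).const_mul 2).log (by positivity)).neg
  have h2 := ((((hasDerivAt_id κ).mul (hasDerivAt_phi κ)).div (hasDerivAt_phiPrim κ)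
    hP.ne').pow 2).const_mul (Real.log 2)
  refine (h1.sub h2).congr_deriv ?_
  rw [gapSlope]
  simp only [id]
  push_cast
  simp only [Pi.mul_apply, Pi.div_apply, id]
  field_simp
  ring

theorem lt_sqrt_two_pi : 2.5066 < √(2 * Real.pi) := by
  apply Real.lt_sqrt_of_sq_lt
  nlinarith [Real.pi_gt_d6]

theorem ratio_bounds {κ : ℝ} (hκ : 0 < κ) : ratioLower (κ ^ 2) ≤ phiPrim κ / (κ * phi κ) ∧
    (κ ≤ 1.8 → phiPrim κ / (κ * phi κ) ≤ ratioUpper (κ ^ 2)) := by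
  have hf := phi_pos κ
  constructor
  · rw [le_div_iff₀ (by positivity)]
    linarith [phi_mul_ratioLower_le hκ.le]
  · intro h
    rw [div_le_iff₀ (by positivity)]
    linarith [phiPrim_le_phi_mul_ratioUpper hκ.le h]

theorem ratioLower_mono {s t : ℝ} (hs : 0 ≤ s) (hst : s ≤ t) : ratioLower s ≤ ratioLower t := by
  unfold ratioLower; gcongr

/-- The gap is smallest close to `κ = 1.37`, where it is only just positive. -/
theorem capacityGap_at : 0.0018 ≤ capacityGap 1.37 := by
  have hP := phiPrim_pos (κ := 1.37) (by norm_num)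
  have hf := phi_pos 1.37
  have hup := phiPrim_le_phi_mul_ratioUpper (κ := 1.37) (by norm_num) (by norm_num)
  have hb1 : 1.9388 ≤ ratioLower (1.37 ^ 2) := by rw [ratioLower]; norm_num
  have hb2 : ratioUpper (1.37 ^ 2) ≤ 1.9393 := by rw [ratioUpper, ratioLower]; norm_num
  have hb := (ratio_bounds (κ := 1.37) (by norm_num)).1
  have ha : 1.37 * phi 1.37 / phiPrim 1.37 ≤ 1 / 1.9388 := by
    rw [← one_div_div]
    exact one_div_le_one_div_of_le (by norm_num) (hb1.trans hb)
  have ha0 : 0 ≤ 1.37 * phi 1.37 / phiPrim 1.37 := by positivity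
  have ha2 : (1.37 * phi 1.37 / phiPrim 1.37) ^ 2 ≤ (1 / 1.9388) ^ 2 := by gcongr
  have hphi : phi 1.37 ≤ Real.exp (-0.93845) / 2.5066 := by
    rw [phi_eq, inv_mul_eq_div]
    rw [show -(1.37 : ℝ) ^ 2 / 2 = -0.93845 by norm_num]
    gcongr
    exact lt_sqrt_two_pi.le
  have hexp : 2.1199 ≤ Real.exp 0.7522 := by
    refine le_trans ?_ (Real.sum_le_exp_of_nonneg (by norm_num) 7)
    norm_num [Finset.sum_range_succ, Nat.factorial]
  have hb0 : 0 ≤ ratioUpper (1.37 ^ 2) := by rw [ratioUpper, ratioLower]; norm_num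
  have h2P : 2 * phiPrim 1.37 ≤ Real.exp (-0.18625) := by
    have h3 : Real.exp (-0.18625) = Real.exp 0.7522 * Real.exp (-0.93845) := by
      rw [← Real.exp_add]; norm_num
    rw [h3]
    calc 2 * phiPrim 1.37 ≤ 2 * (phi 1.37 * (1.37 * ratioUpper (1.37 ^ 2))) := by gcongr
      _ ≤ 2 * (Real.exp (-0.93845) / 2.5066 * (1.37 * 1.9393)) := by gcongr
      _ = (2 * 1.37 * 1.9393 / 2.5066) * Real.exp (-0.93845) := by ring
      _ ≤ Real.exp 0.7522 * Real.exp (-0.93845) := by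
          gcongr
          exact le_trans (by norm_num) hexp
  have hlog : Real.log (2 * phiPrim 1.37) ≤ -0.18625 := by
    rw [Real.log_le_iff_le_exp (by positivity)]; exact h2P
  have hc := Real.log_two_lt_d9
  have hc0 := Real.log_two_gt_d9
  have : Real.log 2 * (1.37 * phi 1.37 / phiPrim 1.37) ^ 2 ≤ 0.69315 * (1 / 1.9388) ^ 2 := by
    gcongr; linarith
  rw [capacityGap]
  norm_num at this hlog ⊢
  linarith

theorem capacityGap_pos_of_le {κ : ℝ} (hκ : 0 < κ) (h : κ ≤ 1.37) : 0 < capacityGap κ := by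
  have hanti : AntitoneOn capacityGap (Set.Icc κ 1.37) := by
    have hpos : ∀ x ∈ Set.Icc κ (1.37 : ℝ), 0 < x := fun x hx => hκ.trans_le hx.1
    refine antitoneOn_of_deriv_nonpos (convex_Icc _ _)
      (fun x hx => (hasDerivAt_capacityGap (hpos x hx)).continuousAt.continuousWithinAt)
      (fun x hx => (hasDerivAt_capacityGap
        (hpos x (interior_subset hx))).differentiableAt.differentiableWithinAt) fun x hx => ?_
    have hx0 := hpos x (interior_subset hx)
    rw [interior_Icc] at hx
    rw [(hasDerivAt_capacityGap hx0).deriv]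
    have h1 := gapSlope_nonneg (t := x ^ 2) (by positivity) (by nlinarith [hx.2])
      (ratio_bounds hx0).1
    have hP := phiPrim_pos hx0
    have hf := phi_pos x
    have : 0 ≤ phi x / phiPrim x * (x * phi x / phiPrim x) ^ 2 := by positivity
    nlinarith
  have := hanti ⟨le_rfl, h⟩ ⟨h, le_rfl⟩ h
  linarith [capacityGap_at]

/-- On `[1.37, 1.8]` the gap loses at most `0.004 * 0.43`, which is less than its value at `1.37`. -/
theorem capacityGap_pos_of_mem {κ : ℝ} (h1 : 1.37 ≤ κ) (h2 : κ ≤ 1.8) : 0 < capacityGap κ := by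
  have hd : ∀ x ∈ Set.Icc (1.37 : ℝ) 1.8, HasDerivAt (fun x => capacityGap x + 0.004 * x)
      (-(phi x / phiPrim x) * (x * phi x / phiPrim x) ^ 2 *
      gapSlope (x ^ 2) (phiPrim x / (x * phi x)) + 0.004) x := fun x hx => by
    have hx0 : 0 < x := lt_of_lt_of_le (by norm_num) hx.1
    have := (hasDerivAt_capacityGap hx0).add ((hasDerivAt_id x).const_mul 0.004)
    exact this.congr_deriv (by ring)
  have hmono : MonotoneOn (fun x => capacityGap x + 0.004 * x) (Set.Icc 1.37 1.8) := by
    refine monotoneOn_of_deriv_nonneg (convex_Icc _ _)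
      (fun x hx => (hd x hx).continuousAt.continuousWithinAt)
      (fun x hx => (hd x (interior_subset hx)).differentiableAt.differentiableWithinAt)
      fun x hx => ?_
    rw [(hd x (interior_subset hx)).deriv]
    rw [interior_Icc] at hx
    have hx0 : 0 < x := lt_trans (by norm_num) hx.1
    have hP := phiPrim_pos hx0
    have hf := phi_pos x
    have hb := ratio_bounds hx0
    have h3 := gapSlope_le (t := x ^ 2) (by nlinarith [hx.1]) (by nlinarith [hx.1, hx.2])
      hb.1 (hb.2 hx.2.le)
    have hb1 : 1.9 ≤ ratioLower (x ^ 2) := by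
      refine le_trans ?_ (ratioLower_mono (s := 1.37 ^ 2) (by norm_num)
        (by nlinarith [hx.1]))
      rw [ratioLower]; norm_num
    have ha : x * phi x / phiPrim x ≤ 1 / 1.9 := by
      rw [← one_div_div]
      exact one_div_le_one_div_of_le (by norm_num) (hb1.trans hb.1)
    have ha0 : 0 ≤ x * phi x / phiPrim x := by positivity
    have ha1 : phi x / phiPrim x ≤ 1 / 1.9 / 1.37 := by
      rw [le_div_iff₀ (by norm_num)]
      refine le_trans ?_ ha
      rw [mul_div_assoc, mul_comm]
      have : 0 ≤ phi x / phiPrim x := by positivity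
      nlinarith [hx.1]
    have hw : phi x / phiPrim x * (x * phi x / phiPrim x) ^ 2 ≤ 1 / 1.9 / 1.37 * (1 / 1.9) ^ 2 := by
      gcongr
    have hw0 : 0 ≤ phi x / phiPrim x * (x * phi x / phiPrim x) ^ 2 := by positivity
    have : phi x / phiPrim x * (x * phi x / phiPrim x) ^ 2 *
        gapSlope (x ^ 2) (phiPrim x / (x * phi x)) ≤ 0.004 := by
      calc _ ≤ phi x / phiPrim x * (x * phi x / phiPrim x) ^ 2 * 0.02 := by gcongr
        _ ≤ 1 / 1.9 / 1.37 * (1 / 1.9) ^ 2 * 0.02 := by gcongr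
        _ ≤ 0.004 := by norm_num
    linarith
  have := hmono ⟨le_rfl, by norm_num⟩ ⟨h1, h2⟩ h1
  simp only at this
  have h3 := capacityGap_at
  norm_num at this h3 h2 ⊢
  linarith

theorem tendsto_phiPrim_atTop : Tendsto phiPrim atTop (𝓝 (1 / 2)) := by
  have h1 : Tendsto (fun x => ∫ t in (-x)..x, phi t) atTop (𝓝 (∫ t, phi t)) :=
    intervalIntegral_tendsto_integral (integrable_gaussianPDFReal 0 1) tendsto_neg_atTop_atBot
      tendsto_id
  have h2 : ∫ t, phi t = 1 := integral_gaussianPDFReal_eq_one 0 one_ne_zero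
  have h3 : ∀ x, ∫ t in (-x)..x, phi t = 2 * phiPrim x := fun x => by
    have := intervalIntegral.integral_interval_sub_left (μ := volume)
      (continuous_phi.intervalIntegrable 0 x) (continuous_phi.intervalIntegrable 0 (-x))
    rw [← this]
    change phiPrim x - phiPrim (-x) = _
    rw [phiPrim_neg]; ring
  simp_rw [h3, h2] at h1
  have := h1.const_mul (1 / 2)
  refine (this.congr fun x => ?_).trans (by simp)
  ring

/-- A lower bound for the Gaussian tail, by the Mills ratio. -/
theorem phiPrim_add_le (κ : ℝ) :
    phiPrim κ + phi κ * (κ / (κ ^ 2 + 1)) ≤ 1 / 2 := by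
  have hd : ∀ x, HasDerivAt (fun x => phiPrim x + phi x * (x / (x ^ 2 + 1)))
      (phi x * (2 / (x ^ 2 + 1) ^ 2)) x := by
    intro x
    have hne : x ^ 2 + 1 ≠ 0 := by positivity
    have h1 : HasDerivAt (fun x : ℝ => x ^ 2 + 1) (2 * x) x := by
      simpa using (hasDerivAt_pow 2 x).add_const 1
    have h2 := (hasDerivAt_phiPrim x).add ((hasDerivAt_phi x).mul ((hasDerivAt_id x).div h1 hne))
    refine h2.congr_deriv ?_
    simp only [Pi.div_apply, id]
    field_simp
    ring
  have hmono := monotone_of_hasDerivAt_nonneg hd fun x =>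
    mul_nonneg (phi_nonneg x) (by positivity)
  have hlim : Tendsto (fun x => phiPrim x + x⁻¹) atTop (𝓝 (1 / 2)) := by
    simpa using tendsto_phiPrim_atTop.add tendsto_inv_atTop_zero
  refine ge_of_tendsto hlim ?_
  filter_upwards [eventually_ge_atTop κ, eventually_gt_atTop 0] with x hx hx0
  refine (hmono hx).trans ?_
  have h1 : x / (x ^ 2 + 1) ≤ x⁻¹ := by
    rw [← one_div, div_le_div_iff₀ (by positivity) hx0]
    nlinarith
  have h2 : phi x * (x / (x ^ 2 + 1)) ≤ 1 * x⁻¹ :=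
    mul_le_mul (phi_le_one x) h1 (by positivity) zero_le_one
  simp only
  linarith

/-- For large `κ`, the bound `-log p ≥ 1 - p` and the Mills ratio suffice. -/
theorem capacityGap_pos_of_ge {κ : ℝ} (h : 1.8 ≤ κ) : 0 < capacityGap κ := by
  have hκ : 0 < κ := lt_of_lt_of_le (by norm_num) h
  have hP := phiPrim_pos hκ
  have hf := phi_pos κ
  have hmills := phiPrim_add_le κ
  -- It is enough to compare `κ (κ² + 1) φ(κ)`, decreasing on this range, with its value at `1.8`.
  have hanti : AntitoneOn (fun x => phi x * (x * (x ^ 2 + 1))) (Set.Ici 1.8) := by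
    have hd : ∀ x, HasDerivAt (fun x => phi x * (x * (x ^ 2 + 1)))
        (phi x * (1 + 2 * x ^ 2 - x ^ 4)) x := by
      intro x
      have h1 : HasDerivAt (fun x : ℝ => x ^ 2 + 1) (2 * x) x := by
        simpa using (hasDerivAt_pow 2 x).add_const 1
      have h2 := (hasDerivAt_phi x).mul ((hasDerivAt_id x).mul h1)
      refine h2.congr_deriv ?_
      simp only [Pi.mul_apply, id]
      ring
    refine antitoneOn_of_deriv_nonpos (convex_Ici _)
      (fun x _ => (hd x).continuousAt.continuousWithinAt)
      (fun x _ => (hd x).differentiableAt.differentiableWithinAt) fun x hx => ?_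
    rw [interior_Ici] at hx
    have hx' : 1.8 < x := hx
    rw [(hd x).deriv]
    refine mul_nonpos_of_nonneg_of_nonpos (phi_nonneg x) ?_
    have : 3.24 ≤ x ^ 2 := by nlinarith
    nlinarith
  have h18 := hanti Set.self_mem_Ici (show (1.8 : ℝ) ≤ κ from h) h
  simp only at h18
  have hmonoP : phiPrim 1.8 ≤ phiPrim κ := by
    have := gaussProb_mono h
    rw [gaussProb_eq (by norm_num), gaussProb_eq hκ.le] at this
    linarith
  have hlo := phi_mul_ratioLower_le (κ := 1.8) (by norm_num)
  have hb1 : 3.25 ≤ ratioLower (1.8 ^ 2) := by rw [ratioLower]; norm_num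
  have hphi : 0.0785 ≤ phi 1.8 := by
    have h1 : √(2 * Real.pi) ≤ 2.5067 := by
      rw [Real.sqrt_le_left (by norm_num)]
      nlinarith [Real.pi_lt_d4]
    have h2 : Real.exp 0.81 ≤ 2.25 := by
      refine (Real.exp_bound' (by norm_num) (by norm_num) (n := 6) (by norm_num)).trans ?_
      norm_num [Finset.sum_range_succ, Nat.factorial]
    have h3 : Real.exp (-1.8 ^ 2 / 2) = (Real.exp 0.81 * Real.exp 0.81)⁻¹ := by
      rw [← Real.exp_add, ← Real.exp_neg]; norm_num
    rw [phi_eq, h3, ← mul_inv, ← one_div, le_div_iff₀ (by positivity)]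
    calc 0.0785 * (√(2 * Real.pi) * (Real.exp 0.81 * Real.exp 0.81)) ≤
        0.0785 * (2.5067 * (2.25 * 2.25)) := by gcongr
      _ ≤ 1 := by norm_num
  have hc := Real.log_two_lt_d9
  have hc0 := Real.log_two_gt_d9
  have hmain : Real.log 2 * phi κ * (κ * (κ ^ 2 + 1)) < 2 * phiPrim κ ^ 2 := by
    have h0 : phi 1.8 * 5.85 ≤ phiPrim κ := by
      refine le_trans ?_ (hlo.trans hmonoP)
      have := phi_pos 1.8
      gcongr
      linarith
    have hf18 := phi_pos 1.8
    calc Real.log 2 * phi κ * (κ * (κ ^ 2 + 1)) = Real.log 2 * (phi κ * (κ * (κ ^ 2 + 1))) := by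
          ring
      _ ≤ 0.69315 * (phi 1.8 * (1.8 * (1.8 ^ 2 + 1))) := by gcongr; linarith
      _ < 2 * (phi 1.8 * 5.85) ^ 2 := by nlinarith
      _ ≤ 2 * phiPrim κ ^ 2 := by gcongr
  have hlog : 1 - 2 * phiPrim κ ≤ -Real.log (2 * phiPrim κ) := by
    have := Real.log_le_sub_one_of_pos (x := 2 * phiPrim κ) (by positivity)
    linarith
  have h1 : 2 * (phi κ * (κ / (κ ^ 2 + 1))) ≤ 1 - 2 * phiPrim κ := by linarith
  have h2 : Real.log 2 * (κ * phi κ / phiPrim κ) ^ 2 < 2 * (phi κ * (κ / (κ ^ 2 + 1))) := by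
    rw [div_pow, ← mul_div_assoc, ← mul_div_assoc, ← mul_div_assoc,
      div_lt_div_iff₀ (by positivity) (by positivity)]
    have : 0 < κ * phi κ := by positivity
    nlinarith [mul_lt_mul_of_pos_left hmain this]
  rw [capacityGap]
  linarith

/-- `log 2 · (2 κ φ(κ) / p)² < log (1 / p)` for every `κ > 0`. -/
theorem capacityGap_pos {κ : ℝ} (hκ : 0 < κ) : 0 < capacityGap κ := by
  rcases le_total κ 1.37 with h | h
  · exact capacityGap_pos_of_le hκ h
  · rcases le_total κ 1.8 with h' | h'
    · exact capacityGap_pos_of_mem h h'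
    · exact capacityGap_pos_of_ge h'

/-! ### The shape of the rate function -/

theorem pairDeriv_zero (κ : ℝ) : pairDeriv κ 0 = 0 := by simp [pairDeriv]

theorem pairDeriv_nonneg (κ : ℝ) {ρ : ℝ} (h0 : 0 ≤ ρ) (h1 : ρ < 1) : 0 ≤ pairDeriv κ ρ := by
  unfold pairDeriv
  have : Real.exp (-κ ^ 2 / (1 - ρ)) ≤ Real.exp (-κ ^ 2 / (1 + ρ)) := by
    apply Real.exp_le_exp.2
    rw [neg_div, neg_div, neg_le_neg_iff]
    exact div_le_div_of_nonneg_left (sq_nonneg _) (by linarith) (by linarith)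
  exact mul_nonneg (by positivity) (sub_nonneg.2 this)

theorem pairDeriv_le (κ : ℝ) {ρ : ℝ} (h0 : 0 ≤ ρ) (h1 : ρ ≤ 1 / 2) :
    pairDeriv κ ρ ≤ 3 * κ ^ 2 * ρ := by
  have hs : 1 / 2 ≤ √(1 - ρ ^ 2) := Real.le_sqrt_of_sq_le (by nlinarith)
  have hpi := Real.pi_gt_three
  have h2 : 1 / (Real.pi * √(1 - ρ ^ 2)) ≤ 1 := by
    rw [div_le_one (by positivity)]; nlinarith
  have h3 : Real.exp (-κ ^ 2 / (1 + ρ)) - Real.exp (-κ ^ 2 / (1 - ρ)) ≤ 3 * κ ^ 2 * ρ := by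
    have e1 : Real.exp (-κ ^ 2 / (1 - ρ)) = Real.exp (-κ ^ 2 / (1 + ρ)) *
        Real.exp (-(2 * κ ^ 2 * ρ / (1 - ρ ^ 2))) := by
      rw [← Real.exp_add]; congr 1
      have : 1 - ρ ^ 2 = (1 - ρ) * (1 + ρ) := by ring
      rw [this]
      have h5 : 1 - ρ ≠ 0 := by linarith
      have h6 : 1 + ρ ≠ 0 := by linarith
      field_simp; ring
    have e2 : 1 - 2 * κ ^ 2 * ρ / (1 - ρ ^ 2) ≤ Real.exp (-(2 * κ ^ 2 * ρ / (1 - ρ ^ 2))) := by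
      have := Real.add_one_le_exp (-(2 * κ ^ 2 * ρ / (1 - ρ ^ 2))); linarith
    have e3 : Real.exp (-κ ^ 2 / (1 + ρ)) ≤ 1 := Real.exp_le_one_iff.2 (by
      rw [neg_div]; have : 0 ≤ κ ^ 2 / (1 + ρ) := by positivity
      linarith)
    have e4 : 2 * κ ^ 2 * ρ / (1 - ρ ^ 2) ≤ 3 * κ ^ 2 * ρ := by
      rw [div_le_iff₀ (by nlinarith)]
      have h6 : 0 ≤ κ ^ 2 * ρ := by positivity
      have h7 : 0 ≤ 1 / 4 - ρ ^ 2 := by nlinarith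
      nlinarith [mul_nonneg h6 h7]
    have e5 : 0 ≤ 2 * κ ^ 2 * ρ / (1 - ρ ^ 2) := div_nonneg (by positivity) (by nlinarith)
    rw [e1]
    nlinarith [Real.exp_pos (-κ ^ 2 / (1 + ρ))]
  rw [pairDeriv]
  have h4 : 0 ≤ 3 * κ ^ 2 * ρ := by positivity
  have h5 : 0 ≤ 1 / (Real.pi * √(1 - ρ ^ 2)) := by positivity
  nlinarith

/-- The two constraints of a pair are positively correlated. -/
theorem sq_le_pairProb {κ : ℝ} (hκ : 0 < κ) {β : ℝ} (hβ : β ∈ Set.Icc (0 : ℝ) 1) :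
    gaussProb κ ^ 2 ≤ pairProb κ β := by
  have hmono : MonotoneOn (pairProb κ) (Set.Icc (1 / 2) 1) := by
    have hd : ∀ x ∈ interior (Set.Icc (1 / 2 : ℝ) 1), HasDerivAt (pairProb κ)
        (2 * pairDeriv κ (2 * x - 1)) x := fun x hx => by
      rw [interior_Icc] at hx
      exact hasDerivAt_pairProb hκ.le ⟨by linarith [hx.1], hx.2⟩
    refine monotoneOn_of_deriv_nonneg (convex_Icc _ _)
      ((continuousOn_pairProb κ).mono (Set.Icc_subset_Icc_left (by norm_num)))
      (fun x hx => (hd x hx).differentiableAt.differentiableWithinAt) fun x hx => ?_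
    rw [(hd x hx).deriv]
    rw [interior_Icc] at hx
    have := pairDeriv_nonneg κ (ρ := 2 * x - 1) (by linarith [hx.1]) (by linarith [hx.2])
    linarith
  rw [← pairProb_half]
  rcases le_total (1 / 2) β with h | h
  · exact hmono ⟨le_rfl, by norm_num⟩ ⟨h, hβ.2⟩ h
  · rw [← pairProb_one_sub κ hβ]
    exact hmono ⟨le_rfl, by norm_num⟩ ⟨by linarith, by linarith [hβ.1]⟩ (by linarith)

theorem pairProb_pos {κ : ℝ} (hκ : 0 < κ) {β : ℝ} (hβ : β ∈ Set.Icc (0 : ℝ) 1) :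
    0 < pairProb κ β :=
  (pow_pos (gaussProb_pos hκ) 2).trans_le (sq_le_pairProb hκ hβ)

/-- By evenness of the constraint, the pair covariance is quadratic in the correlation. -/
theorem pairProb_le_add {κ : ℝ} (hκ : 0 < κ) {β : ℝ} (hβ : β ∈ Set.Icc (0 : ℝ) 1) :
    pairProb κ β ≤ gaussProb κ ^ 2 + (3 * κ ^ 2 / 2 + 4) * (2 * β - 1) ^ 2 := by
  wlog h : 1 / 2 ≤ β generalizing β
  · have := this (β := 1 - β) ⟨by linarith [hβ.2], by linarith [hβ.1]⟩ (by linarith)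
    rw [pairProb_one_sub κ hβ] at this
    refine this.trans (le_of_eq ?_)
    ring
  rcases le_total β (3 / 4) with h' | h'
  · have hanti : AntitoneOn (fun x => pairProb κ x - 3 * κ ^ 2 / 2 * (2 * x - 1) ^ 2)
        (Set.Icc (1 / 2) (3 / 4)) := by
      have hd : ∀ x ∈ Set.Icc (1 / 2 : ℝ) (3 / 4),
          HasDerivAt (fun x => pairProb κ x - 3 * κ ^ 2 / 2 * (2 * x - 1) ^ 2)
          (2 * pairDeriv κ (2 * x - 1) - 6 * κ ^ 2 * (2 * x - 1)) x := fun x hx => by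
        have h1 := hasDerivAt_pairProb hκ.le (β := x) ⟨by linarith [hx.1], by linarith [hx.2]⟩
        have h2 : HasDerivAt (fun x : ℝ => 2 * x - 1) 2 x := by
          simpa using ((hasDerivAt_id x).const_mul 2).sub_const 1
        refine (h1.sub ((h2.pow 2).const_mul (3 * κ ^ 2 / 2))).congr_deriv ?_
        push_cast; ring
      refine antitoneOn_of_deriv_nonpos (convex_Icc _ _)
        (fun x hx => (hd x hx).continuousAt.continuousWithinAt)
        (fun x hx => (hd x (interior_subset hx)).differentiableAt.differentiableWithinAt)
        fun x hx => ?_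
      rw [(hd x (interior_subset hx)).deriv]
      rw [interior_Icc] at hx
      have := pairDeriv_le κ (ρ := 2 * x - 1) (by linarith [hx.1]) (by linarith [hx.2])
      linarith
    have := hanti ⟨le_rfl, by norm_num⟩ ⟨h, h'⟩ h
    simp only [pairProb_half] at this
    nlinarith [sq_nonneg (2 * β - 1)]
  · have h1 : pairProb κ β ≤ 1 := (pairProb_le_gaussProb κ hβ).trans (gaussProb_lt_one κ).le
    have h2 : 1 ≤ 4 * (2 * β - 1) ^ 2 := by nlinarith
    have h3 : 0 ≤ 3 * κ ^ 2 / 2 * (2 * β - 1) ^ 2 := by positivity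
    nlinarith [sq_nonneg (gaussProb κ)]

/-- The derivative of the rate function on `(0, 1)`. -/
def rateDeriv (κ α β : ℝ) : ℝ :=
  Real.log (1 - β) - Real.log β + α * (2 * pairDeriv κ (2 * β - 1) / pairProb κ β)

theorem hasDerivAt_rate {κ : ℝ} (hκ : 0 < κ) (α : ℝ) {β : ℝ} (hβ : β ∈ Set.Ioo (0 : ℝ) 1) :
    HasDerivAt (rate κ α) (rateDeriv κ α β) β :=
  (Real.hasDerivAt_binEntropy hβ.1.ne' hβ.2.ne).add
    (((hasDerivAt_pairProb hκ.le hβ).log (pairProb_pos hκ ⟨hβ.1.le, hβ.2.le⟩).ne').const_mul α)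

theorem continuousAt_pairDeriv (κ : ℝ) {ρ : ℝ} (hρ : ρ ∈ Set.Ioo (-1 : ℝ) 1) :
    ContinuousAt (pairDeriv κ) ρ := by
  have h0 : 0 < 1 - ρ ^ 2 := by nlinarith [hρ.1, hρ.2]
  have hs : 0 < √(1 - ρ ^ 2) := Real.sqrt_pos.2 h0
  have h1 : Real.pi * √(1 - ρ ^ 2) ≠ 0 := by positivity
  have hp : 1 + ρ ≠ 0 := by linarith [hρ.1]
  have hm : 1 - ρ ≠ 0 := by linarith [hρ.2]
  unfold pairDeriv
  fun_prop (disch := assumption)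

theorem continuousOn_rateDeriv {κ : ℝ} (hκ : 0 < κ) (α : ℝ) :
    ContinuousOn (rateDeriv κ α) (Set.Ioo 0 1) := by
  intro β hβ
  have h1 : 1 - β ≠ 0 := by linarith [hβ.2]
  have h2 : β ≠ 0 := hβ.1.ne'
  have h3 : ContinuousAt (pairProb κ) β := (hasDerivAt_pairProb hκ.le hβ).continuousAt
  have h4 : pairProb κ β ≠ 0 := (pairProb_pos hκ ⟨hβ.1.le, hβ.2.le⟩).ne'
  have h5 : ContinuousAt (fun b => pairDeriv κ (2 * b - 1)) β :=
    ContinuousAt.comp (f := fun b : ℝ => 2 * b - 1)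
      (continuousAt_pairDeriv κ ⟨by linarith [hβ.1], by linarith [hβ.2]⟩) (by fun_prop)
  apply ContinuousAt.continuousWithinAt
  unfold rateDeriv
  fun_prop (disch := assumption)

theorem continuousOn_rate {κ : ℝ} (hκ : 0 < κ) (α : ℝ) :
    ContinuousOn (rate κ α) (Set.Icc 0 1) := by
  unfold rate
  refine Real.binEntropy_continuous.continuousOn.add (continuousOn_const.mul ?_)
  exact (continuousOn_pairProb κ).log fun β hβ => (pairProb_pos hκ hβ).ne'

theorem hasDerivAt_pairDeriv_zero (κ : ℝ) :
    HasDerivAt (pairDeriv κ) (4 * κ ^ 2 * phi κ ^ 2) 0 := by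
  have h1 : HasDerivAt (fun r : ℝ => Real.exp (-κ ^ 2 / (1 + r)))
      (Real.exp (-κ ^ 2) * κ ^ 2) 0 := by
    have h := ((hasDerivAt_const (0 : ℝ) (-κ ^ 2)).div ((hasDerivAt_id (0 : ℝ)).const_add 1)
      (by simp)).exp
    refine h.congr_deriv ?_
    simp
  have h2 : HasDerivAt (fun r : ℝ => Real.exp (-κ ^ 2 / (1 - r)))
      (-(Real.exp (-κ ^ 2) * κ ^ 2)) 0 := by
    have h := ((hasDerivAt_const (0 : ℝ) (-κ ^ 2)).div ((hasDerivAt_id (0 : ℝ)).const_sub 1)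
      (by simp)).exp
    refine h.congr_deriv ?_
    simp
  have h3 : HasDerivAt (fun r : ℝ => 1 - r ^ 2) 0 0 := by
    simpa using (hasDerivAt_pow 2 (0 : ℝ)).const_sub 1
  have h4 := (hasDerivAt_const (0 : ℝ) (1 : ℝ)).div ((h3.sqrt (by simp)).const_mul Real.pi)
    (by simp [Real.pi_ne_zero])
  have h5 := h4.mul (h1.sub h2)
  refine h5.congr_deriv ?_
  rw [sq (phi κ), phi_mul_phi]
  have : -(κ ^ 2 + κ ^ 2) / 2 = -κ ^ 2 := by ring
  rw [this]
  simp
  field_simp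
  ring

theorem hasDerivAt_rateDeriv_half {κ : ℝ} (hκ : 0 < κ) (α : ℝ) :
    HasDerivAt (rateDeriv κ α) (-4 + 4 * α * (κ * phi κ / phiPrim κ) ^ 2) (1 / 2) := by
  have h1 : HasDerivAt (fun b : ℝ => Real.log (1 - b)) (-2) (1 / 2) := by
    have := ((hasDerivAt_id (1 / 2 : ℝ)).const_sub 1).log (by norm_num)
    refine this.congr_deriv (by norm_num)
  have h2 : HasDerivAt Real.log 2 (1 / 2) := by
    refine (Real.hasDerivAt_log (by norm_num)).congr_deriv (by norm_num)
  have h3 : HasDerivAt (fun x : ℝ => 2 * x - 1) 2 (1 / 2) := by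
    simpa using ((hasDerivAt_id (1 / 2 : ℝ)).const_mul 2).sub_const 1
  have h4 : HasDerivAt (fun b : ℝ => pairDeriv κ (2 * b - 1)) (4 * κ ^ 2 * phi κ ^ 2 * 2) (1 / 2) :=
    HasDerivAt.comp (1 / 2) (h₂ := pairDeriv κ) (h := fun x : ℝ => 2 * x - 1)
      (by simpa using hasDerivAt_pairDeriv_zero κ) h3
  have h5 := hasDerivAt_pairProb hκ.le (β := 1 / 2) (by norm_num)
  have hp := gaussProb_pos hκ
  have h6 := (((h4.const_mul 2).div h5 (by rw [pairProb_half]; positivity)).const_mul α)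
  refine ((h1.sub h2).add h6).congr_deriv ?_
  have e : (2 : ℝ) * (1 / 2) - 1 = 0 := by norm_num
  have hP := phiPrim_pos hκ
  rw [e, pairDeriv_zero, pairProb_half, gaussProb_eq hκ.le]
  field_simp
  ring

theorem deriv_deriv_rate_half {κ : ℝ} (hκ : 0 < κ) (α : ℝ) :
    deriv (deriv (rate κ α)) (1 / 2) = -4 + 4 * α * (κ * phi κ / phiPrim κ) ^ 2 := by
  have h : deriv (rate κ α) =ᶠ[𝓝 (1 / 2)] rateDeriv κ α := by
    filter_upwards [Ioo_mem_nhds (show (0 : ℝ) < 1 / 2 by norm_num) (show (1 / 2 : ℝ) < 1 by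
      norm_num)] with b hb using (hasDerivAt_rate hκ α hb).deriv
  rw [h.deriv_eq, (hasDerivAt_rateDeriv_half hκ α).deriv]

theorem neg_log_gaussProb_pos {κ : ℝ} (hκ : 0 < κ) : 0 < -Real.log (gaussProb κ) := by
  have := Real.log_neg (gaussProb_pos hκ) (gaussProb_lt_one κ)
  linarith

theorem mul_neg_log_gaussProb_lt {κ α : ℝ} (hκ : 0 < κ) (hαc : α < criticalDensity κ) :
    α * -Real.log (gaussProb κ) < Real.log 2 := by
  have h := neg_log_gaussProb_pos hκ
  rw [criticalDensity, ← div_neg_eq_neg_div', lt_div_iff₀ h] at hαc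
  exact hαc

theorem rate_half_curvature {κ α : ℝ} (hκ : 0 < κ) (hαc : α < criticalDensity κ) :
    -4 + 4 * α * (κ * phi κ / phiPrim κ) ^ 2 < 0 := by
  have h1 := mul_neg_log_gaussProb_lt hκ hαc
  have h2 := capacityGap_pos hκ
  have h3 := neg_log_gaussProb_pos hκ
  rw [gaussProb_eq hκ.le] at h1 h3
  rw [capacityGap] at h2
  set L := -Real.log (2 * phiPrim κ)
  set a := (κ * phi κ / phiPrim κ) ^ 2
  have ha : 0 ≤ a := by positivity
  have hl : 0 < Real.log 2 := Real.log_pos (by norm_num)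
  rcases le_or_gt α 0 with h | h
  · nlinarith
  · have : α * a * Real.log 2 < Real.log 2 := by nlinarith
    have : α * a < 1 := by nlinarith
    linarith

/-! ### The critical distance and the gap of the rate at its centre -/

/-- Near `0` the loss in `log q` is of order `√β` and beats the entropy `β log (1 / β)`. -/
theorem tendsto_sqrt_mul_rateDeriv {κ : ℝ} (hκ : 0 < κ) (α : ℝ) :
    Tendsto (fun β => √β * rateDeriv κ α β) (𝓝[>] 0)
      (𝓝 (-(α * Real.exp (-κ ^ 2 / 2) / (Real.pi * gaussProb κ)))) := by
  have hid : Tendsto (fun β : ℝ => β) (𝓝[>] 0) (𝓝 0) := tendsto_nhdsWithin_of_tendsto_nhds tendsto_id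
  have hmem : ∀ᶠ β : ℝ in 𝓝[>] 0, β ∈ Set.Ioo (0 : ℝ) 1 := Ioo_mem_nhdsGT one_pos
  have h1 : Tendsto (fun β : ℝ => √β * Real.log (1 - β)) (𝓝[>] 0) (𝓝 0) := by
    have : ContinuousAt (fun β : ℝ => √β * Real.log (1 - β)) 0 := by
      have : (1 : ℝ) - 0 ≠ 0 := by norm_num
      fun_prop (disch := assumption)
    have := this.tendsto.mono_left (nhdsWithin_le_nhds (s := Set.Ioi 0))
    simpa using this
  have h2 : Tendsto (fun β : ℝ => √β * Real.log β) (𝓝[>] 0) (𝓝 0) := by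
    have := tendsto_log_mul_rpow_nhdsGT_zero (r := 1 / 2) (by norm_num)
    refine this.congr fun β => ?_
    rw [Real.sqrt_eq_rpow]; ring
  have hq : Tendsto (fun β : ℝ => pairProb κ β) (𝓝[>] 0) (𝓝 (gaussProb κ)) := by
    have := (continuousOn_pairProb κ) 0 ⟨le_rfl, zero_le_one⟩
    rw [ContinuousWithinAt, pairProb_zero] at this
    refine this.mono_left ?_
    rw [nhdsWithin_le_iff]
    filter_upwards [hmem] with β hβ using ⟨hβ.1.le, hβ.2.le⟩
  have he1 : Tendsto (fun β : ℝ => Real.exp (-κ ^ 2 / (1 + (2 * β - 1)))) (𝓝[>] 0) (𝓝 0) := by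
    have h := (tendsto_inv_nhdsGT_zero (𝕜 := ℝ)).const_mul_atTop (show 0 < κ ^ 2 / 2 by positivity)
    refine (Real.tendsto_exp_neg_atTop_nhds_zero.comp h).congr fun β => ?_
    simp only [Function.comp]
    congr 1
    rw [show 1 + (2 * β - 1) = 2 * β by ring, neg_div, ← div_div]; rfl
  have he2 : Tendsto (fun β : ℝ => Real.exp (-κ ^ 2 / (1 - (2 * β - 1)))) (𝓝[>] 0)
      (𝓝 (Real.exp (-κ ^ 2 / 2))) := by
    have : ContinuousAt (fun β : ℝ => Real.exp (-κ ^ 2 / (1 - (2 * β - 1)))) 0 := by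
      have : (1 : ℝ) - (2 * 0 - 1) ≠ 0 := by norm_num
      fun_prop (disch := assumption)
    have := this.tendsto.mono_left (nhdsWithin_le_nhds (s := Set.Ioi 0))
    norm_num at this
    exact this
  have hs : Tendsto (fun β : ℝ => 1 / (Real.pi * √(1 - β))) (𝓝[>] 0) (𝓝 (1 / Real.pi)) := by
    have : ContinuousAt (fun β : ℝ => 1 / (Real.pi * √(1 - β))) 0 := by
      have : Real.pi * √(1 - (0 : ℝ)) ≠ 0 := by simp [Real.pi_ne_zero]
      fun_prop (disch := assumption)
    have := this.tendsto.mono_left (nhdsWithin_le_nhds (s := Set.Ioi 0))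
    simpa using this
  have h3 := (h1.sub h2).add (((hs.mul (he1.sub he2)).div hq (gaussProb_pos hκ).ne').const_mul α)
  have h4 : 0 - 0 + α * (1 / Real.pi * (0 - Real.exp (-κ ^ 2 / 2)) / gaussProb κ) =
      -(α * Real.exp (-κ ^ 2 / 2) / (Real.pi * gaussProb κ)) := by
    field_simp; ring
  rw [h4] at h3
  refine h3.congr' ?_
  filter_upwards [hmem] with β hβ
  have hb : 0 < √β := Real.sqrt_pos.2 hβ.1
  have hb1 : 0 < √(1 - β) := Real.sqrt_pos.2 (by linarith [hβ.2])
  have hsq : √(1 - (2 * β - 1) ^ 2) = 2 * (√β * √(1 - β)) := by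
    rw [← Real.sqrt_mul hβ.1.le, show 1 - (2 * β - 1) ^ 2 = 2 ^ 2 * (β * (1 - β)) by ring,
      Real.sqrt_mul (by norm_num), Real.sqrt_sq (by norm_num)]
  simp only [Pi.div_apply]
  rw [rateDeriv, pairDeriv, hsq]
  field_simp

theorem rate_zero (κ α : ℝ) : rate κ α 0 = α * Real.log (gaussProb κ) := by
  simp [rate, pairProb_zero]

theorem rate_half (κ α : ℝ) :
    rate κ α (1 / 2) = Real.log 2 + 2 * (α * Real.log (gaussProb κ)) := by
  rw [rate, pairProb_half, Real.log_pow, one_div, Real.binEntropy_two_inv]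
  push_cast; ring

/-- Near `0` the rate function drops below its value at `0` at least like `√β`. -/
theorem rate_near_zero {κ α : ℝ} (hκ : 0 < κ) (hα : 0 < α) :
    ∃ A b : ℝ, 0 < A ∧ 0 < b ∧ b < 1 / 2 ∧
      (∀ β ∈ Set.Ioc 0 b, rateDeriv κ α β < 0) ∧
      ∀ β ∈ Set.Icc 0 b, rate κ α β - α * Real.log (gaussProb κ) ≤ -A * √β := by
  have hp := gaussProb_pos hκ
  have hpi := Real.pi_pos
  set B := α * Real.exp (-κ ^ 2 / 2) / (Real.pi * gaussProb κ)
  have hB : 0 < B := by positivity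
  have h := (tendsto_sqrt_mul_rateDeriv hκ α).eventually_le_const (show -B < -B / 2 by linarith)
  obtain ⟨u, hu0, hu⟩ := (mem_nhdsGT_iff_exists_Ioo_subset).1 h
  have hu0' : (0 : ℝ) < u := hu0
  set b := min (u / 2) (1 / 4)
  have hb : 0 < b := by positivity
  have hbu : b < u := (min_le_left _ _).trans_lt (by linarith)
  have hb2 : b ≤ 1 / 4 := min_le_right _ _
  have hkey : ∀ β ∈ Set.Ioc 0 b, √β * rateDeriv κ α β ≤ -B / 2 := fun β hβ =>
    hu ⟨hβ.1, hβ.2.trans_lt hbu⟩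
  refine ⟨B, b, hB, hb, by linarith, fun β hβ => ?_, ?_⟩
  · have := hkey β hβ
    have h2 := Real.sqrt_pos.2 hβ.1
    by_contra hcon
    have := mul_nonneg h2.le (not_lt.1 hcon)
    linarith
  · have hanti : AntitoneOn (fun β => rate κ α β + B * √β) (Set.Icc 0 b) := by
      have hd : ∀ x ∈ interior (Set.Icc 0 b), HasDerivAt (fun β => rate κ α β + B * √β)
          (rateDeriv κ α x + B * (1 / (2 * √x))) x := fun x hx => by
        rw [interior_Icc] at hx
        exact (hasDerivAt_rate hκ α ⟨hx.1, by linarith [hx.2]⟩).add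
          ((Real.hasDerivAt_sqrt hx.1.ne').const_mul B)
      refine antitoneOn_of_deriv_nonpos (convex_Icc _ _) ?_
        (fun x hx => (hd x hx).differentiableAt.differentiableWithinAt) fun x hx => ?_
      · exact ((continuousOn_rate hκ α).mono (Set.Icc_subset_Icc_right (by linarith))).add
          (by fun_prop)
      · rw [(hd x hx).deriv]
        rw [interior_Icc] at hx
        have h1 := hkey x ⟨hx.1, hx.2.le⟩
        have h2 := Real.sqrt_pos.2 hx.1
        have h3 : √x * (rateDeriv κ α x + B * (1 / (2 * √x))) ≤ 0 := by
          have : √x * (B * (1 / (2 * √x))) = B / 2 := by field_simp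
          rw [mul_add, this]; linarith
        by_contra hcon
        have := mul_pos h2 (not_le.1 hcon)
        linarith
    intro β hβ
    have := hanti ⟨le_rfl, hb.le⟩ hβ hβ.1
    simp only [rate_zero, Real.sqrt_zero, mul_zero, add_zero] at this
    linarith

theorem rateDeriv_half (κ α : ℝ) : rateDeriv κ α (1 / 2) = 0 := by
  have e : (2 : ℝ) * (1 / 2) - 1 = 0 := by norm_num
  rw [rateDeriv, e, pairDeriv_zero]
  norm_num

/-- The curvature at `1/2` controls the derivative of the rate function to the left of `1/2`. -/
theorem rateDeriv_near_half {κ α : ℝ} (hκ : 0 < κ) (hαc : α < criticalDensity κ) :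
    ∃ m θ : ℝ, 0 < m ∧ 0 < θ ∧ θ < 1 / 2 ∧
      ∀ β ∈ Set.Icc (1 / 2 - θ) (1 / 2), m * (1 / 2 - β) ≤ rateDeriv κ α β := by
  set M := -(-4 + 4 * α * (κ * phi κ / phiPrim κ) ^ 2)
  have hM : 0 < M := by have := rate_half_curvature hκ hαc; linarith
  have h := (hasDerivAt_rateDeriv_half hκ α).isLittleO
  have h2 := h.def (show 0 < M / 2 by linarith)
  rw [Metric.eventually_nhds_iff] at h2
  obtain ⟨ε, hε, h2⟩ := h2
  refine ⟨M / 2, min (ε / 2) (1 / 4), by linarith, by positivity,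
    (min_le_right _ _).trans_lt (by norm_num), fun β hβ => ?_⟩
  have h3 : dist β (1 / 2) < ε := by
    have := min_le_left (ε / 2) (1 / 4)
    rw [Real.dist_eq, abs_sub_comm, abs_of_nonneg (by linarith [hβ.2])]
    linarith [hβ.1]
  have h4 := h2 h3
  rw [rateDeriv_half] at h4
  simp only [sub_zero, smul_eq_mul, Real.norm_eq_abs] at h4
  rw [abs_sub_comm β, abs_of_nonneg (show 0 ≤ 1 / 2 - β by linarith [hβ.2])] at h4
  have h5 := (abs_le.1 h4).1
  have h6 : (β - 1 / 2) * (-4 + 4 * α * (κ * phi κ / phiPrim κ) ^ 2) = M * (1 / 2 - β) := by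
    simp only [M]; ring
  rw [h6] at h5
  linarith

/-- The single-critical-point condition makes the rate function unimodal on `[0, 1/2]`. -/
theorem rate_unimodal {κ α : ℝ} (hκ : 0 < κ) (hα : 0 < α) (hαc : α < criticalDensity κ)
    (hF : SingleCriticalPoint κ α) :
    ∃ β₀ ∈ Set.Ioo (0 : ℝ) (1 / 2), StrictAntiOn (rate κ α) (Set.Icc 0 β₀) ∧
      StrictMonoOn (rate κ α) (Set.Icc β₀ (1 / 2)) := by
  have hcurv := rate_half_curvature hκ hαc
  rw [← deriv_deriv_rate_half hκ] at hcurv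
  obtain ⟨β₀, ⟨hβ₀, hcrit⟩, huniq⟩ := hF hcurv
  obtain ⟨A, b, -, hb, hb2, hneg, -⟩ := rate_near_zero hκ hα
  obtain ⟨m, θ, hm, hθ, hθ2, hpos⟩ := rateDeriv_near_half hκ hαc
  have hcont := continuousOn_rateDeriv hκ α
  have hne : ∀ x ∈ Set.Ioo (0 : ℝ) (1 / 2), x ≠ β₀ → rateDeriv κ α x ≠ 0 := fun x hx hxβ h0 => by
    refine hxβ (huniq x ⟨hx, ?_⟩)
    have := hasDerivAt_rate hκ α (β := x) ⟨hx.1, by linarith [hx.2]⟩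
    rwa [h0] at this
  have hleft : ∀ x ∈ Set.Ioo 0 β₀, rateDeriv κ α x < 0 := by
    intro x hx
    by_contra hcon
    set y := min b (x / 2)
    have hx0 := hx.1
    have hy : 0 < y := lt_min hb (by linarith)
    have hyx : y < x := (min_le_right _ _).trans_lt (by linarith)
    have hyneg := hneg y ⟨hy, min_le_left _ _⟩
    have hivt := intermediate_value_Icc hyx.le (f := rateDeriv κ α)
      (hcont.mono fun z hz => ⟨hy.trans_le hz.1, by linarith [hz.2, hx.2, hβ₀.2]⟩)
    obtain ⟨z, hz, hz0⟩ := hivt ⟨hyneg.le, not_lt.1 hcon⟩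
    exact hne z ⟨hy.trans_le hz.1, by linarith [hz.2, hx.2, hβ₀.2]⟩
      (by linarith [hz.2, hx.2] : z < β₀).ne hz0
  have hright : ∀ x ∈ Set.Ioo β₀ (1 / 2), 0 < rateDeriv κ α x := by
    intro x hx
    by_contra hcon
    set y := max (1 / 2 - θ) ((x + 1 / 2) / 2)
    have hy : y < 1 / 2 := max_lt (by linarith) (by linarith [hx.2])
    have hyx : x < y := lt_of_lt_of_le (by linarith [hx.2]) (le_max_right _ _)
    have hypos : 0 < rateDeriv κ α y :=
      lt_of_lt_of_le (mul_pos hm (by linarith)) (hpos y ⟨le_max_left _ _, hy.le⟩)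
    have hivt := intermediate_value_Icc hyx.le (f := rateDeriv κ α)
      (hcont.mono fun z hz => ⟨by linarith [hz.1, hx.1, hβ₀.1], by linarith [hz.2]⟩)
    obtain ⟨z, hz, hz0⟩ := hivt ⟨not_lt.1 hcon, hypos.le⟩
    exact hne z ⟨by linarith [hz.1, hx.1, hβ₀.1], by linarith [hz.2]⟩
      (by linarith [hz.1, hx.1] : β₀ < z).ne' hz0
  refine ⟨β₀, hβ₀, ?_, ?_⟩
  · refine strictAntiOn_of_deriv_neg (convex_Icc _ _)
      ((continuousOn_rate hκ α).mono (Set.Icc_subset_Icc_right (by linarith [hβ₀.2])))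
      fun x hx => ?_
    rw [interior_Icc] at hx
    rw [(hasDerivAt_rate hκ α ⟨hx.1, by linarith [hx.2, hβ₀.2]⟩).deriv]
    exact hleft x hx
  · refine strictMonoOn_of_deriv_pos (convex_Icc _ _)
      ((continuousOn_rate hκ α).mono (Set.Icc_subset_Icc hβ₀.1.le (by norm_num)))
      fun x hx => ?_
    rw [interior_Icc] at hx
    rw [(hasDerivAt_rate hκ α ⟨by linarith [hx.1, hβ₀.1], by linarith [hx.2]⟩).deriv]
    exact hright x hx

/-- The critical distance exists and is unique, and below it the rate function is negative,
with a gap of order `√β`. -/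
theorem exists_criticalDistance {κ α : ℝ} (hκ : 0 < κ) (hα : 0 < α)
    (hαc : α < criticalDensity κ) (hF : SingleCriticalPoint κ α) :
    ∃ βc : ℝ, IsCriticalDistance κ α βc ∧ (∀ β, IsCriticalDistance κ α β → β = βc) ∧
      ∀ δ ∈ Set.Ioo 0 βc, ∃ c : ℝ, 0 < c ∧ ∀ β ∈ Set.Ioc 0 (βc - δ),
        rate κ α β - α * Real.log (gaussProb κ) ≤ -c * √β := by
  obtain ⟨β₀, hβ₀, hanti, hmono⟩ := rate_unimodal hκ hα hαc hF
  obtain ⟨A, b, hA, hb, hb2, -, hnear⟩ := rate_near_zero hκ hα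
  set e := α * Real.log (gaussProb κ) with he
  have h0 : rate κ α 0 = e := rate_zero κ α
  have hhalf : e < rate κ α (1 / 2) := by
    have := mul_neg_log_gaussProb_lt hκ hαc
    rw [rate_half, ← he]
    have : α * -Real.log (gaussProb κ) = -e := by rw [he]; ring
    linarith
  have hlow : ∀ β ∈ Set.Ioc 0 β₀, rate κ α β < e := fun β hβ => by
    rw [← h0]; exact hanti ⟨le_rfl, hβ₀.1.le⟩ ⟨hβ.1.le, hβ.2⟩ hβ.1
  have hivt := intermediate_value_Ioo hβ₀.2.le (f := rate κ α)
    ((continuousOn_rate hκ α).mono (Set.Icc_subset_Icc hβ₀.1.le (by norm_num)))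
  obtain ⟨βc, hβc, hroot⟩ := hivt ⟨hlow β₀ ⟨hβ₀.1, le_rfl⟩, hhalf⟩
  have hneg : ∀ β ∈ Set.Ioo 0 βc, rate κ α β < e := fun β hβ => by
    rcases le_total β β₀ with h | h
    · exact hlow β ⟨hβ.1, h⟩
    · rw [← hroot]
      exact hmono ⟨h, (hβ.2.trans hβc.2).le⟩ ⟨hβc.1.le, hβc.2.le⟩ hβ.2
  refine ⟨βc, ⟨⟨hβ₀.1.trans hβc.1, hβc.2⟩, by rw [hroot]; ring⟩, ?_, ?_⟩
  · rintro β ⟨hβ, hβ0⟩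
    have hβe : rate κ α β = e := by linarith
    have hge : β₀ ≤ β := by
      by_contra hcon
      exact (hlow β ⟨hβ.1, (not_le.1 hcon).le⟩).ne hβe
    exact hmono.injOn ⟨hge, hβ.2.le⟩ ⟨hβc.1.le, hβc.2.le⟩ (hβe.trans hroot.symm)
  · intro δ hδ
    rcases le_or_gt (βc - δ) b with hle | hlt
    · exact ⟨A, hA, fun β hβ => hnear β ⟨hβ.1.le, hβ.2.trans hle⟩⟩
    · obtain ⟨x, hx, hmax⟩ := isCompact_Icc.exists_isMaxOn (Set.nonempty_Icc.2 hlt.le)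
        ((continuousOn_rate hκ α).mono (Set.Icc_subset_Icc hb.le
          (by linarith [hδ.1, hβc.2] : βc - δ ≤ 1)))
      have hx' := hneg x ⟨hb.trans_le hx.1, by linarith [hx.2, hδ.1]⟩
      refine ⟨min A (e - rate κ α x), lt_min hA (by linarith), fun β hβ => ?_⟩
      have hs := Real.sqrt_nonneg β
      rcases le_total β b with h | h
      · have h1 := hnear β ⟨hβ.1.le, h⟩
        have h2 := mul_le_mul_of_nonneg_right (min_le_left A (e - rate κ α x)) hs
        linarith
      · have h1 : rate κ α β ≤ rate κ α x := hmax ⟨h, hβ.2⟩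
        have h2 := mul_le_mul_of_nonneg_right (min_le_right A (e - rate κ α x)) hs
        have h3 : √β ≤ 1 := Real.sqrt_le_one.2 (by linarith [hβ.2, hδ.1, hβc.2])
        have h4 : (e - rate κ α x) * √β ≤ (e - rate κ α x) * 1 := by
          gcongr
        linarith

/-- The rate function has a quadratic maximum at `1/2`. -/
theorem rate_quadratic_gap {κ α : ℝ} (hκ : 0 < κ) (hα : 0 < α) (hαc : α < criticalDensity κ)
    (hF : SingleCriticalPoint κ α) :
    ∃ c : ℝ, 0 < c ∧ ∀ β ∈ Set.Icc (0 : ℝ) 1,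
      rate κ α β ≤ rate κ α (1 / 2) - c * (2 * β - 1) ^ 2 := by
  obtain ⟨β₀, hβ₀, hanti, hmono⟩ := rate_unimodal hκ hα hαc hF
  obtain ⟨m, θ, hm, hθ, hθ2, hpos⟩ := rateDeriv_near_half hκ hαc
  have hcont := continuousOn_rate hκ α
  have hhalf : rate κ α 0 < rate κ α (1 / 2) := by
    have := mul_neg_log_gaussProb_lt hκ hαc
    rw [rate_half, rate_zero]; linarith
  have hlt : ∀ β ∈ Set.Icc 0 (1 / 2 - θ), rate κ α β < rate κ α (1 / 2) := fun β hβ => by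
    rcases le_total β β₀ with h | h
    · exact (hanti.antitoneOn ⟨le_rfl, hβ₀.1.le⟩ ⟨hβ.1, h⟩ hβ.1).trans_lt hhalf
    · exact hmono ⟨h, by linarith [hβ.2]⟩ ⟨hβ₀.2.le, le_rfl⟩ (by linarith [hβ.2])
  obtain ⟨x, hx, hmax⟩ := isCompact_Icc.exists_isMaxOn
    (Set.nonempty_Icc.2 (show (0 : ℝ) ≤ 1 / 2 - θ by linarith))
    (hcont.mono (Set.Icc_subset_Icc_right (by linarith : 1 / 2 - θ ≤ 1)))
  have hx' := hlt x hx
  have hnear : ∀ β ∈ Set.Icc (1 / 2 - θ) (1 / 2),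
      rate κ α β ≤ rate κ α (1 / 2) - m / 8 * (2 * β - 1) ^ 2 := by
    have hd : ∀ x ∈ Set.Icc (1 / 2 - θ) (1 / 2),
        HasDerivAt (fun x => rate κ α x + m / 8 * (2 * x - 1) ^ 2)
          (rateDeriv κ α x + m / 2 * (2 * x - 1)) x := fun x hx => by
      have h2 : HasDerivAt (fun x : ℝ => 2 * x - 1) 2 x := by
        simpa using ((hasDerivAt_id x).const_mul 2).sub_const 1
      refine ((hasDerivAt_rate hκ α ⟨by linarith [hx.1], by linarith [hx.2]⟩).add
        ((h2.pow 2).const_mul (m / 8))).congr_deriv ?_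
      push_cast; ring
    have hmon : MonotoneOn (fun x => rate κ α x + m / 8 * (2 * x - 1) ^ 2)
        (Set.Icc (1 / 2 - θ) (1 / 2)) := by
      refine monotoneOn_of_deriv_nonneg (convex_Icc _ _)
        (fun x hx => (hd x hx).continuousAt.continuousWithinAt)
        (fun x hx => (hd x (interior_subset hx)).differentiableAt.differentiableWithinAt)
        fun x hx => ?_
      rw [(hd x (interior_subset hx)).deriv]
      have := hpos x (interior_subset hx)
      linarith
    intro β hβ
    have := hmon hβ ⟨by linarith, le_rfl⟩ hβ.2
    norm_num at this ⊢
    linarith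
  refine ⟨min (m / 8) (rate κ α (1 / 2) - rate κ α x), lt_min (by linarith) (by linarith), ?_⟩
  intro β hβ
  wlog h : β ≤ 1 / 2 generalizing β
  · have := this (1 - β) ⟨by linarith [hβ.2], by linarith [hβ.1]⟩ (by linarith)
    rw [rate, Real.binEntropy_one_sub, pairProb_one_sub κ hβ, ← rate] at this
    refine this.trans (le_of_eq ?_)
    ring
  have hs := sq_nonneg (2 * β - 1)
  rcases le_total β (1 / 2 - θ) with h' | h'
  · have h1 : rate κ α β ≤ rate κ α x := hmax ⟨hβ.1, h'⟩
    have h2 := mul_le_mul_of_nonneg_right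
      (min_le_right (m / 8) (rate κ α (1 / 2) - rate κ α x)) hs
    have h3 : (2 * β - 1) ^ 2 ≤ 1 := by nlinarith [hβ.1, hβ.2]
    have h4 : (rate κ α (1 / 2) - rate κ α x) * (2 * β - 1) ^ 2 ≤
        (rate κ α (1 / 2) - rate κ α x) * 1 := by
      gcongr
    linarith
  · have h1 := hnear β ⟨h', h⟩
    have h2 := mul_le_mul_of_nonneg_right
      (min_le_left (m / 8) (rate κ α (1 / 2) - rate κ α x)) hs
    linarith

/-! ### Counting pairs of solutions -/

theorem measurable_comp_solutions (κ : ℝ) {N m : ℕ} {E : Type*} [MeasurableSpace E]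
    (f : Set (Cube N) → E) :
    Measurable fun X : Fin m → Fin N → ℝ => f (solutions κ X) := by
  intro U _
  have h : (fun X : Fin m → Fin N → ℝ => f (solutions κ X)) ⁻¹' U =
      ⋃ T ∈ {T : Set (Cube N) | f T ∈ U}, {X | solutions κ X = T} := by
    ext X; simp
  rw [h]
  exact MeasurableSet.biUnion (Set.to_countable _) fun T _ => measurableSet_solutions_eq κ T

instance (N m : ℕ) : IsProbabilityMeasure (disorder N m) := by
  unfold disorder; infer_instance

theorem exists_abs_le_of_finite {ι : Type*} [Finite ι] (f : ι → ℝ) : ∃ C, ∀ i, |f i| ≤ C := by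
  obtain ⟨C, hC⟩ := (Set.finite_range fun i => |f i|).bddAbove
  exact ⟨C, fun i => hC ⟨i, rfl⟩⟩

theorem integrable_comp_solutions (κ : ℝ) {N m : ℕ} (f : Set (Cube N) → ℝ) :
    Integrable (fun X => f (solutions κ X)) (disorder N m) := by
  obtain ⟨C, hC⟩ := exists_abs_le_of_finite f
  exact Integrable.of_bound (measurable_comp_solutions κ f).aestronglyMeasurable C
    (ae_of_all _ fun X => hC _)

/-- The expectation of a function of the solution space of `m` constraints. -/
def expect (κ : ℝ) (N m : ℕ) (f : Set (Cube N) → ℝ) : ℝ :=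
  ∫ X, f (solutions κ X) ∂disorder N m

theorem measurable_comp_inter_constraintSet (κ : ℝ) {N : ℕ} (T : Set (Cube N))
    {E : Type*} [MeasurableSpace E] (f : Set (Cube N) → E) :
    Measurable fun x : Fin N → ℝ => f (T ∩ constraintSet κ x) := by
  have h := measurable_comp_solutions κ (m := 1) fun U => f (T ∩ U)
  have h2 := h.comp (measurable_pi_lambda (fun x : Fin N → ℝ => fun _ : Fin 1 => x)
    fun _ => measurable_id)
  refine (congrArg Measurable (funext fun x => ?_)).mp h2
  exact congrArg (fun U => f (T ∩ U)) (Set.iInter_const (ι := Fin 1) (constraintSet κ x))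

theorem integrable_comp_inter_constraintSet (κ : ℝ) {N : ℕ} (T : Set (Cube N))
    (f : Set (Cube N) → ℝ) :
    Integrable (fun x => f (T ∩ constraintSet κ x)) (rowLaw N) := by
  obtain ⟨C, hC⟩ := exists_abs_le_of_finite f
  exact Integrable.of_bound (measurable_comp_inter_constraintSet κ T f).aestronglyMeasurable C
    (ae_of_all _ fun X => hC _)

/-- Adding one constraint to the system. -/
theorem expect_succ (κ : ℝ) (N m : ℕ) (f : Set (Cube N) → ℝ) :
    expect κ N (m + 1) f =
      expect κ N m fun T => ∫ x, f (T ∩ constraintSet κ x) ∂rowLaw N := by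
  have hmp := measurePreserving_piFinSuccAbove
    (fun _ : Fin (m + 1) => (Measure.pi fun _ : Fin N => gaussianReal 0 1)) 0
  have hsol : ∀ (x : Fin N → ℝ) (X : Fin m → Fin N → ℝ),
      solutions κ (Fin.cons x X : Fin (m + 1) → Fin N → ℝ) =
        solutions κ X ∩ constraintSet κ x := by
    intro x X
    ext σ
    simp [solutions, Fin.forall_fin_succ, and_comm]
  have h1 := hmp.symm.integral_comp' (g := fun X : Fin (m + 1) → Fin N → ℝ => f (solutions κ X))
  rw [expect, disorder, ← h1, integral_prod_symm]
  · simp only [MeasurableEquiv.piFinSuccAbove_symm_apply, Fin.insertNthEquiv, Fin.insertNth_zero]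
    refine integral_congr_ae (ae_of_all _ fun X => ?_)
    refine integral_congr_ae (ae_of_all _ fun x => ?_)
    exact congrArg f (hsol x X)
  · have h2 := integrable_comp_solutions κ (m := m + 1) f
    exact hmp.symm.integrable_comp_emb (MeasurableEquiv.measurableEmbedding _) |>.2 h2

theorem expect_mono (κ : ℝ) (N m : ℕ) {f g : Set (Cube N) → ℝ} (h : ∀ T, f T ≤ g T) :
    expect κ N m f ≤ expect κ N m g :=
  integral_mono (integrable_comp_solutions κ f) (integrable_comp_solutions κ g) fun _ => h _

theorem expect_add (κ : ℝ) (N m : ℕ) (f g : Set (Cube N) → ℝ) :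
    expect κ N m (fun T => f T + g T) = expect κ N m f + expect κ N m g :=
  integral_add (integrable_comp_solutions κ f) (integrable_comp_solutions κ g)

theorem expect_const_mul (κ : ℝ) (N m : ℕ) (c : ℝ) (f : Set (Cube N) → ℝ) :
    expect κ N m (fun T => c * f T) = c * expect κ N m f :=
  integral_const_mul _ _

theorem expect_const (κ : ℝ) (N m : ℕ) (c : ℝ) : expect κ N m (fun _ => c) = c := by
  simp [expect]

theorem expect_sum (κ : ℝ) (N m : ℕ) {ι : Type*} (s : Finset ι) (f : ι → Set (Cube N) → ℝ) :
    expect κ N m (fun T => ∑ i ∈ s, f i T) = ∑ i ∈ s, expect κ N m (f i) :=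
  integral_finsetSum _ fun i _ => integrable_comp_solutions κ (f i)

/-- The number of points of a subset of the cube. -/
def cnt {N : ℕ} (T : Set (Cube N)) : ℝ := ∑ σ, T.indicator 1 σ

/-- The sum of a weight over the ordered pairs of points of a subset of the cube. -/
def pairSum {N : ℕ} (w : Cube N → Cube N → ℝ) (T : Set (Cube N)) : ℝ :=
  ∑ σ, ∑ τ, w σ τ * (T.indicator 1 σ * T.indicator 1 τ)

theorem expect_indicator_mul {κ : ℝ} {N : ℕ} (hN : 0 < N) (m : ℕ) (σ τ : Cube N) :
    expect κ N m (fun T => T.indicator 1 σ * T.indicator 1 τ) =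
      pairProb κ (1 - hammingDist σ τ / N) ^ m := by
  have h1 : ∀ X : Fin m → Fin N → ℝ,
      ((solutions κ X).indicator 1 σ * (solutions κ X).indicator 1 τ : ℝ) =
      (Set.univ.pi fun _ => {x : Fin N → ℝ | σ ∈ constraintSet κ x ∧ τ ∈ constraintSet κ x}
        ).indicator 1 X := by
    intro X
    have hmem : X ∈ (Set.univ.pi fun _ : Fin m =>
        {x : Fin N → ℝ | σ ∈ constraintSet κ x ∧ τ ∈ constraintSet κ x}) ↔
        σ ∈ solutions κ X ∧ τ ∈ solutions κ X := by
      simp only [Set.mem_pi, Set.mem_univ, true_implies, Set.mem_ofPred_eq, forall_and, solutions,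
        Set.mem_iInter]
    by_cases h1 : σ ∈ solutions κ X <;> by_cases h2 : τ ∈ solutions κ X <;>
      simp [hmem, h1, h2]
  simp_rw [expect, h1]
  have hms : MeasurableSet {x : Fin N → ℝ | σ ∈ constraintSet κ x ∧ τ ∈ constraintSet κ x} :=
    (measurableSet_mem_constraintSet κ σ).inter (measurableSet_mem_constraintSet κ τ)
  rw [integral_indicator_one (MeasurableSet.univ_pi fun _ => hms),
    disorder, measureReal_def, Measure.pi_pi, ENNReal.toReal_prod]
  simp only [← measureReal_def]
  have := prob_pair hN κ σ τ
  rw [rowLaw] at this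
  simp [this]

theorem hammingDist_div_mem_Icc {N : ℕ} (σ τ : Cube N) :
    (hammingDist σ τ : ℝ) / N ∈ Set.Icc (0 : ℝ) 1 := by
  refine ⟨by positivity, div_le_one_of_le₀ ?_ (by positivity)⟩
  have := hammingDist_le_card_fintype (x := σ) (y := τ)
  rw [Fintype.card_fin] at this
  exact_mod_cast this

theorem expect_pairSum {κ : ℝ} {N : ℕ} (hN : 0 < N) (m : ℕ) (w : Cube N → Cube N → ℝ) :
    expect κ N m (pairSum w) =
      ∑ σ, ∑ τ, w σ τ * pairProb κ (hammingDist σ τ / N) ^ m := by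
  unfold pairSum
  rw [expect_sum]
  refine Finset.sum_congr rfl fun σ _ => ?_
  rw [expect_sum]
  refine Finset.sum_congr rfl fun τ _ => ?_
  rw [expect_const_mul, expect_indicator_mul hN, pairProb_one_sub κ (hammingDist_div_mem_Icc σ τ)]

theorem expect_cnt {κ : ℝ} {N : ℕ} (hN : 0 < N) (m : ℕ) :
    expect κ N m cnt = 2 ^ N * gaussProb κ ^ m := by
  unfold cnt
  rw [expect_sum]
  have h : ∀ σ : Cube N, expect κ N m (fun T => T.indicator 1 σ) = gaussProb κ ^ m := by
    intro σ
    have h := expect_indicator_mul (κ := κ) hN m σ σ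
    rw [hammingDist_self, Nat.cast_zero, zero_div, sub_zero, pairProb_one] at h
    rw [← h]
    congr 1
    funext T
    by_cases h : σ ∈ T <;> simp [h]
  simp_rw [h]
  simp

/-- The number of points at distance `d` from `σ` is at most `exp (N H(d/N))`. -/
theorem card_sphere_le {N : ℕ} (hN : 0 < N) (σ : Cube N) {d : ℕ} (hd : d ≤ N) :
    ((Finset.univ.filter fun τ : Cube N => hammingDist σ τ = d).card : ℝ) ≤
      Real.exp (N * Real.binEntropy (d / N)) := by
  set β : ℝ := d / N with hβ
  have hN' : (0 : ℝ) < N := by positivity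
  have hβ0 : 0 ≤ β := by positivity
  have hβ1 : β ≤ 1 := div_le_one_of_le₀ (by exact_mod_cast hd) hN'.le
  have hprod : ∀ τ : Cube N, ∏ j, (if σ j ≠ τ j then β else 1 - β) =
      β ^ hammingDist σ τ * (1 - β) ^ (N - hammingDist σ τ) := by
    intro τ
    rw [Finset.prod_ite, Finset.prod_const, Finset.prod_const, hammingDist]
    congr 2
    rw [Finset.filter_not, Finset.card_sdiff_of_subset (Finset.filter_subset _ _)]
    simp
  have hsum : ∑ τ : Cube N, ∏ j, (if σ j ≠ τ j then β else 1 - β) = 1 := by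
    have h := Finset.prod_univ_sum (κ := fun _ : Fin N => ℤˣ) (fun _ => Finset.univ)
      (fun j u => if σ j ≠ u then β else 1 - β)
    rw [Fintype.piFinset_univ] at h
    rw [← h, Finset.prod_eq_one]
    intro j _
    rw [show (Finset.univ : Finset ℤˣ) = {1, -1} from rfl, Finset.sum_pair (by decide)]
    rcases Int.units_eq_one_or (σ j) with h | h <;> simp [h]
  have hle : ((Finset.univ.filter fun τ : Cube N => hammingDist σ τ = d).card : ℝ) *
      (β ^ d * (1 - β) ^ (N - d)) ≤ 1 := by
    simp_rw [hprod] at hsum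
    rw [← nsmul_eq_mul, ← Finset.sum_const]
    have h1 : 0 ≤ 1 - β := by linarith
    calc _ = ∑ τ ∈ Finset.univ.filter (fun τ : Cube N => hammingDist σ τ = d),
          β ^ hammingDist σ τ * (1 - β) ^ (N - hammingDist σ τ) :=
          Finset.sum_congr rfl fun τ hτ => by rw [(Finset.mem_filter.1 hτ).2]
      _ ≤ ∑ τ : Cube N, β ^ hammingDist σ τ * (1 - β) ^ (N - hammingDist σ τ) :=
          Finset.sum_le_univ_sum_of_nonneg fun τ => by positivity
      _ = 1 := hsum
  have hexp : β ^ d * (1 - β) ^ (N - d) = (Real.exp (N * Real.binEntropy β))⁻¹ := by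
    have hd' : (d : ℝ) = N * β := by rw [hβ]; field_simp
    have hd2 : ((N - d : ℕ) : ℝ) = N * (1 - β) := by rw [Nat.cast_sub hd, hd']; ring
    have e : ∀ (b : ℝ) (n : ℕ), 0 ≤ b → (b = 0 → n = 0) → b ^ n = Real.exp (n * Real.log b) := by
      intro b n hb h
      rcases hb.eq_or_lt with h0 | h0
      · simp [h h0.symm]
      · rw [← Real.log_pow, Real.exp_log (by positivity)]
    rw [e β d hβ0 (fun h => by rw [h] at hd'; simpa using hd'),
      e (1 - β) (N - d) (by linarith) (fun h => by rw [h] at hd2; exact_mod_cast (by simpa using hd2)),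
      ← Real.exp_add, ← Real.exp_neg, hd', hd2]
    congr 1
    rw [Real.binEntropy, Real.log_inv, Real.log_inv]
    ring
  rw [hexp, ← div_eq_mul_inv, div_le_one (Real.exp_pos _)] at hle
  exact hle

/-- A sum over the cube of a function of the distance to `σ`, sphere by sphere. -/
theorem sum_hammingDist_le {N : ℕ} (hN : 0 < N) (σ : Cube N) {f : ℕ → ℝ} {B : ℝ}
    (h0 : ∀ d, 0 ≤ f d)
    (hf : ∀ d ≤ N, Real.exp (N * Real.binEntropy (d / N)) * f d ≤ B) :
    ∑ τ, f (hammingDist σ τ) ≤ (N + 1) * B := by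
  have hmaps : ∀ τ ∈ (Finset.univ : Finset (Cube N)), hammingDist σ τ ∈ Finset.range (N + 1) := by
    intro τ _
    have := hammingDist_le_card_fintype (x := σ) (y := τ)
    rw [Fintype.card_fin] at this
    exact Finset.mem_range.2 (by omega)
  rw [← Finset.sum_fiberwise_of_maps_to hmaps]
  calc _ ≤ ∑ d ∈ Finset.range (N + 1), B := by
        refine Finset.sum_le_sum fun d hd => ?_
        have hd' : d ≤ N := by have := Finset.mem_range.1 hd; omega
        calc _ = ∑ τ ∈ Finset.univ.filter (fun τ : Cube N => hammingDist σ τ = d), f d :=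
              Finset.sum_congr rfl fun τ hτ => by rw [(Finset.mem_filter.1 hτ).2]
          _ = (Finset.univ.filter fun τ : Cube N => hammingDist σ τ = d).card * f d := by
              rw [Finset.sum_const, nsmul_eq_mul]
          _ ≤ Real.exp (N * Real.binEntropy (d / N)) * f d :=
              mul_le_mul_of_nonneg_right (card_sphere_le hN σ hd') (h0 d)
          _ ≤ B := hf d hd'
    _ = (N + 1) * B := by simp

/-! ### First moments of pair counts -/

/-- The exponential moment of the squared overlap over the pairs of solutions is, up to a linear
factor, at most the square of the expected number of solutions. -/
theorem expect_pairSum_exp_le {κ α c : ℝ} (hκ : 0 < κ)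
    (hgap : ∀ β ∈ Set.Icc (0 : ℝ) 1, rate κ α β ≤ rate κ α (1 / 2) - c * (2 * β - 1) ^ 2)
    {N t : ℕ} (hN : 0 < N) (ht : (t : ℝ) ≤ α * N) :
    expect κ N t (pairSum fun σ τ => Real.exp (c * N * overlap σ τ ^ 2)) ≤
      (2 ^ N * gaussProb κ ^ t) ^ 2 * (N + 1) := by
  have hp := gaussProb_pos hκ
  rw [expect_pairSum hN]
  have hrow : ∀ σ : Cube N, ∑ τ, Real.exp (c * N * overlap σ τ ^ 2) *
      pairProb κ (hammingDist σ τ / N) ^ t ≤ (N + 1) * (2 ^ N * (gaussProb κ ^ t) ^ 2) := by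
    intro σ
    refine sum_hammingDist_le hN σ (f := fun d => Real.exp (c * N * (1 - 2 * (d / N : ℝ)) ^ 2) *
      pairProb κ (d / N) ^ t) (fun d => mul_nonneg (Real.exp_nonneg _)
        (pow_nonneg (pairProb_nonneg _ _) _)) fun d hd => ?_
    have hN' : (0 : ℝ) < N := by positivity
    set β : ℝ := d / N
    have hβ : β ∈ Set.Icc (0 : ℝ) 1 :=
      ⟨by positivity, div_le_one_of_le₀ (by exact_mod_cast hd) hN'.le⟩
    have hq := pairProb_pos hκ hβ
    have hlog : 2 * Real.log (gaussProb κ) ≤ Real.log (pairProb κ β) := by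
      have := Real.log_le_log (by positivity) (sq_le_pairProb hκ hβ)
      rwa [Real.log_pow] at this
    have h1 : pairProb κ β ^ t = (gaussProb κ ^ t) ^ 2 *
        Real.exp (t * (Real.log (pairProb κ β) - 2 * Real.log (gaussProb κ))) := by
      rw [mul_sub, Real.exp_sub, ← Real.log_pow, Real.exp_log (by positivity),
        show (t : ℝ) * (2 * Real.log (gaussProb κ)) = ((t * 2 : ℕ) : ℝ) * Real.log (gaussProb κ) by
          push_cast; ring, ← Real.log_pow, Real.exp_log (by positivity), pow_mul]
      field_simp
    have h2 : (2 : ℝ) ^ N = Real.exp (N * Real.log 2) := by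
      rw [← Real.log_pow, Real.exp_log (by positivity)]
    rw [h1, h2]
    have h3 := hgap β hβ
    rw [rate_half, rate] at h3
    have h4 : t * (Real.log (pairProb κ β) - 2 * Real.log (gaussProb κ)) ≤
        α * N * (Real.log (pairProb κ β) - 2 * Real.log (gaussProb κ)) := by
      gcongr
    calc _ = (gaussProb κ ^ t) ^ 2 * Real.exp (N * Real.binEntropy β +
          c * N * (1 - 2 * β) ^ 2 +
          t * (Real.log (pairProb κ β) - 2 * Real.log (gaussProb κ))) := by
          rw [Real.exp_add, Real.exp_add]; ring
      _ ≤ (gaussProb κ ^ t) ^ 2 * Real.exp (N * Real.log 2) := by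
          gcongr
          nlinarith [mul_le_mul_of_nonneg_left h3 hN'.le]
      _ = _ := by ring
  calc _ ≤ ∑ σ : Cube N, (N + 1) * (2 ^ N * (gaussProb κ ^ t) ^ 2) :=
        Finset.sum_le_sum fun σ _ => hrow σ
    _ = _ := by simp; ring

/-- Pairs of distinct solutions below the critical distance are rare in expectation. -/
theorem expect_pairSum_close_le {κ α b c : ℝ} (hκ : 0 < κ) (hb : b ≤ 1) (hc : 0 < c)
    (hclose : ∀ β ∈ Set.Ioc (0 : ℝ) b,
      rate κ α β - α * Real.log (gaussProb κ) ≤ -c * √β)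
    {N : ℕ} (hN : 0 < N) :
    expect κ N ⌊α * (N : ℝ)⌋₊
      (pairSum fun σ τ => if σ ≠ τ ∧ (hammingDist σ τ : ℝ) ≤ b * N then 1 else 0) ≤
      2 ^ N * gaussProb κ ^ ⌊α * (N : ℝ)⌋₊ *
        ((N + 1) * (Real.exp (-c * √N) / gaussProb κ)) := by
  have hp := gaussProb_pos hκ
  set m := ⌊α * (N : ℝ)⌋₊
  have hm : α * N - 1 ≤ m := (Nat.sub_one_lt_floor _).le
  rw [expect_pairSum hN]
  have hN' : (0 : ℝ) < N := by positivity
  have hrow : ∀ σ : Cube N, ∑ τ, (if σ ≠ τ ∧ (hammingDist σ τ : ℝ) ≤ b * N then 1 else 0) *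
      pairProb κ (hammingDist σ τ / N) ^ m ≤
        (N + 1) * (gaussProb κ ^ m * (Real.exp (-c * √N) / gaussProb κ)) := by
    intro σ
    have e : ∀ τ : Cube N, (if σ ≠ τ ∧ (hammingDist σ τ : ℝ) ≤ b * N then (1 : ℝ) else 0) =
        if hammingDist σ τ ≠ 0 ∧ (hammingDist σ τ : ℝ) ≤ b * N then 1 else 0 := fun τ => by
      simp only [hammingDist_ne_zero]
    simp_rw [e]
    refine sum_hammingDist_le hN σ (f := fun d => (if d ≠ 0 ∧ (d : ℝ) ≤ b * N then 1 else 0) *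
      pairProb κ (d / N) ^ m) (fun d => mul_nonneg (by split_ifs <;> norm_num)
        (pow_nonneg (pairProb_nonneg _ _) _)) fun d hd => ?_
    by_cases h : d ≠ 0 ∧ (d : ℝ) ≤ b * N
    swap
    · rw [if_neg h, zero_mul, mul_zero]; positivity
    rw [if_pos h, one_mul]
    set β : ℝ := d / N with hβdef
    have hd0 : 0 < d := Nat.pos_of_ne_zero h.1
    have hβ : β ∈ Set.Ioc (0 : ℝ) b := ⟨by positivity, by rw [hβdef, div_le_iff₀ hN']; exact h.2⟩
    have hβ' : β ∈ Set.Icc (0 : ℝ) 1 := ⟨hβ.1.le, hβ.2.trans hb⟩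
    have hq := pairProb_pos hκ hβ'
    have h1 : pairProb κ β ^ m = gaussProb κ ^ m *
        Real.exp (m * (Real.log (pairProb κ β) - Real.log (gaussProb κ))) := by
      rw [mul_sub, Real.exp_sub, ← Real.log_pow, Real.exp_log (by positivity), ← Real.log_pow,
        Real.exp_log (by positivity)]
      field_simp
    have h2 : Real.log (pairProb κ β) - Real.log (gaussProb κ) ≤ 0 :=
      sub_nonpos.2 (Real.log_le_log hq (pairProb_le_gaussProb κ hβ'))
    have h3 : Real.log (gaussProb κ) ≤ Real.log (pairProb κ β) - Real.log (gaussProb κ) := by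
      have := Real.log_le_log (by positivity) (sq_le_pairProb hκ hβ')
      rw [Real.log_pow] at this
      push_cast at this; linarith
    have h4 : m * (Real.log (pairProb κ β) - Real.log (gaussProb κ)) ≤
        (α * N - 1) * (Real.log (pairProb κ β) - Real.log (gaussProb κ)) :=
      mul_le_mul_of_nonpos_right hm h2
    have h5 := hclose β hβ
    rw [rate] at h5
    -- The distance is at least one, so that `N √β ≥ √N`.
    have h6 : √N ≤ N * √β := by
      have : √(N : ℝ) * √β = √d := by
        rw [← Real.sqrt_mul hN'.le, hβdef]; congr 1; field_simp
      have h7 : 1 ≤ √(d : ℝ) := Real.one_le_sqrt.2 (by exact_mod_cast hd0)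
      have h8 : (N : ℝ) = √N * √N := (Real.mul_self_sqrt hN'.le).symm
      calc √(N : ℝ) = √N * 1 := (mul_one _).symm
        _ ≤ √N * √d := by gcongr
        _ = √N * √N * √β := by rw [← this]; ring
        _ = N * √β := by rw [← h8]
    rw [h1]
    calc _ = gaussProb κ ^ m * Real.exp (N * Real.binEntropy β +
          m * (Real.log (pairProb κ β) - Real.log (gaussProb κ))) := by
          rw [Real.exp_add]; ring
      _ ≤ gaussProb κ ^ m * Real.exp (-c * √N - Real.log (gaussProb κ)) := by
          gcongr
          nlinarith [mul_le_mul_of_nonneg_left h5 hN'.le, mul_le_mul_of_nonneg_left h6 hc.le]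
      _ = _ := by rw [Real.exp_sub, Real.exp_log hp]
  calc _ ≤ ∑ σ : Cube N, (N + 1) * (gaussProb κ ^ m * (Real.exp (-c * √N) / gaussProb κ)) :=
        Finset.sum_le_sum fun σ _ => hrow σ
    _ = _ := by simp; ring

/-! ### Adding one constraint to a fixed set -/

theorem cnt_inter {N : ℕ} (T H : Set (Cube N)) :
    cnt (T ∩ H) = ∑ σ, T.indicator 1 σ * H.indicator (1 : Cube N → ℝ) σ := by
  refine Finset.sum_congr rfl fun σ _ => ?_
  rw [Set.inter_indicator_one]; rfl

theorem integral_indicator_constraintSet {κ : ℝ} {N : ℕ} (hN : 0 < N) (σ : Cube N) :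
    ∫ x, (constraintSet κ x).indicator (1 : Cube N → ℝ) σ ∂rowLaw N = gaussProb κ := by
  rw [← prob_single hN κ σ, ← integral_indicator_one (measurableSet_mem_constraintSet κ σ)]
  rfl

theorem integral_indicator_mul_constraintSet {κ : ℝ} {N : ℕ} (hN : 0 < N) (σ τ : Cube N) :
    ∫ x, (constraintSet κ x).indicator (1 : Cube N → ℝ) σ *
      (constraintSet κ x).indicator (1 : Cube N → ℝ) τ ∂rowLaw N =
        pairProb κ (hammingDist σ τ / N) := by
  have hms : MeasurableSet {x : Fin N → ℝ | σ ∈ constraintSet κ x ∧ τ ∈ constraintSet κ x} :=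
    (measurableSet_mem_constraintSet κ σ).inter (measurableSet_mem_constraintSet κ τ)
  rw [← pairProb_one_sub κ (hammingDist_div_mem_Icc σ τ), ← prob_pair hN κ σ τ,
    ← integral_indicator_one hms]
  refine integral_congr_ae (ae_of_all _ fun x => ?_)
  by_cases h1 : σ ∈ constraintSet κ x <;> by_cases h2 : τ ∈ constraintSet κ x <;>
    simp [h1, h2]

theorem integrable_comp_constraintSet (κ : ℝ) {N : ℕ} (f : Set (Cube N) → ℝ) :
    Integrable (fun x => f (constraintSet κ x)) (rowLaw N) := by
  simpa using integrable_comp_inter_constraintSet κ Set.univ f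

theorem integral_cnt_inter {κ : ℝ} {N : ℕ} (hN : 0 < N) (T : Set (Cube N)) :
    ∫ x, cnt (T ∩ constraintSet κ x) ∂rowLaw N = gaussProb κ * cnt T := by
  simp_rw [cnt_inter]
  rw [integral_finsetSum _ fun σ _ => (integrable_comp_constraintSet κ
    fun H => T.indicator 1 σ * H.indicator (1 : Cube N → ℝ) σ)]
  simp_rw [integral_const_mul, integral_indicator_constraintSet hN]
  rw [← Finset.sum_mul, mul_comm]; rfl

theorem integral_cnt_inter_sq {κ : ℝ} {N : ℕ} (hN : 0 < N) (T : Set (Cube N)) :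
    ∫ x, cnt (T ∩ constraintSet κ x) ^ 2 ∂rowLaw N =
      pairSum (fun σ τ => pairProb κ (hammingDist σ τ / N)) T := by
  have e : ∀ H : Set (Cube N), cnt (T ∩ H) ^ 2 = ∑ σ, ∑ τ,
      (T.indicator 1 σ * T.indicator 1 τ) *
        (H.indicator (1 : Cube N → ℝ) σ * H.indicator (1 : Cube N → ℝ) τ) := by
    intro H
    rw [cnt_inter, sq, Finset.sum_mul_sum]
    refine Finset.sum_congr rfl fun σ _ => Finset.sum_congr rfl fun τ _ => by ring
  simp_rw [e]
  rw [integral_finsetSum _ fun σ _ => (integrable_comp_constraintSet κ fun H => ∑ τ,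
      (T.indicator 1 σ * T.indicator 1 τ) *
        (H.indicator (1 : Cube N → ℝ) σ * H.indicator (1 : Cube N → ℝ) τ))]
  refine Finset.sum_congr rfl fun σ _ => ?_
  rw [integral_finsetSum _ fun τ _ => (integrable_comp_constraintSet κ fun H =>
      (T.indicator 1 σ * T.indicator 1 τ) *
        (H.indicator (1 : Cube N → ℝ) σ * H.indicator (1 : Cube N → ℝ) τ))]
  refine Finset.sum_congr rfl fun τ _ => ?_
  rw [integral_const_mul, integral_indicator_mul_constraintSet hN, mul_comm]

theorem sum_pi_prod {α : Type*} [Fintype α] [DecidableEq α] {k : ℕ} (g : Fin k → α → ℝ) :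
    ∑ s : Fin k → α, ∏ l, g l (s l) = ∏ l, ∑ a, g l a := by
  have h := Finset.prod_univ_sum (κ := fun _ : Fin k => α) (fun _ => Finset.univ) g
  rw [Fintype.piFinset_univ] at h
  exact h.symm

/-- Two coordinates of a product probability vector are independent. -/
theorem sum_pi_prod_mul_pair {α : Type*} [Fintype α] [DecidableEq α] {k : ℕ} {u : α → ℝ}
    (hu : ∑ a, u a = 1) (b : α → α → ℝ) {i j : Fin k} (hij : i ≠ j) :
    ∑ s : Fin k → α, (∏ l, u (s l)) * b (s i) (s j) = ∑ a, ∑ a', b a a' * (u a * u a') := by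
  have h1 : ∀ s : Fin k → α, (∏ l, u (s l)) * b (s i) (s j) = ∑ a, ∑ a', b a a' *
      ∏ l, (u (s l) * (if l = i then (if s l = a then 1 else 0) else 1) *
        (if l = j then (if s l = a' then 1 else 0) else 1)) := by
    intro s
    have h2 : ∀ a a', ∏ l, (u (s l) * (if l = i then (if s l = a then 1 else 0) else 1) *
        (if l = j then (if s l = a' then 1 else 0) else 1)) =
        (∏ l, u (s l)) * ((if s i = a then 1 else 0) * (if s j = a' then 1 else 0)) := by
      intro a a'
      rw [Finset.prod_mul_distrib, Finset.prod_mul_distrib, Finset.prod_ite_eq_of_mem' _ _ _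
        (Finset.mem_univ i), Finset.prod_ite_eq_of_mem' _ _ _ (Finset.mem_univ j)]
      ring
    simp_rw [h2]
    rw [Finset.sum_eq_single (s i) (fun a _ ha => by simp [ha.symm]) (by simp),
      Finset.sum_eq_single (s j) (fun a _ ha => by simp [ha.symm]) (by simp)]
    simp; ring
  simp_rw [h1]
  rw [Finset.sum_comm]
  refine Finset.sum_congr rfl fun a _ => ?_
  rw [Finset.sum_comm]
  refine Finset.sum_congr rfl fun a' _ => ?_
  rw [← Finset.mul_sum, sum_pi_prod fun l x => u x * (if l = i then (if x = a then 1 else 0) else 1)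
    * (if l = j then (if x = a' then 1 else 0) else 1)]
  congr 1
  rw [Finset.prod_eq_mul i j hij]
  · simp [hij, hij.symm]
  · rintro l - ⟨h3, h4⟩
    simp [h3, h4, hu]
  · simp
  · simp

/-! ### Small fractions of a set under a random constraint -/

theorem cnt_nonneg {N : ℕ} (T : Set (Cube N)) : 0 ≤ cnt T :=
  Finset.sum_nonneg fun _ _ => Set.indicator_nonneg (fun _ _ => zero_le_one) _

theorem cnt_mono {N : ℕ} {T U : Set (Cube N)} (h : T ⊆ U) : cnt T ≤ cnt U :=
  Finset.sum_le_sum fun _ _ => Set.indicator_le_indicator_of_subset h (fun _ => zero_le_one) _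

theorem cnt_univ (N : ℕ) : cnt (Set.univ : Set (Cube N)) = 2 ^ N := by
  simp [cnt]

theorem cnt_eq_zero_iff {N : ℕ} {T : Set (Cube N)} : cnt T = 0 ↔ T = ∅ := by
  constructor
  · intro h
    have h0 : ∀ σ ∈ Finset.univ, 0 ≤ T.indicator (1 : Cube N → ℝ) σ :=
      fun _ _ => Set.indicator_nonneg (fun _ _ => zero_le_one) _
    rw [cnt, Finset.sum_eq_zero_iff_of_nonneg h0] at h
    ext σ
    have := h σ (Finset.mem_univ σ)
    simpa using this
  · rintro rfl; simp [cnt]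

theorem pairSum_mono {N : ℕ} {w w' : Cube N → Cube N → ℝ} (h : ∀ σ τ, w σ τ ≤ w' σ τ)
    (T : Set (Cube N)) : pairSum w T ≤ pairSum w' T :=
  Finset.sum_le_sum fun σ _ => Finset.sum_le_sum fun τ _ =>
    mul_le_mul_of_nonneg_right (h σ τ) (mul_nonneg
      (Set.indicator_nonneg (fun _ _ => zero_le_one) _)
      (Set.indicator_nonneg (fun _ _ => zero_le_one) _))

theorem pairSum_const_mul {N : ℕ} (c : ℝ) (w : Cube N → Cube N → ℝ) (T : Set (Cube N)) :
    pairSum (fun σ τ => c * w σ τ) T = c * pairSum w T := by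
  simp only [pairSum, Finset.mul_sum, mul_assoc]

theorem pairSum_add {N : ℕ} (w w' : Cube N → Cube N → ℝ) (T : Set (Cube N)) :
    pairSum (fun σ τ => w σ τ + w' σ τ) T = pairSum w T + pairSum w' T := by
  simp only [pairSum, add_mul, Finset.sum_add_distrib]

theorem pairSum_const {N : ℕ} (c : ℝ) (T : Set (Cube N)) :
    pairSum (fun _ _ => c) T = c * cnt T ^ 2 := by
  simp only [pairSum, ← Finset.mul_sum]
  rw [sq, cnt, Finset.sum_mul_sum]
  simp only [Finset.mul_sum]

theorem pairSum_nonneg {N : ℕ} {w : Cube N → Cube N → ℝ} (h : ∀ σ τ, 0 ≤ w σ τ)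
    (T : Set (Cube N)) : 0 ≤ pairSum w T :=
  Finset.sum_nonneg fun σ _ => Finset.sum_nonneg fun τ _ =>
    mul_nonneg (h σ τ) (mul_nonneg (Set.indicator_nonneg (fun _ _ => zero_le_one) _)
      (Set.indicator_nonneg (fun _ _ => zero_le_one) _))

theorem gaussProb_quarter_le {κ : ℝ} (hκ : 0 < κ) : gaussProb (κ / 4) ≤ gaussProb κ :=
  gaussProb_mono (by linarith)

/-- A random constraint rarely removes a large proportion of a set most of whose pairs are nearly
orthogonal: otherwise `k` random points of the set would all fail with a probability far
larger than that for nearly independent failures. -/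
theorem prob_small_fraction_le {κ : ℝ} (hκ : 0 < κ) {N k : ℕ} (hN : 0 < N) {η : ℝ} (hη : 0 ≤ η)
    (hη1 : k * η ≤ 1) (hηκ : 8 * (k : ℝ) ^ 2 * η ≤ κ ^ 2) {c₀ : ℝ} (hc₀ : c₀ < 1)
    {T : Set (Cube N)} (hT : 0 < cnt T) :
    (1 - c₀) ^ k * (rowLaw N).real {x | cnt (T ∩ constraintSet κ x) < c₀ * cnt T} ≤
      2 * (1 - gaussProb (κ / 4)) ^ k +
        k ^ 2 * (pairSum (fun σ τ => if η < |overlap σ τ| then 1 else 0) T / cnt T ^ 2) := by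
  classical
  set n := cnt T with hn
  set u : Cube N → ℝ := fun σ => T.indicator 1 σ / n with hu
  have hu0 : ∀ σ, 0 ≤ u σ := fun σ =>
    div_nonneg (Set.indicator_nonneg (fun _ _ => zero_le_one) _) hT.le
  have husum : ∑ σ, u σ = 1 := by
    rw [hu, ← Finset.sum_div]; exact div_self hT.ne'
  -- The proportion of `T` which fails the constraint.
  set B : Set (Cube N) → ℝ := fun H => ∑ σ, u σ * Hᶜ.indicator 1 σ with hB
  have hB0 : ∀ H, 0 ≤ B H := fun H => Finset.sum_nonneg fun σ _ =>
    mul_nonneg (hu0 σ) (Set.indicator_nonneg (fun _ _ => zero_le_one) _)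
  have hBeq : ∀ H, B H = 1 - cnt (T ∩ H) / n := by
    intro H
    rw [cnt_inter, Finset.sum_div, ← husum, ← Finset.sum_sub_distrib]
    refine Finset.sum_congr rfl fun σ _ => ?_
    by_cases h : σ ∈ H <;> simp [hu, h]
  have hmeas : MeasurableSet {x : Fin N → ℝ | cnt (T ∩ constraintSet κ x) < c₀ * n} :=
    measurableSet_lt (measurable_comp_inter_constraintSet κ T cnt) measurable_const
  have hstep1 : (1 - c₀) ^ k * (rowLaw N).real {x | cnt (T ∩ constraintSet κ x) < c₀ * n} ≤
      ∫ x, B (constraintSet κ x) ^ k ∂rowLaw N := by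
    rw [← integral_indicator_one hmeas, ← integral_const_mul]
    refine integral_mono ((integrable_indicator_iff hmeas).2
      (integrable_const _).integrableOn |>.const_mul _)
      (integrable_comp_constraintSet κ fun H => B H ^ k) fun x => ?_
    simp only [Set.indicator_apply, Set.mem_ofPred_eq, Pi.one_apply]
    split_ifs with h
    · rw [mul_one, hBeq]
      have : cnt (T ∩ constraintSet κ x) / n ≤ c₀ := by rw [div_le_iff₀ hT]; exact h.le
      exact pow_le_pow_left₀ (by linarith) (by linarith) k
    · rw [mul_zero]; exact pow_nonneg (hB0 _) k
  have hBk : ∀ H, B H ^ k = ∑ s : Fin k → Cube N, (∏ l, u (s l)) *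
      ∏ l, Hᶜ.indicator 1 (s l) := by
    intro H
    have h := sum_pi_prod (k := k) fun (_ : Fin k) σ => u σ * Hᶜ.indicator 1 σ
    simp only [Finset.prod_const, Finset.card_univ, Fintype.card_fin] at h
    rw [← h]
    exact Finset.sum_congr rfl fun s _ => Finset.prod_mul_distrib
  have hfail : ∀ s : Fin k → Cube N,
      ∫ x, ∏ l, (constraintSet κ x)ᶜ.indicator (1 : Cube N → ℝ) (s l) ∂rowLaw N =
        (rowLaw N).real {x | ∀ i, s i ∉ constraintSet κ x} := by
    intro s
    have hms : MeasurableSet {x : Fin N → ℝ | ∀ i, s i ∉ constraintSet κ x} := by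
      have : {x : Fin N → ℝ | ∀ i, s i ∉ constraintSet κ x} =
          ⋂ i, {x | s i ∈ constraintSet κ x}ᶜ := by ext; simp
      rw [this]
      exact MeasurableSet.iInter fun i => (measurableSet_mem_constraintSet κ (s i)).compl
    rw [← integral_indicator_one hms]
    refine integral_congr_ae (ae_of_all _ fun x => ?_)
    simp only [Set.indicator_apply, Set.mem_compl_iff, Pi.one_apply, Set.mem_ofPred_eq]
    rw [Finset.prod_ite_zero]
    simp
  have hprob : ∀ s : Fin k → Cube N, (rowLaw N).real {x | ∀ i, s i ∉ constraintSet κ x} ≤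
      2 * (1 - gaussProb (κ / 4)) ^ k + ∑ i, ∑ j,
        (if i ≠ j then (if η < |overlap (s i) (s j)| then 1 else 0) else 0) := by
    intro s
    have h0 : ∀ i j : Fin k, (0 : ℝ) ≤
        if i ≠ j then (if η < |overlap (s i) (s j)| then 1 else 0) else 0 := fun i j => by
      split_ifs <;> norm_num
    have h1 : (0 : ℝ) ≤ 2 * (1 - gaussProb (κ / 4)) ^ k := by
      have := gaussProb_lt_one (κ / 4)
      exact mul_nonneg zero_le_two (pow_nonneg (by linarith) _)
    by_cases h : ∀ i j, i ≠ j → |overlap (s i) (s j)| ≤ η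
    · have := prob_all_fail_le hκ hN s hη hη1 hηκ h
      have h2 := Finset.sum_nonneg fun i (_ : i ∈ Finset.univ) =>
        Finset.sum_nonneg fun j (_ : j ∈ Finset.univ) => h0 i j
      linarith
    · push Not at h
      obtain ⟨i, j, hij, hlt⟩ := h
      have h2 : (1 : ℝ) ≤ ∑ i, ∑ j,
          (if i ≠ j then (if η < |overlap (s i) (s j)| then 1 else 0) else 0) := by
        calc (1 : ℝ) = if i ≠ j then (if η < |overlap (s i) (s j)| then 1 else 0) else 0 := by
              rw [if_pos hij, if_pos hlt]
          _ ≤ ∑ j, (if i ≠ j then (if η < |overlap (s i) (s j)| then 1 else 0) else 0) :=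
              Finset.single_le_sum (fun j _ => h0 i j) (Finset.mem_univ j)
          _ ≤ _ := Finset.single_le_sum (f := fun i => ∑ j,
              (if i ≠ j then (if η < |overlap (s i) (s j)| then (1 : ℝ) else 0) else 0))
              (fun i _ => Finset.sum_nonneg fun j _ => h0 i j) (Finset.mem_univ i)
      have h3 : (rowLaw N).real {x | ∀ i, s i ∉ constraintSet κ x} ≤ 1 := measureReal_le_one
      linarith
  have hbad : ∀ i j : Fin k, ∑ s : Fin k → Cube N, (∏ l, u (s l)) *
      (if i ≠ j then (if η < |overlap (s i) (s j)| then 1 else 0) else 0) ≤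
      pairSum (fun σ τ => if η < |overlap σ τ| then 1 else 0) T / n ^ 2 := by
    intro i j
    have hps : 0 ≤ pairSum (fun σ τ => if η < |overlap σ τ| then (1 : ℝ) else 0) T :=
      pairSum_nonneg (fun σ τ => by split_ifs <;> norm_num) T
    by_cases hij : i = j
    · simp only [hij, ne_eq, not_true_eq_false, if_false, mul_zero, Finset.sum_const_zero]
      positivity
    · simp only [ne_eq, hij, not_false_eq_true, if_true]
      rw [sum_pi_prod_mul_pair husum (fun σ τ => if η < |overlap σ τ| then 1 else 0) hij, pairSum,
        Finset.sum_div]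
      refine le_of_eq (Finset.sum_congr rfl fun σ _ => ?_)
      rw [Finset.sum_div]
      refine Finset.sum_congr rfl fun τ _ => ?_
      simp only [hu]; ring
  refine hstep1.trans ?_
  simp_rw [hBk]
  rw [integral_finsetSum _ fun s _ => (integrable_comp_constraintSet κ fun H =>
    (∏ l, u (s l)) * ∏ l, Hᶜ.indicator 1 (s l))]
  simp_rw [integral_const_mul, hfail]
  have hw0 : ∀ s : Fin k → Cube N, 0 ≤ ∏ l, u (s l) := fun s =>
    Finset.prod_nonneg fun l _ => hu0 _
  have hwsum : ∑ s : Fin k → Cube N, ∏ l, u (s l) = 1 := by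
    rw [sum_pi_prod fun _ => u]; simp [husum]
  calc _ ≤ ∑ s : Fin k → Cube N, (∏ l, u (s l)) * (2 * (1 - gaussProb (κ / 4)) ^ k + ∑ i, ∑ j,
        (if i ≠ j then (if η < |overlap (s i) (s j)| then 1 else 0) else 0)) :=
        Finset.sum_le_sum fun s _ => mul_le_mul_of_nonneg_left (hprob s) (hw0 s)
    _ = 2 * (1 - gaussProb (κ / 4)) ^ k + ∑ i, ∑ j, ∑ s : Fin k → Cube N, (∏ l, u (s l)) *
        (if i ≠ j then (if η < |overlap (s i) (s j)| then 1 else 0) else 0) := by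
        simp_rw [mul_add]
        rw [Finset.sum_add_distrib, ← Finset.sum_mul, hwsum, one_mul]
        congr 1
        simp_rw [Finset.mul_sum]
        rw [Finset.sum_comm]
        refine Finset.sum_congr rfl fun i _ => ?_
        rw [Finset.sum_comm]
    _ ≤ 2 * (1 - gaussProb (κ / 4)) ^ k + ∑ i : Fin k, ∑ j : Fin k,
        pairSum (fun σ τ => if η < |overlap σ τ| then 1 else 0) T / n ^ 2 := by
        gcongr with i _ j _
        exact hbad i j
    _ = _ := by simp; ring

/-- A second-order bound for the loss of the truncated logarithm when the mass `M` is multiplied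
by `a`; the last term pays for the very small `a`. -/
theorem log_sub_log_le {M τ a c₁ : ℝ} (hM : 0 < M) (hτ : 0 < τ) (ha : 0 ≤ a) (hc₁ : 0 < c₁)
    (hc₁2 : c₁ ≤ 1 / 2) :
    Real.log (M + τ) - Real.log (M * a + τ) ≤
      M / (M + τ) * (1 - a) + 1 / c₁ * ((M / (M + τ)) ^ 2 * (1 - a) ^ 2) +
        (if a < c₁ ∧ τ ≤ M then Real.log ((M + τ) / τ) else 0) := by
  have hMτ : 0 < M + τ := by positivity
  have hMa : 0 < M * a + τ := by positivity
  set w := M / (M + τ) with hw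
  have hw0 : 0 < w := by positivity
  have hw1 : w ≤ 1 := by rw [hw, div_le_one hMτ]; linarith
  have hy : (M * a + τ) / (M + τ) = 1 - w * (1 - a) := by rw [hw]; field_simp; ring
  have hlog : Real.log (M + τ) - Real.log (M * a + τ) = -Real.log (1 - w * (1 - a)) := by
    rw [← hy, Real.log_div hMa.ne' hMτ.ne']; ring
  have hypos : 0 < 1 - w * (1 - a) := by rw [← hy]; positivity
  by_cases hbad : a < c₁ ∧ τ ≤ M
  · rw [if_pos hbad, Real.log_div hMτ.ne' hτ.ne']
    have h1 : Real.log τ ≤ Real.log (M * a + τ) :=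
      Real.log_le_log hτ (by nlinarith [mul_nonneg hM.le ha])
    have h2 : 0 ≤ w * (1 - a) := mul_nonneg hw0.le (by linarith [hbad.1])
    have h3 : 0 ≤ 1 / c₁ * (w ^ 2 * (1 - a) ^ 2) := by positivity
    linarith
  · rw [if_neg hbad, add_zero, hlog]
    have hge : c₁ ≤ 1 - w * (1 - a) := by
      rcases le_or_gt 1 a with h1 | h1
      · nlinarith [mul_nonneg hw0.le (sub_nonneg.2 h1)]
      rcases lt_or_ge a c₁ with h | h
      · have h2 : M < τ := by
          by_contra hcon
          exact hbad ⟨h, not_lt.1 hcon⟩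
        have h3 : w ≤ 1 / 2 := by rw [hw, div_le_iff₀ hMτ]; linarith
        nlinarith
      · nlinarith
    have h4 : -Real.log (1 - w * (1 - a)) ≤ (1 - w * (1 - a))⁻¹ - 1 := by
      rw [← Real.log_inv]; exact Real.log_le_sub_one_of_pos (inv_pos.2 hypos)
    have h5 : (1 - w * (1 - a))⁻¹ - 1 =
        w * (1 - a) + (1 - w * (1 - a))⁻¹ * (w ^ 2 * (1 - a) ^ 2) := by
      field_simp; ring
    have h6 : (1 - w * (1 - a))⁻¹ ≤ 1 / c₁ := by
      rw [← one_div]; exact one_div_le_one_div_of_le hc₁ hge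
    have h7 : (1 - w * (1 - a))⁻¹ * (w ^ 2 * (1 - a) ^ 2) ≤ 1 / c₁ * (w ^ 2 * (1 - a) ^ 2) := by
      gcongr
    linarith

/-! ### The loss of the logarithm in terms of the overlaps -/

/-- The variance of the proportion of a set which satisfies a random constraint, relative to the
square of its mean. -/
theorem integral_sq_one_sub {κ : ℝ} (hκ : 0 < κ) {N : ℕ} (hN : 0 < N) {T : Set (Cube N)}
    (hT : 0 < cnt T) :
    ∫ x, (1 - cnt (T ∩ constraintSet κ x) / (gaussProb κ * cnt T)) ^ 2 ∂rowLaw N =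
      pairSum (fun σ τ => pairProb κ (hammingDist σ τ / N) / gaussProb κ ^ 2 - 1) T /
        cnt T ^ 2 := by
  have hp := gaussProb_pos hκ
  set p := gaussProb κ
  set n := cnt T
  have e : ∀ x, (1 - cnt (T ∩ constraintSet κ x) / (p * n)) ^ 2 =
      1 + (-(2 / (p * n)) * cnt (T ∩ constraintSet κ x) +
        1 / (p * n) ^ 2 * cnt (T ∩ constraintSet κ x) ^ 2) := fun x => by
    field_simp; ring
  have i1 := (integrable_comp_inter_constraintSet κ T cnt).const_mul (-(2 / (p * n)))
  have i2 := (integrable_comp_inter_constraintSet κ T fun U => cnt U ^ 2).const_mul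
    (1 / (p * n) ^ 2)
  have e1 := integral_add (integrable_const (1 : ℝ)) (i1.add i2)
  have e2 := integral_add i1 i2
  simp only [Pi.add_apply] at e1 e2
  simp_rw [e]
  rw [e1, e2, integral_const_mul,
    integral_const_mul, integral_cnt_inter hN, integral_cnt_inter_sq hN]
  have h : pairSum (fun σ τ => pairProb κ (hammingDist σ τ / N) / p ^ 2 - 1) T =
      1 / p ^ 2 * pairSum (fun σ τ => pairProb κ (hammingDist σ τ / N)) T + -1 * n ^ 2 := by
    rw [← pairSum_const_mul, ← pairSum_const, ← pairSum_add]
    congr 1; funext σ τ; ring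
  rw [h]
  simp
  field_simp
  ring

/-- The expected loss of the truncated logarithm of the normalised mass in one step. -/
theorem integral_log_sub_log_le {κ : ℝ} (hκ : 0 < κ) {N : ℕ} (hN : 0 < N) {T : Set (Cube N)}
    (hT : 0 < cnt T) {D τ : ℝ} (hD : 0 < D) (hτ : 0 < τ) :
    Real.log (cnt T / D + τ) -
        ∫ x, Real.log (cnt (T ∩ constraintSet κ x) / (D * gaussProb κ) + τ) ∂rowLaw N ≤
      2 * gaussProb κ / gaussProb (κ / 4) * ((cnt T / D / (cnt T / D + τ)) ^ 2 *
        (pairSum (fun σ τ => pairProb κ (hammingDist σ τ / N) / gaussProb κ ^ 2 - 1) T /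
          cnt T ^ 2)) +
      (if τ ≤ cnt T / D then Real.log ((cnt T / D + τ) / τ) else 0) *
        (rowLaw N).real {x | cnt (T ∩ constraintSet κ x) < gaussProb (κ / 4) / 2 * cnt T} := by
  have hp := gaussProb_pos hκ
  have hp' := gaussProb_pos (show 0 < κ / 4 by positivity)
  have hpp := gaussProb_quarter_le hκ
  rw [← integral_sq_one_sub hκ hN hT]
  set p := gaussProb κ
  set p' := gaussProb (κ / 4)
  set n := cnt T
  set M := n / D with hM
  have hMpos : 0 < M := by positivity
  have hmeas : MeasurableSet {x : Fin N → ℝ | cnt (T ∩ constraintSet κ x) < p' / 2 * n} :=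
    measurableSet_lt (measurable_comp_inter_constraintSet κ T cnt) measurable_const
  have i1 := integrable_comp_inter_constraintSet κ T fun U => Real.log (cnt U / (D * p) + τ)
  have i2 := (integrable_comp_inter_constraintSet κ T fun U => 1 - cnt U / (p * n)).const_mul
    (M / (M + τ))
  have i3 := (integrable_comp_inter_constraintSet κ T fun U =>
    (1 - cnt U / (p * n)) ^ 2).const_mul (2 * p / p' * (M / (M + τ)) ^ 2)
  have i4 : Integrable ({x : Fin N → ℝ | cnt (T ∩ constraintSet κ x) < p' / 2 * n}.indicator
      (1 : (Fin N → ℝ) → ℝ)) (rowLaw N) :=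
    (integrable_indicator_iff hmeas).2 (integrable_const _).integrableOn
  have i5 := i4.const_mul (if τ ≤ M then Real.log ((M + τ) / τ) else 0)
  have h1 : Real.log (M + τ) - ∫ x, Real.log (cnt (T ∩ constraintSet κ x) / (D * p) + τ) ∂rowLaw N
      = ∫ x, (Real.log (M + τ) - Real.log (cnt (T ∩ constraintSet κ x) / (D * p) + τ))
        ∂rowLaw N := by
    rw [integral_sub (integrable_const _) i1]; simp
  have h2 : ∫ x, M / (M + τ) * (1 - cnt (T ∩ constraintSet κ x) / (p * n)) ∂rowLaw N = 0 := by
    rw [integral_const_mul, integral_sub (integrable_const _)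
      ((integrable_comp_inter_constraintSet κ T cnt).div_const _), integral_div,
      integral_cnt_inter hN]
    have h3 : gaussProb κ * cnt T / (p * n) = 1 := div_self (by positivity)
    rw [h3]
    simp
  calc _ = ∫ x, (Real.log (M + τ) - Real.log (cnt (T ∩ constraintSet κ x) / (D * p) + τ))
        ∂rowLaw N := h1
    _ ≤ ∫ x, (M / (M + τ) * (1 - cnt (T ∩ constraintSet κ x) / (p * n)) +
          2 * p / p' * (M / (M + τ)) ^ 2 * (1 - cnt (T ∩ constraintSet κ x) / (p * n)) ^ 2 +
          (if τ ≤ M then Real.log ((M + τ) / τ) else 0) *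
            {x : Fin N → ℝ | cnt (T ∩ constraintSet κ x) < p' / 2 * n}.indicator 1 x)
        ∂rowLaw N := by
        refine integral_mono ((integrable_const _).sub i1) ((i2.add i3).add i5) fun x => ?_
        have h3 := log_sub_log_le (M := M) (τ := τ) (a := cnt (T ∩ constraintSet κ x) / (p * n))
          (c₁ := p' / (2 * p)) hMpos hτ (div_nonneg (cnt_nonneg _) (by positivity))
          (by positivity) (by rw [div_le_iff₀ (by positivity)]; linarith)
        have h4 : M * (cnt (T ∩ constraintSet κ x) / (p * n)) =
            cnt (T ∩ constraintSet κ x) / (D * p) := by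
          rw [hM]; field_simp
        have h5 : cnt (T ∩ constraintSet κ x) / (p * n) < p' / (2 * p) ↔
            cnt (T ∩ constraintSet κ x) < p' / 2 * n := by
          rw [div_lt_div_iff₀ (by positivity) (by positivity)]
          constructor <;> intro h <;> nlinarith
        rw [h4] at h3
        refine h3.trans (le_of_eq ?_)
        simp only [h5, Set.indicator_apply, Set.mem_ofPred_eq, Pi.one_apply, one_div_div]
        congr 1
        · ring
        · by_cases h6 : cnt (T ∩ constraintSet κ x) < p' / 2 * n <;> by_cases h7 : τ ≤ M <;>
            simp [h6, h7]
    _ = _ := by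
        have e1 := integral_add (i2.add i3) i5
        have e2 := integral_add i2 i3
        simp only [Pi.add_apply] at e1 e2
        rw [e1, e2, h2, integral_const_mul, integral_const_mul, integral_indicator_one hmeas]
        ring

/-- The mean squared overlap of a set is controlled by its mass, through an exponential
moment (the Gibbs variational inequality). -/
theorem pairSum_overlap_sq_le {N : ℕ} (hN : 0 < N) {T : Set (Cube N)} (hT : 0 < cnt T) {D : ℝ}
    (hD : 0 < D) (c : ℝ) :
    c * N * (pairSum (fun σ τ => overlap σ τ ^ 2) T / cnt T ^ 2) ≤
      Real.log (N + 1) - 2 * Real.log (cnt T / D) +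
        pairSum (fun σ τ => Real.exp (c * N * overlap σ τ ^ 2)) T / D ^ 2 / (N + 1) := by
  set n := cnt T
  have hN' : (0 : ℝ) < N := by positivity
  set a := Real.log (N + 1) - 2 * Real.log (n / D) with ha
  have hexp : Real.exp (-a) = (n / D) ^ 2 / (N + 1) := by
    rw [ha, neg_sub, Real.exp_sub, Real.exp_log (by positivity),
      show 2 * Real.log (n / D) = Real.log ((n / D) ^ 2) by rw [Real.log_pow]; push_cast; ring,
      Real.exp_log (by positivity)]
  -- Young's inequality `x ≤ exp (x - a) + a - 1`, at the value of `a` that normalises the mass.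
  have h1 : pairSum (fun σ τ => c * N * overlap σ τ ^ 2) T ≤
      pairSum (fun σ τ => Real.exp (-a) * Real.exp (c * N * overlap σ τ ^ 2) + (a - 1)) T := by
    refine pairSum_mono (fun σ τ => ?_) T
    rw [← Real.exp_add]
    have := Real.add_one_le_exp (-a + c * N * overlap σ τ ^ 2)
    linarith
  rw [pairSum_const_mul, pairSum_add, pairSum_const_mul, pairSum_const, hexp] at h1
  set E := pairSum (fun σ τ => Real.exp (c * N * overlap σ τ ^ 2)) T
  rw [← mul_div_assoc, div_le_iff₀ (by positivity)]
  refine h1.trans ?_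
  have h2 : (a + E / D ^ 2 / (N + 1)) * n ^ 2 =
      (n / D) ^ 2 / (N + 1) * E + (a - 1) * n ^ 2 + n ^ 2 := by
    field_simp; ring
  rw [h2]
  nlinarith [sq_nonneg n]

/-- With the weight `(M / (M + τ)) ^ 2`, the term `-log M` is controlled by the truncated
`-log (M + τ)`, however small `M` may be. -/
theorem sq_mul_neg_log_le {M τ B : ℝ} (hM : 0 < M) (hτ : 0 < τ) (hB : 0 ≤ B) :
    (M / (M + τ)) ^ 2 * (B - 2 * Real.log M) ≤ B + 2 * (-Real.log (M + τ) + (M + τ) + 1) := by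
  have hMτ : 0 < M + τ := by positivity
  set w := M / (M + τ) with hw
  have hw0 : 0 < w := by positivity
  have hw1 : w ≤ 1 := by rw [hw, div_le_one hMτ]; linarith
  have hM' : Real.log M = Real.log (M + τ) + Real.log w := by
    rw [hw, Real.log_div hM.ne' hMτ.ne']; ring
  have h1 : -(w ^ 2 * Real.log w) ≤ 1 := by
    have := Real.log_le_sub_one_of_pos (inv_pos.2 hw0)
    rw [Real.log_inv] at this
    have h2 : w ^ 2 * -Real.log w ≤ w ^ 2 * (w⁻¹ - 1) := by gcongr
    have h3 : w ^ 2 * (w⁻¹ - 1) = w - w ^ 2 := by field_simp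
    nlinarith
  have h2 : -(w ^ 2 * Real.log (M + τ)) ≤ -Real.log (M + τ) + (M + τ) := by
    have h3 := Real.log_le_sub_one_of_pos hMτ
    have h4 : w ^ 2 ≤ 1 := by nlinarith
    rcases le_total 0 (Real.log (M + τ)) with h | h
    · have : 0 ≤ w ^ 2 * Real.log (M + τ) := by positivity
      linarith
    · nlinarith
  have h3 : w ^ 2 * B ≤ B := mul_le_of_le_one_left hB (by nlinarith)
  rw [hM']
  nlinarith

/-! ### The loss of the logarithm in one step -/

/-- The constant in front of `1 / N` in the expected loss of the logarithm of the mass. -/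
def lossConst (κ c : ℝ) : ℝ :=
  2 * gaussProb κ / gaussProb (κ / 4) * ((3 * κ ^ 2 / 2 + 4) / gaussProb κ ^ 2 / c)

theorem lossConst_pos {κ c : ℝ} (hκ : 0 < κ) (hc : 0 < c) : 0 < lossConst κ c := by
  have hp := gaussProb_pos hκ
  have hp' := gaussProb_pos (show 0 < κ / 4 by positivity)
  unfold lossConst
  positivity

/-- A bound for the probability that a random constraint keeps less than the proportion
`gaussProb (κ / 4) / 2` of a set, when pairs of points of overlap more than `η` have mass
`y` relative to the set. -/
def collapseBound (κ : ℝ) (k : ℕ) (y : ℝ) : ℝ :=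
  (2 * (1 - gaussProb (κ / 4)) ^ k + k ^ 2 * y) / (1 - gaussProb (κ / 4) / 2) ^ k

theorem collapseBound_nonneg {κ : ℝ} (k : ℕ) {y : ℝ} (hy : 0 ≤ y) : 0 ≤ collapseBound κ k y := by
  have h := gaussProb_lt_one (κ / 4)
  have h1 : 0 ≤ 1 - gaussProb (κ / 4) := by linarith
  have h2 : 0 ≤ 1 - gaussProb (κ / 4) / 2 := by linarith
  unfold collapseBound
  positivity

/-- The expected loss of the truncated logarithm of the normalised mass when a constraint is
added to `T`. The empty set is allowed: it loses nothing. -/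
theorem log_sub_integral_log_le {κ c : ℝ} (hκ : 0 < κ) (hc : 0 < c) {N k : ℕ} (hN : 0 < N)
    {η : ℝ} (hη : 0 ≤ η) (hη1 : k * η ≤ 1) (hηκ : 8 * (k : ℝ) ^ 2 * η ≤ κ ^ 2)
    {D τ Λ : ℝ} (hD : 0 < D) (hτ : 0 < τ) (hτ1 : τ ≤ 1)
    (hΛ : Real.log ((2 ^ N / D + τ) / τ) ≤ Λ) (T : Set (Cube N)) :
    Real.log (cnt T / D + τ) -
        ∫ x, Real.log (cnt (T ∩ constraintSet κ x) / (D * gaussProb κ) + τ) ∂rowLaw N ≤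
      lossConst κ c / N * (Real.log (N + 1) +
          pairSum (fun σ τ => Real.exp (c * N * overlap σ τ ^ 2)) T / D ^ 2 / (N + 1) +
          2 * (-Real.log (cnt T / D + τ) + (cnt T / D + τ) + 1)) +
        Λ * collapseBound κ k (Real.exp (-(c * N * η ^ 2)) *
          (pairSum (fun σ τ => Real.exp (c * N * overlap σ τ ^ 2)) T / D ^ 2) / τ ^ 2) := by
  have hp := gaussProb_pos hκ
  have hp' := gaussProb_pos (show 0 < κ / 4 by positivity)
  have hp'1 := gaussProb_lt_one (κ / 4)
  have hC := lossConst_pos hκ hc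
  have hN' : (0 : ℝ) < N := by positivity
  set Y := pairSum (fun σ τ => Real.exp (c * N * overlap σ τ ^ 2)) T / D ^ 2 with hY
  have hY0 : 0 ≤ Y := div_nonneg (pairSum_nonneg (fun _ _ => (Real.exp_pos _).le) T) (sq_nonneg D)
  have hlogN : 0 ≤ Real.log (N + 1) := Real.log_nonneg (by linarith)
  have hΛ0 : 0 ≤ Λ := by
    refine (Real.log_nonneg ?_).trans hΛ
    rw [one_le_div hτ]
    have : (0 : ℝ) ≤ 2 ^ N / D := by positivity
    linarith
  have hy0 : 0 ≤ Real.exp (-(c * N * η ^ 2)) * Y / τ ^ 2 := by positivity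
  have hcol := collapseBound_nonneg (κ := κ) k hy0
  rcases (cnt_nonneg T).eq_or_lt with h0 | hT
  · have hTe : T = ∅ := cnt_eq_zero_iff.1 h0.symm
    have h1 : ∫ x, Real.log (cnt (T ∩ constraintSet κ x) / (D * gaussProb κ) + τ) ∂rowLaw N =
        Real.log τ := by
      have : cnt (∅ : Set (Cube N)) = 0 := cnt_eq_zero_iff.2 rfl
      simp [hTe, this]
    rw [h1, ← h0, zero_div, zero_add, sub_self]
    have h2 : Real.log τ ≤ 0 := Real.log_nonpos hτ.le hτ1
    have h3 : 0 ≤ Real.log (N + 1) + Y / (N + 1) + 2 * (-Real.log τ + τ + 1) := by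
      have : 0 ≤ Y / (N + 1) := by positivity
      linarith
    exact add_nonneg (mul_nonneg (by positivity) h3) (mul_nonneg hΛ0 hcol)
  set n := cnt T with hn
  set M := n / D with hM
  have hMpos : 0 < M := by positivity
  refine (integral_log_sub_log_le hκ hN hT hD hτ).trans (add_le_add ?_ ?_)
  · -- The variance is controlled by the mean squared overlap.
    set A := pairSum (fun σ τ => overlap σ τ ^ 2) T / n ^ 2 with hA
    have hV : pairSum (fun σ τ => pairProb κ (hammingDist σ τ / N) / gaussProb κ ^ 2 - 1) T /
        n ^ 2 ≤ (3 * κ ^ 2 / 2 + 4) / gaussProb κ ^ 2 * A := by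
      rw [hA, ← mul_div_assoc, ← pairSum_const_mul]
      refine div_le_div_of_nonneg_right (pairSum_mono (fun σ τ => ?_) T) (sq_nonneg _)
      have h1 := pairProb_le_add hκ (hammingDist_div_mem_Icc σ τ)
      rw [sub_le_iff_le_add, div_le_iff₀ (by positivity)]
      refine h1.trans (le_of_eq ?_)
      unfold overlap
      field_simp
      ring
    have hA2 := pairSum_overlap_sq_le hN hT hD c
    rw [← hA, ← hM] at hA2
    have h3 := sq_mul_neg_log_le hMpos hτ (B := Real.log (N + 1) + Y / (N + 1)) (by positivity)
    set w := M / (M + τ)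
    set R := Real.log (N + 1) + Y / (N + 1) + 2 * (-Real.log (M + τ) + (M + τ) + 1)
    have h4 : w ^ 2 * (c * N * A) ≤ R :=
      (mul_le_mul_of_nonneg_left hA2 (sq_nonneg w)).trans
        ((le_of_eq (by rw [← hY]; ring)).trans h3)
    calc _ ≤ 2 * gaussProb κ / gaussProb (κ / 4) *
          (w ^ 2 * ((3 * κ ^ 2 / 2 + 4) / gaussProb κ ^ 2 * A)) := by gcongr
      _ = lossConst κ c / N * (w ^ 2 * (c * N * A)) := by
          unfold lossConst; field_simp
      _ ≤ _ := by gcongr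
  · have hps : 0 ≤ pairSum (fun σ τ => if η < |overlap σ τ| then (1 : ℝ) else 0) T :=
      pairSum_nonneg (fun σ τ => by split_ifs <;> norm_num) T
    split_ifs with hτM
    swap
    · rw [zero_mul]; exact mul_nonneg hΛ0 hcol
    have hMle : M ≤ 2 ^ N / D := by
      rw [hM, hn, ← cnt_univ N]
      exact div_le_div_of_nonneg_right (cnt_mono (Set.subset_univ T)) hD.le
    have hlog : Real.log ((M + τ) / τ) ≤ Λ :=
      (Real.log_le_log (by positivity) (by gcongr)).trans hΛ
    refine mul_le_mul hlog ?_ measureReal_nonneg hΛ0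
    have h1 := prob_small_fraction_le hκ hN hη hη1 hηκ (c₀ := gaussProb (κ / 4) / 2)
      (by linarith) hT
    have h2 : 0 < (1 - gaussProb (κ / 4) / 2) ^ k := pow_pos (by linarith) k
    unfold collapseBound
    rw [le_div_iff₀ h2, mul_comm]
    refine h1.trans ?_
    refine add_le_add le_rfl (mul_le_mul_of_nonneg_left ?_ (by positivity))
    -- Markov's inequality for the exponential moment of the squared overlap.
    have h3 : pairSum (fun σ τ => if η < |overlap σ τ| then (1 : ℝ) else 0) T ≤
        Real.exp (-(c * N * η ^ 2)) *
          pairSum (fun σ τ => Real.exp (c * N * overlap σ τ ^ 2)) T := by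
      rw [← pairSum_const_mul]
      refine pairSum_mono (fun σ τ => ?_) T
      rw [← Real.exp_add]
      split_ifs with h
      · rw [Real.one_le_exp_iff]
        have : η ^ 2 ≤ overlap σ τ ^ 2 := by
          rw [← sq_abs (overlap σ τ)]; exact pow_le_pow_left₀ hη h.le 2
        have h4 : c * N * η ^ 2 ≤ c * N * overlap σ τ ^ 2 := by gcongr
        linarith
      · exact (Real.exp_pos _).le
    have h5 : τ * D ≤ n := (le_div_iff₀ hD).1 hτM
    calc _ ≤ Real.exp (-(c * N * η ^ 2)) *
          pairSum (fun σ τ => Real.exp (c * N * overlap σ τ ^ 2)) T / n ^ 2 := by gcongr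
      _ ≤ Real.exp (-(c * N * η ^ 2)) *
          pairSum (fun σ τ => Real.exp (c * N * overlap σ τ ^ 2)) T / (τ * D) ^ 2 := by
          have := pairSum_nonneg (fun σ τ => (Real.exp_pos (c * N * overlap σ τ ^ 2)).le) T
          gcongr
      _ = _ := by rw [hY]; field_simp

/-! ### Accumulated loss of the logarithm -/

theorem expect_zero (κ : ℝ) (N : ℕ) (f : Set (Cube N) → ℝ) : expect κ N 0 f = f Set.univ := by
  have h : ∀ X : Fin 0 → Fin N → ℝ, solutions κ X = Set.univ := fun X => by simp [solutions]
  simp [expect, h]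

theorem expect_nonneg (κ : ℝ) (N m : ℕ) {f : Set (Cube N) → ℝ} (h : ∀ T, 0 ≤ f T) :
    0 ≤ expect κ N m f :=
  integral_nonneg fun _ => h _

/-- The expected loss of the truncated logarithm of the normalised mass, up to the feedback of
the mass itself, in a single step. -/
def stepLoss (κ c : ℝ) (N k : ℕ) (η τ Λ : ℝ) : ℝ :=
  lossConst κ c / N * (Real.log (N + 1) + 7) +
    Λ * collapseBound κ k (Real.exp (-(c * N * η ^ 2)) * (N + 1) / τ ^ 2)

/-- The expectation of minus the truncated logarithm of the number of solutions, normalised by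
its mean. -/
def logDefect (κ : ℝ) (N t : ℕ) (τ : ℝ) : ℝ :=
  -expect κ N t fun T => Real.log (cnt T / (2 ^ N * gaussProb κ ^ t) + τ)

/-- The defect can grow by a factor `1 + O(1 / N)` in one step, because the mean squared overlap is
bounded in terms of the logarithm of the mass itself. -/
theorem logDefect_succ_le {κ α c : ℝ} (hκ : 0 < κ) (hc : 0 < c)
    (hgap : ∀ β ∈ Set.Icc (0 : ℝ) 1, rate κ α β ≤ rate κ α (1 / 2) - c * (2 * β - 1) ^ 2)
    {N k t : ℕ} (hN : 0 < N) (ht : (t : ℝ) ≤ α * N)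
    {η : ℝ} (hη : 0 ≤ η) (hη1 : k * η ≤ 1) (hηκ : 8 * (k : ℝ) ^ 2 * η ≤ κ ^ 2)
    {τ Λ : ℝ} (hτ : 0 < τ) (hτ1 : τ ≤ 1)
    (hΛ : Real.log ((2 ^ N / (2 ^ N * gaussProb κ ^ t) + τ) / τ) ≤ Λ) :
    logDefect κ N (t + 1) τ ≤
      (1 + 2 * (lossConst κ c / N)) * logDefect κ N t τ + stepLoss κ c N k η τ Λ := by
  have hp := gaussProb_pos hκ
  have hp'1 := gaussProb_lt_one (κ / 4)
  have hN' : (0 : ℝ) < N := by positivity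
  have hK : 0 < lossConst κ c / N := div_pos (lossConst_pos hκ hc) hN'
  set K := lossConst κ c / N with hKdef
  set D : ℝ := 2 ^ N * gaussProb κ ^ t with hD
  have hDpos : 0 < D := by positivity
  have hΛ0 : 0 ≤ Λ := by
    refine (Real.log_nonneg ?_).trans hΛ
    rw [one_le_div hτ]
    have : (0 : ℝ) ≤ 2 ^ N / D := by positivity
    linarith
  set L : Set (Cube N) → ℝ := fun T => Real.log (cnt T / D + τ) with hL
  set Y : Set (Cube N) → ℝ := pairSum fun σ τ => Real.exp (c * N * overlap σ τ ^ 2) with hY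
  set r := (1 - gaussProb (κ / 4) / 2) ^ k with hr
  have hrpos : 0 < r := pow_pos (by linarith) k
  set a := Real.exp (-(c * N * η ^ 2)) with ha
  set b₀ := K * (Real.log (N + 1) + 2 * (τ + 1)) + Λ * (2 * (1 - gaussProb (κ / 4)) ^ k / r)
    with hb₀
  set b₁ := (K / (N + 1) + Λ * (k ^ 2 * a / τ ^ 2 / r)) / D ^ 2 with hb₁
  have hb₁0 : 0 ≤ b₁ := by positivity
  have hsucc : expect κ N (t + 1) (fun T => Real.log (cnt T / (2 ^ N * gaussProb κ ^ (t + 1)) + τ))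
      = expect κ N t fun T =>
        ∫ x, Real.log (cnt (T ∩ constraintSet κ x) / (D * gaussProb κ) + τ) ∂rowLaw N := by
    rw [expect_succ, hD, pow_succ, mul_assoc]
  have hstep : ∀ T : Set (Cube N), (1 + 2 * K) * L T ≤
      ∫ x, Real.log (cnt (T ∩ constraintSet κ x) / (D * gaussProb κ) + τ) ∂rowLaw N +
        (b₀ + (b₁ * Y T + 2 * K / D * cnt T)) := by
    intro T
    have h := log_sub_integral_log_le hκ hc hN hη hη1 hηκ hDpos hτ hτ1 hΛ T
    have e : K * (Real.log (N + 1) + Y T / D ^ 2 / (N + 1) +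
          2 * (-L T + (cnt T / D + τ) + 1)) +
        Λ * collapseBound κ k (a * (Y T / D ^ 2) / τ ^ 2) =
        b₀ + (b₁ * Y T + 2 * K / D * cnt T) - 2 * K * L T := by
      unfold collapseBound
      rw [hb₀, hb₁, ← hr]
      ring
    rw [← hKdef, ← ha] at h
    have h' := h.trans_eq e
    linarith
  have h := expect_mono κ N t hstep
  rw [expect_const_mul, expect_add, ← hsucc, expect_add, expect_const, expect_add,
    expect_const_mul, expect_const_mul, expect_cnt hN, ← hD] at h
  have hEY : expect κ N t Y ≤ D ^ 2 * (N + 1) := expect_pairSum_exp_le hκ hgap hN ht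
  have h1 : b₁ * expect κ N t Y ≤ K + Λ * (k ^ 2 * (a * (N + 1) / τ ^ 2) / r) := by
    refine (mul_le_mul_of_nonneg_left hEY hb₁0).trans (le_of_eq ?_)
    rw [hb₁]; field_simp
  have h2 : 2 * K / D * D = 2 * K := by field_simp
  have h3 : stepLoss κ c N k η τ Λ = K * (Real.log (N + 1) + 7) +
      Λ * (2 * (1 - gaussProb (κ / 4)) ^ k / r) + Λ * (k ^ 2 * (a * (N + 1) / τ ^ 2) / r) := by
    unfold stepLoss collapseBound
    rw [← hr, ← ha, ← hKdef]; ring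
  have h4 : b₀ ≤ K * (Real.log (N + 1) + 4) + Λ * (2 * (1 - gaussProb (κ / 4)) ^ k / r) := by
    rw [hb₀]; gcongr; linarith
  rw [h2] at h
  unfold logDefect
  rw [← hD, h3]
  linarith

theorem stepLoss_nonneg {κ c : ℝ} (hκ : 0 < κ) (hc : 0 < c) (N k : ℕ) (η τ : ℝ) {Λ : ℝ}
    (hΛ : 0 ≤ Λ) : 0 ≤ stepLoss κ c N k η τ Λ := by
  have h1 := lossConst_pos hκ hc
  have h2 : 0 ≤ Real.log (N + 1) := Real.log_nonneg (by linarith [N.cast_nonneg (α := ℝ)])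
  have h3 := collapseBound_nonneg (κ := κ) k
    (show 0 ≤ Real.exp (-(c * N * η ^ 2)) * (N + 1) / τ ^ 2 by positivity)
  unfold stepLoss
  positivity

/-- The discrete Grönwall inequality for the recursion of `logDefect_succ_le`. -/
theorem logDefect_le {κ α c : ℝ} (hκ : 0 < κ) (hc : 0 < c)
    (hgap : ∀ β ∈ Set.Icc (0 : ℝ) 1, rate κ α β ≤ rate κ α (1 / 2) - c * (2 * β - 1) ^ 2)
    {N k m : ℕ} (hN : 0 < N) (hm : (m : ℝ) ≤ α * N)
    {η : ℝ} (hη : 0 ≤ η) (hη1 : k * η ≤ 1) (hηκ : 8 * (k : ℝ) ^ 2 * η ≤ κ ^ 2)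
    {τ Λ : ℝ} (hτ : 0 < τ) (hτ1 : τ ≤ 1)
    (hΛ : ∀ t ≤ m, Real.log ((2 ^ N / (2 ^ N * gaussProb κ ^ t) + τ) / τ) ≤ Λ) :
    logDefect κ N m τ ≤
      stepLoss κ c N k η τ Λ * m * Real.exp (2 * (lossConst κ c / N) * m) := by
  have hN' : (0 : ℝ) < N := by positivity
  have hK : 0 < lossConst κ c / N := div_pos (lossConst_pos hκ hc) hN'
  set K := lossConst κ c / N with hKdef
  have hΛ0 : 0 ≤ Λ := by
    refine (Real.log_nonneg ?_).trans (hΛ 0 m.zero_le)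
    rw [one_le_div hτ]
    have : (0 : ℝ) ≤ 2 ^ N / (2 ^ N * gaussProb κ ^ 0) := by positivity
    linarith
  have hε := stepLoss_nonneg hκ hc N k η τ hΛ0
  set ε := stepLoss κ c N k η τ Λ with hεdef
  have hind : ∀ t ≤ m, logDefect κ N t τ ≤ ε * t * (1 + 2 * K) ^ t := by
    intro t
    induction t with
    | zero =>
      intro _
      have h0 : 0 ≤ Real.log (1 + τ) := Real.log_nonneg (by linarith)
      simp only [logDefect, expect_zero, cnt_univ, pow_zero, mul_one]
      rw [div_self (by positivity)]
      simpa using h0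
    | succ t ih =>
      intro ht
      have h1 : (t : ℝ) ≤ m := by exact_mod_cast (Nat.le_of_succ_le ht)
      have h2 := logDefect_succ_le hκ hc hgap hN (h1.trans hm) hη hη1 hηκ hτ hτ1
        (hΛ t (Nat.le_of_succ_le ht))
      rw [← hKdef, ← hεdef] at h2
      have h3 := mul_le_mul_of_nonneg_left (ih (Nat.le_of_succ_le ht))
        (show 0 ≤ 1 + 2 * K by positivity)
      have h4 : 1 ≤ (1 + 2 * K) ^ (t + 1) := one_le_pow₀ (by linarith)
      have h5 := mul_le_mul_of_nonneg_left h4 hε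
      push_cast
      rw [pow_succ] at h5 ⊢
      linarith
  refine (hind m le_rfl).trans ?_
  have h1 : (1 + 2 * K) ^ m ≤ Real.exp (2 * K * m) := by
    rw [mul_comm (2 * K), Real.exp_nat_mul]
    exact pow_le_pow_left₀ (by positivity) (by linarith [Real.add_one_le_exp (2 * K)]) m
  gcongr

/-- A small number of solutions is unlikely when the logarithm of the number of solutions has a
small defect. -/
theorem expect_small_mul_le {κ : ℝ} (hκ : 0 < κ) {N : ℕ} (hN : 0 < N) (m : ℕ) {τ : ℝ}
    (hτ : 0 < τ) (hτ1 : τ ≤ 1) :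
    expect κ N m (fun T => if cnt T / (2 ^ N * gaussProb κ ^ m) < τ then 1 else 0) *
      -Real.log (2 * τ) ≤ logDefect κ N m τ + 2 := by
  have hp := gaussProb_pos hκ
  set D : ℝ := 2 ^ N * gaussProb κ ^ m with hD
  have hDpos : 0 < D := by positivity
  have h := expect_mono κ N m (f := fun T => -Real.log (2 * τ) *
      (if cnt T / D < τ then 1 else 0))
    (g := fun T => -1 * Real.log (cnt T / D + τ) + (1 / D * cnt T + τ)) fun T => by
      have hM : 0 ≤ cnt T / D := div_nonneg (cnt_nonneg T) hDpos.le
      have hM' : 1 / D * cnt T = cnt T / D := by ring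
      rw [hM']
      split_ifs with hlt
      · have := Real.log_le_log (by positivity : 0 < cnt T / D + τ)
          (by linarith : cnt T / D + τ ≤ 2 * τ)
        linarith
      · have := Real.log_le_sub_one_of_pos (by positivity : 0 < cnt T / D + τ)
        linarith
  rw [expect_const_mul, expect_add, expect_const_mul, expect_add, expect_const_mul, expect_const,
    expect_cnt hN, ← hD, one_div_mul_cancel hDpos.ne'] at h
  unfold logDefect
  rw [← hD]
  linarith

/-! ### Concentration of the number of solutions -/

theorem pow_sixteen_add_one_le {x : ℝ} (hx : 0 ≤ x) : x ^ 16 + 1 ≤ Real.exp (16 * x + 1) := by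
  have hxe : x ≤ Real.exp x := by linarith [Real.add_one_le_exp x]
  have h5 : Real.exp (16 * x) = Real.exp x ^ 16 := by rw [← Real.exp_nat_mul]; norm_cast
  have h6 : x ^ 16 ≤ Real.exp x ^ 16 := pow_le_pow_left₀ hx hxe 16
  have h7 : 1 ≤ Real.exp x ^ 16 := one_le_pow₀ (Real.one_le_exp hx)
  have h8 := Real.add_one_le_exp (1 : ℝ)
  rw [Real.exp_add, h5]
  nlinarith

/-- With `N = x ^ 16`, tuples of `⌊x⌋₊` points and overlaps up to `x ^ (-4)`, the collapse of a
set of normalised mass at least `exp (-x ^ 4)` is exponentially unlikely in `x`. -/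
theorem exists_collapseBound_le {κ c : ℝ} (hκ : 0 < κ) (hc : 0 < c) :
    ∃ A ρ : ℝ, 0 < A ∧ 0 < ρ ∧ ∀ᶠ x : ℝ in atTop,
      collapseBound κ ⌊x⌋₊ (Real.exp (-(c * x ^ 8)) * (x ^ 16 + 1) / Real.exp (-x ^ 4) ^ 2) ≤
        A * Real.exp (-ρ * x) + Real.exp (-x) := by
  have hp' := gaussProb_pos (show 0 < κ / 4 by positivity)
  have hp'1 := gaussProb_lt_one (κ / 4)
  set p' := gaussProb (κ / 4)
  set s := 1 - p' / 2 with hs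
  have hs0 : 0 < s := by linarith
  have hs1 : s < 1 := by linarith
  set r := (1 - p') / s with hr
  have hr0 : 0 < r := div_pos (by linarith) hs0
  have hr1 : r < 1 := by rw [hr, div_lt_one hs0]; linarith
  have hlr : Real.log r < 0 := Real.log_neg hr0 hr1
  have hls : Real.log s < 0 := Real.log_neg hs0 hs1
  refine ⟨2 * Real.exp (-Real.log r), -Real.log r, by positivity, by linarith, ?_⟩
  filter_upwards [eventually_ge_atTop 1, eventually_ge_atTop ((22 + -Real.log s) / c)] with x hx hxc
  have hk1 : (⌊x⌋₊ : ℝ) ≤ x := Nat.floor_le (by linarith)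
  have hk2 : x - 1 ≤ ⌊x⌋₊ := (Nat.sub_one_lt_floor x).le
  set k := ⌊x⌋₊
  have h1 : r ^ k ≤ Real.exp (-Real.log r) * Real.exp (Real.log r * x) := by
    rw [← Real.exp_add, ← Real.rpow_natCast, Real.rpow_def_of_pos hr0]
    exact Real.exp_le_exp.2 (by nlinarith)
  have h2 : (s ^ k)⁻¹ ≤ Real.exp (-Real.log s * x) := by
    rw [← inv_pow, ← Real.rpow_natCast, Real.rpow_def_of_pos (inv_pos.2 hs0), Real.log_inv]
    exact Real.exp_le_exp.2 (by nlinarith)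
  have hxe : x ≤ Real.exp x := by linarith [Real.add_one_le_exp x]
  have h3 : (k : ℝ) ^ 2 ≤ Real.exp (2 * x) := by
    have : Real.exp (2 * x) = Real.exp x ^ 2 := by rw [← Real.exp_nat_mul]; norm_cast
    rw [this]
    exact pow_le_pow_left₀ (by positivity) (hk1.trans hxe) 2
  have h4 := pow_sixteen_add_one_le (zero_le_one.trans hx)
  have h5 : (Real.exp (-x ^ 4) ^ 2)⁻¹ = Real.exp (2 * x ^ 4) := by
    rw [← Real.exp_nat_mul, ← Real.exp_neg]; congr 1; push_cast; ring
  have hx2 : x ≤ x ^ 4 := le_self_pow₀ hx (by norm_num)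
  have hexp : 2 * x + (-(c * x ^ 8) + (16 * x + 1) + 2 * x ^ 4) + -Real.log s * x ≤ -x := by
    have h6 : 22 + -Real.log s ≤ c * x ^ 4 := by
      rw [div_le_iff₀ hc] at hxc
      nlinarith
    have h7 : (22 + -Real.log s) * x ^ 4 ≤ c * x ^ 4 * x ^ 4 := by gcongr
    have h8 : -Real.log s * x ≤ -Real.log s * x ^ 4 := by
      have : 0 ≤ -Real.log s := by linarith
      gcongr
    nlinarith
  have e : collapseBound κ k (Real.exp (-(c * x ^ 8)) * (x ^ 16 + 1) / Real.exp (-x ^ 4) ^ 2) =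
      2 * r ^ k + k ^ 2 * (Real.exp (-(c * x ^ 8)) * (x ^ 16 + 1) *
        (Real.exp (-x ^ 4) ^ 2)⁻¹) * (s ^ k)⁻¹ := by
    unfold collapseBound
    rw [hr, div_pow]; ring
  rw [e, h5]
  refine add_le_add ?_ ?_
  · rw [neg_neg, mul_assoc]; gcongr
  · calc _ ≤ Real.exp (2 * x) * (Real.exp (-(c * x ^ 8)) * Real.exp (16 * x + 1) *
          Real.exp (2 * x ^ 4)) * Real.exp (-Real.log s * x) := by gcongr
      _ = Real.exp (2 * x + (-(c * x ^ 8) + (16 * x + 1) + 2 * x ^ 4) + -Real.log s * x) := by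
          simp only [Real.exp_add]
      _ ≤ _ := Real.exp_le_exp.2 hexp

/-- With the truncation `exp (-N ^ (1 / 4))`, written with `N = x ^ 16`, the logarithm of the mass varies
by at most `O(N)`. -/
theorem log_truncation_le {κ α : ℝ} (hκ : 0 < κ) {N t : ℕ}
    (ht : (t : ℝ) ≤ α * N) {x : ℝ} (hx : 1 ≤ x) (hxN : x ^ 16 = N) :
    Real.log ((2 ^ N / (2 ^ N * gaussProb κ ^ t) + Real.exp (-x ^ 4)) / Real.exp (-x ^ 4)) ≤
      (2 + α * -Real.log (gaussProb κ)) * N := by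
  have hp := gaussProb_pos hκ
  have hp1 := gaussProb_lt_one κ
  have hlp : Real.log (gaussProb κ) < 0 := Real.log_neg hp hp1
  set p := gaussProb κ
  have h1 : (2 : ℝ) ^ N / (2 ^ N * p ^ t) = (p ^ t)⁻¹ := by field_simp
  have h2 : 1 ≤ (p ^ t)⁻¹ := (one_le_inv₀ (by positivity)).2 (pow_le_one₀ hp.le hp1.le)
  have h3 : Real.exp (-x ^ 4) ≤ 1 := Real.exp_le_one_iff.2 (by have : 0 ≤ x ^ 4 := by positivity
                                                               linarith)
  have h4 : (2 ^ N / (2 ^ N * p ^ t) + Real.exp (-x ^ 4)) / Real.exp (-x ^ 4) ≤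
      2 * (p ^ t)⁻¹ / Real.exp (-x ^ 4) := by
    rw [h1]; gcongr; linarith
  refine (Real.log_le_log (by positivity) h4).trans ?_
  rw [Real.log_div (by positivity) (by positivity), Real.log_exp,
    Real.log_mul (by norm_num) (by positivity), Real.log_inv, Real.log_pow]
  have h5 : Real.log 2 ≤ 1 := by
    have := Real.log_le_sub_one_of_pos (show (0 : ℝ) < 2 by norm_num); linarith
  have h6 : x ^ 4 ≤ N := by rw [← hxN]; exact pow_le_pow_right₀ hx (by norm_num)
  have h7 : (1 : ℝ) ≤ N := by rw [← hxN]; exact one_le_pow₀ hx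
  have h8 : (t : ℝ) * -Real.log p ≤ α * N * -Real.log p := by
    have : 0 ≤ -Real.log p := by linarith
    gcongr
  nlinarith

/-- The number of solutions is at least `exp (-N ^ (1 / 4))` times its mean with high
probability. -/
theorem tendsto_expect_small {κ α c : ℝ} (hκ : 0 < κ) (hα : 0 < α) (hc : 0 < c)
    (hgap : ∀ β ∈ Set.Icc (0 : ℝ) 1, rate κ α β ≤ rate κ α (1 / 2) - c * (2 * β - 1) ^ 2) :
    Tendsto (fun N : ℕ => expect κ N ⌊α * (N : ℝ)⌋₊ fun T =>
      if cnt T / (2 ^ N * gaussProb κ ^ ⌊α * (N : ℝ)⌋₊) < Real.exp (-((N : ℝ) ^ (1 / 16 : ℝ)) ^ 4)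
        then 1 else 0) atTop (𝓝 0) := by
  obtain ⟨A, ρ, hA, hρ, hcol⟩ := exists_collapseBound_le hκ hc
  have hlim : Tendsto (fun N : ℕ => (N : ℝ) ^ (1 / 16 : ℝ)) atTop atTop :=
    (tendsto_rpow_atTop (by norm_num)).comp tendsto_natCast_atTop_atTop
  have hlp : 0 < -Real.log (gaussProb κ) := by
    have := Real.log_neg (gaussProb_pos hκ) (gaussProb_lt_one κ); linarith
  set C := lossConst κ c
  have hC : 0 < C := lossConst_pos hκ hc
  set C₂ := 2 + α * -Real.log (gaussProb κ) with hC₂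
  have hC₂0 : 0 < C₂ := by positivity
  have hexp0 : Tendsto (fun x : ℝ => x ^ 32 * (A * Real.exp (-ρ * x) + Real.exp (-x)))
      atTop (𝓝 0) := by
    have h1 := (tendsto_rpow_mul_exp_neg_mul_atTop_nhds_zero 32 ρ hρ).const_mul A
    have h2 := tendsto_rpow_mul_exp_neg_mul_atTop_nhds_zero 32 1 one_pos
    have h3 := h1.add h2
    rw [mul_zero, add_zero] at h3
    refine h3.congr fun x => ?_
    have : x ^ (32 : ℝ) = x ^ 32 := by exact_mod_cast Real.rpow_natCast x 32
    rw [this, neg_one_mul]; ring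
  set B := α * Real.exp (2 * C * α) * (C * 24 + C₂) + 2 with hB
  have hB0 : 0 < B := by positivity
  have hbound : ∀ᶠ N : ℕ in atTop, expect κ N ⌊α * (N : ℝ)⌋₊ (fun T =>
      if cnt T / (2 ^ N * gaussProb κ ^ ⌊α * (N : ℝ)⌋₊) < Real.exp (-((N : ℝ) ^ (1 / 16 : ℝ)) ^ 4)
        then 1 else 0) ≤ B / (N : ℝ) ^ (1 / 16 : ℝ) := by
    filter_upwards [eventually_gt_atTop 0, hlim.eventually hcol,
      hlim.eventually (eventually_ge_atTop 2), hlim.eventually (eventually_ge_atTop (8 / κ ^ 2)),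
      hlim.eventually (hexp0.eventually_le_const zero_lt_one)] with N hN hcolN hx2 hxκ hx1
    set x := (N : ℝ) ^ (1 / 16 : ℝ) with hx
    have hxN : x ^ 16 = N := by
      rw [hx, ← Real.rpow_natCast, ← Real.rpow_mul (by positivity)]; norm_num
    have hx0 : 0 < x := by linarith
    have hxone : 1 ≤ x := by linarith
    have hN' : (0 : ℝ) < N := by positivity
    set m := ⌊α * (N : ℝ)⌋₊
    have hm : (m : ℝ) ≤ α * N := Nat.floor_le (by positivity)
    have hk : (⌊x⌋₊ : ℝ) ≤ x := Nat.floor_le hx0.le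
    have hη1 : (⌊x⌋₊ : ℝ) * (x ^ 4)⁻¹ ≤ 1 := by
      rw [← div_eq_mul_inv, div_le_one (by positivity)]
      exact hk.trans (le_self_pow₀ hxone (by norm_num))
    have hηκ : 8 * (⌊x⌋₊ : ℝ) ^ 2 * (x ^ 4)⁻¹ ≤ κ ^ 2 := by
      calc 8 * (⌊x⌋₊ : ℝ) ^ 2 * (x ^ 4)⁻¹ ≤ 8 * x ^ 2 * (x ^ 4)⁻¹ := by gcongr
        _ = 8 / x ^ 2 := by field_simp
        _ ≤ κ ^ 2 := by
          rw [div_le_iff₀ (by positivity)] at hxκ ⊢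
          have : x ≤ x ^ 2 := le_self_pow₀ hxone (by norm_num)
          nlinarith [sq_nonneg κ]
    have hτ1 : Real.exp (-x ^ 4) ≤ 1 := Real.exp_le_one_iff.2 (by
      have : 0 ≤ x ^ 4 := by positivity
      linarith)
    have hdef := logDefect_le (m := m) (η := (x ^ 4)⁻¹) (Λ := C₂ * N) hκ hc hgap hN hm
      (by positivity) hη1 hηκ (Real.exp_pos (-x ^ 4)) hτ1 fun t ht =>
        log_truncation_le hκ ((Nat.cast_le.2 ht).trans hm) hxone hxN
    have hE := expect_small_mul_le hκ hN m (Real.exp_pos (-x ^ 4)) hτ1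
    set E := expect κ N m (fun T =>
      if cnt T / (2 ^ N * gaussProb κ ^ m) < Real.exp (-x ^ 4) then 1 else 0)
    have hE0 : 0 ≤ E := expect_nonneg _ _ _ fun T => by split_ifs <;> norm_num
    have hstep : stepLoss κ c N ⌊x⌋₊ (x ^ 4)⁻¹ (Real.exp (-x ^ 4)) (C₂ * N) * N ≤
        (C * 24 + C₂) * x := by
      have e1 : c * N * (x ^ 4)⁻¹ ^ 2 = c * x ^ 8 := by rw [← hxN]; field_simp
      have e2 : (N : ℝ) * N = x ^ 32 := by rw [← hxN]; ring
      have hlog : Real.log (N + 1) ≤ 17 * x := by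
        have h1 : (N : ℝ) + 1 ≤ 2 * x ^ 16 := by
          rw [hxN]; have : (1 : ℝ) ≤ N := by exact_mod_cast hN
          linarith
        have h2 := Real.log_le_log (by positivity) h1
        rw [Real.log_mul (by norm_num) (by positivity), Real.log_pow] at h2
        have h3 := Real.log_le_sub_one_of_pos hx0
        have h4 := Real.log_le_sub_one_of_pos (show (0 : ℝ) < 2 by norm_num)
        push_cast at h2
        linarith
      unfold stepLoss
      rw [e1, show lossConst κ c = C from rfl]
      rw [← hxN] at hlog ⊢
      calc _ = C * (Real.log (x ^ 16 + 1) + 7) + C₂ * (x ^ 32 * collapseBound κ ⌊x⌋₊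
            (Real.exp (-(c * x ^ 8)) * (x ^ 16 + 1) / Real.exp (-x ^ 4) ^ 2)) := by
            field_simp
        _ ≤ C * (17 * x + 7 * x) + C₂ * (x ^ 32 * (A * Real.exp (-ρ * x) + Real.exp (-x))) := by
            gcongr; linarith
        _ ≤ C * (17 * x + 7 * x) + C₂ * x := by gcongr; linarith
        _ = _ := by ring
    have hs0 := stepLoss_nonneg hκ hc N ⌊x⌋₊ (x ^ 4)⁻¹ (Real.exp (-x ^ 4))
      (show 0 ≤ C₂ * N by positivity)
    set ε := stepLoss κ c N ⌊x⌋₊ (x ^ 4)⁻¹ (Real.exp (-x ^ 4)) (C₂ * N)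
    have hmain : E * (x ^ 4 - 1) ≤ B * x := by
      have h1 : x ^ 4 - 1 ≤ -Real.log (2 * Real.exp (-x ^ 4)) := by
        rw [Real.log_mul (by norm_num) (Real.exp_pos _).ne', Real.log_exp]
        have h4 := Real.log_le_sub_one_of_pos (show (0 : ℝ) < 2 by norm_num)
        linarith
      have h2 : Real.exp (2 * (C / N) * m) ≤ Real.exp (2 * C * α) := by
        refine Real.exp_le_exp.2 ?_
        calc 2 * (C / N) * m ≤ 2 * (C / N) * (α * N) := by gcongr
          _ = _ := by field_simp
      calc E * (x ^ 4 - 1) ≤ E * -Real.log (2 * Real.exp (-x ^ 4)) := by gcongr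
        _ ≤ ε * m * Real.exp (2 * (C / N) * m) + 2 := by linarith
        _ ≤ ε * (α * N) * Real.exp (2 * C * α) + 2 * x := by
            refine add_le_add ?_ (by linarith)
            gcongr
        _ = α * Real.exp (2 * C * α) * (ε * N) + 2 * x := by ring
        _ ≤ α * Real.exp (2 * C * α) * ((C * 24 + C₂) * x) + 2 * x := by gcongr
        _ = B * x := by rw [hB]; ring
    rw [le_div_iff₀ hx0]
    have h3 : x ^ 2 ≤ x ^ 4 - 1 := by nlinarith [mul_self_nonneg (x ^ 2 - 2)]
    have h4 : E * x * x ≤ B * x := by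
      refine le_trans ?_ hmain
      rw [mul_assoc, ← sq]; gcongr
    exact le_of_mul_le_mul_right h4 hx0
  refine squeeze_zero' (Eventually.of_forall fun N => ?_) hbound ?_
  · exact expect_nonneg _ _ _ fun T => by split_ifs <;> norm_num
  · exact tendsto_const_nhds.div_atTop hlim

/-! ### The conditioned model and isolated solutions -/

theorem uniformOn_eq_ofReal {N : ℕ} (S U : Set (Cube N)) :
    uniformOn S U = ENNReal.ofReal (cnt (S ∩ U) / cnt S) := by
  classical
  rcases S.eq_empty_or_nonempty with rfl | hS
  · simp [cnt]
  have h : ∀ T : Set (Cube N), cnt T = T.toFinset.card := fun T => by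
    simp only [cnt, Set.indicator_apply, Pi.one_apply, Finset.sum_boole]
    congr 2; ext; simp
  have hS' : (0 : ℝ) < S.toFinset.card := by
    exact_mod_cast Finset.card_pos.2 (Set.toFinset_nonempty.2 hS)
  have h1 := uniformOn_apply_finset (s := S.toFinset) (t := U.toFinset)
  rw [Set.coe_toFinset, Set.coe_toFinset] at h1
  rw [h1, h, h, ENNReal.ofReal_div_of_pos hS', ENNReal.ofReal_natCast, ENNReal.ofReal_natCast,
    Set.toFinset_inter]

theorem measurableSet_nonempty_solutions (κ : ℝ) (N m : ℕ) :
    MeasurableSet {X : Fin m → Fin N → ℝ | (solutions κ X).Nonempty} := by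
  have h : {X : Fin m → Fin N → ℝ | (solutions κ X).Nonempty} =
      {X | solutions κ X = ∅}ᶜ := by ext; simp [Set.nonempty_iff_ne_empty]
  rw [h]
  exact (measurableSet_solutions_eq κ ∅).compl

theorem measurableSet_mem_comp_solutions (κ : ℝ) {N m : ℕ} (P : Set (Cube N) → Set (Cube N)) :
    MeasurableSet {ω : (Fin m → Fin N → ℝ) × Cube N | ω.2 ∈ P (solutions κ ω.1)} := by
  have h : {ω : (Fin m → Fin N → ℝ) × Cube N | ω.2 ∈ P (solutions κ ω.1)} =
      ⋃ U : Set (Cube N), {X | solutions κ X = U} ×ˢ P U := by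
    ext ω; simp
  rw [h]
  exact MeasurableSet.iUnion fun U =>
    (measurableSet_solutions_eq κ U).prod (Set.toFinite _).measurableSet

theorem randomModel_apply (κ : ℝ) (N m : ℕ) (P : Set (Cube N) → Set (Cube N)) :
    randomModel κ N m {ω | ω.2 ∈ P (solutions κ ω.1)} =
      (disorder N m {X | (solutions κ X).Nonempty})⁻¹ *
        ∫⁻ X in {X | (solutions κ X).Nonempty},
          uniformOn (solutions κ X) (P (solutions κ X)) ∂disorder N m := by
  rw [randomModel, Measure.compProd_apply (measurableSet_mem_comp_solutions κ P),
    ProbabilityTheory.cond, lintegral_smul_measure, smul_eq_mul]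
  rfl

theorem randomModel_univ (κ : ℝ) (N m : ℕ) :
    randomModel κ N m Set.univ =
      (disorder N m {X | (solutions κ X).Nonempty})⁻¹ *
        disorder N m {X | (solutions κ X).Nonempty} := by
  have h := randomModel_apply κ N m fun _ => Set.univ
  simp only [Set.mem_univ, Set.ofPred_true] at h
  rw [h]
  congr 1
  rw [setLIntegral_congr_fun (g := fun _ => 1) (measurableSet_nonempty_solutions κ N m)]
  · simp
  · intro X hX
    exact uniformOn_of_univ (Set.toFinite _) hX

theorem randomModel_le_one (κ : ℝ) (N m : ℕ) (s : Set ((Fin m → Fin N → ℝ) × Cube N)) :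
    randomModel κ N m s ≤ 1 :=
  (measure_mono (Set.subset_univ s)).trans
    ((randomModel_univ κ N m).trans_le (ENNReal.inv_mul_le_one _))

/-- Expectations of nonnegative functions as lower integrals. -/
theorem ofReal_expect {κ : ℝ} {N m : ℕ} {f : Set (Cube N) → ℝ} (hf : ∀ T, 0 ≤ f T) :
    ∫⁻ X, ENNReal.ofReal (f (solutions κ X)) ∂disorder N m = ENNReal.ofReal (expect κ N m f) :=
  (ofReal_integral_eq_lintegral_ofReal (integrable_comp_solutions κ f)
    (ae_of_all _ fun _ => hf _)).symm

theorem tendsto_disorder_nonempty {κ : ℝ} {m : ℕ → ℕ}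
    (h : Tendsto (fun N => expect κ N (m N) fun T => if cnt T = 0 then 1 else 0) atTop (𝓝 0)) :
    Tendsto (fun N => disorder N (m N) {X | (solutions κ X).Nonempty}) atTop (𝓝 1) := by
  have e : ∀ N, disorder N (m N) {X | (solutions κ X).Nonempty} =
      1 - ENNReal.ofReal (expect κ N (m N) fun T => if cnt T = 0 then 1 else 0) := by
    intro N
    have h1 : {X : Fin (m N) → Fin N → ℝ | (solutions κ X).Nonempty} =
        {X | solutions κ X = ∅}ᶜ := by ext; simp [Set.nonempty_iff_ne_empty]
    rw [h1, prob_compl_eq_one_sub (measurableSet_solutions_eq κ ∅),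
      ← ofReal_expect (fun T => by split_ifs <;> norm_num),
      ← lintegral_indicator_one (measurableSet_solutions_eq κ ∅)]
    congr 2
    funext X
    by_cases hX : solutions κ X = ∅ <;> simp [cnt_eq_zero_iff, hX]
  simp_rw [e]
  have h2 := ENNReal.tendsto_ofReal h
  rw [ENNReal.ofReal_zero] at h2
  simpa using ENNReal.Tendsto.sub tendsto_const_nhds h2 (Or.inl ENNReal.one_ne_top)

/-- A property of a solution holds with high probability when the expected proportion of solutions
which violate it, without conditioning, tends to zero. -/
theorem tendsto_randomModel {κ : ℝ} {m : ℕ → ℕ} (P : ∀ N, Set (Cube N) → Set (Cube N))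
    (h : Tendsto (fun N => expect κ N (m N) fun T => if cnt T = 0 then 1 else 0) atTop (𝓝 0))
    (hP : Tendsto (fun N => expect κ N (m N) fun T => cnt (T ∩ (P N T)ᶜ) / cnt T) atTop (𝓝 0)) :
    Tendsto (fun N => randomModel κ N (m N) {ω | ω.2 ∈ P N (solutions κ ω.1)}) atTop (𝓝 1) := by
  have hA := tendsto_disorder_nonempty h
  have hbad : Tendsto (fun N => randomModel κ N (m N) {ω | ω.2 ∈ P N (solutions κ ω.1)}ᶜ)
      atTop (𝓝 0) := by
    have h1 : Tendsto (fun N => (disorder N (m N) {X | (solutions κ X).Nonempty})⁻¹ *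
        ENNReal.ofReal (expect κ N (m N) fun T => cnt (T ∩ (P N T)ᶜ) / cnt T)) atTop (𝓝 0) := by
      have h2 := ENNReal.tendsto_ofReal hP
      rw [ENNReal.ofReal_zero] at h2
      have h3 := tendsto_inv_iff.2 hA
      rw [inv_one] at h3
      simpa using ENNReal.Tendsto.mul h3 (Or.inl one_ne_zero) h2 (Or.inr ENNReal.one_ne_top)
    refine tendsto_of_tendsto_of_tendsto_of_le_of_le tendsto_const_nhds h1
      (fun _ => zero_le) fun N => ?_
    have h2 := randomModel_apply κ N (m N) fun T => (P N T)ᶜ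
    have h3 : {ω : (Fin (m N) → Fin N → ℝ) × Cube N | ω.2 ∈ P N (solutions κ ω.1)}ᶜ =
      {ω | ω.2 ∈ (P N (solutions κ ω.1))ᶜ} := rfl
    dsimp only
    rw [h3, h2, ← ofReal_expect fun T => div_nonneg (cnt_nonneg _) (cnt_nonneg _)]
    refine mul_le_mul_right ((setLIntegral_le_lintegral _ _).trans (le_of_eq ?_)) _
    simp_rw [uniformOn_eq_ofReal]
  have hpos : ∀ᶠ N in atTop, disorder N (m N) {X | (solutions κ X).Nonempty} ≠ 0 :=
    hA.eventually_ne one_ne_zero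
  have h1 : Tendsto (fun N => 1 - randomModel κ N (m N) {ω | ω.2 ∈ P N (solutions κ ω.1)}ᶜ)
      atTop (𝓝 1) := by
    simpa using ENNReal.Tendsto.sub tendsto_const_nhds hbad (Or.inl ENNReal.one_ne_top)
  refine h1.congr' ?_
  filter_upwards [hpos] with N hN
  have : IsProbabilityMeasure (randomModel κ N (m N)) :=
    ⟨by rw [randomModel_univ, ENNReal.inv_mul_cancel hN (measure_ne_top _ _)]⟩
  rw [prob_compl_eq_one_sub (measurableSet_mem_comp_solutions κ (P N)),
    ENNReal.sub_sub_cancel ENNReal.one_ne_top prob_le_one]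

/-- The number of solutions with another solution nearby is at most the number of pairs of
distinct nearby solutions. -/
theorem cnt_not_isolated_le {N : ℕ} {b : ℝ} (hb : 0 ≤ b) (T : Set (Cube N)) :
    cnt (T ∩ {σ | {σ' | σ' ∈ T ∧ (hammingDist σ σ' : ℝ) ≤ b * N} = {σ}}ᶜ) ≤
      pairSum (fun σ τ => if σ ≠ τ ∧ (hammingDist σ τ : ℝ) ≤ b * N then 1 else 0) T := by
  refine Finset.sum_le_sum fun σ _ => ?_
  have h0 : ∀ τ ∈ Finset.univ, (0 : ℝ) ≤
      (if σ ≠ τ ∧ (hammingDist σ τ : ℝ) ≤ b * N then 1 else 0) *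
        (T.indicator 1 σ * T.indicator 1 τ) := fun τ _ =>
    mul_nonneg (by split_ifs <;> norm_num) (mul_nonneg
      (Set.indicator_nonneg (fun _ _ => zero_le_one) _)
      (Set.indicator_nonneg (fun _ _ => zero_le_one) _))
  by_cases hσ : σ ∈ T ∩ {σ | {σ' | σ' ∈ T ∧ (hammingDist σ σ' : ℝ) ≤ b * N} = {σ}}ᶜ
  · obtain ⟨hσT, hne⟩ := hσ
    obtain ⟨τ, hτT, hd, hτσ⟩ : ∃ τ ∈ T, (hammingDist σ τ : ℝ) ≤ b * N ∧ τ ≠ σ := by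
      by_contra hcon
      push Not at hcon
      refine hne (Set.eq_singleton_iff_unique_mem.2 ⟨⟨hσT, ?_⟩, fun τ hτ => hcon τ hτ.1 hτ.2⟩)
      rw [hammingDist_self]; push_cast; positivity
    refine le_trans (le_of_eq ?_) (Finset.single_le_sum h0 (Finset.mem_univ τ))
    rw [Set.indicator_of_mem (s := T ∩ {σ | {σ' | σ' ∈ T ∧ (hammingDist σ σ' : ℝ) ≤ b * N} = {σ}}ᶜ)
      ⟨hσT, hne⟩, Set.indicator_of_mem hσT,
      Set.indicator_of_mem hτT, if_pos ⟨hτσ.symm, hd⟩]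
    simp
  · rw [Set.indicator_of_notMem hσ]
    exact Finset.sum_nonneg h0

/-- Solutions are isolated up to any distance below which the first moment of the number of nearby
pairs is exponentially small in `√N`. -/
theorem tendsto_randomModel_isolated {κ α b c c' : ℝ} (hκ : 0 < κ) (hα : 0 < α) (hb : 0 ≤ b)
    (hb1 : b ≤ 1) (hc : 0 < c) (hc' : 0 < c')
    (hclose : ∀ β ∈ Set.Ioc (0 : ℝ) b,
      rate κ α β - α * Real.log (gaussProb κ) ≤ -c * √β)
    (hgap : ∀ β ∈ Set.Icc (0 : ℝ) 1, rate κ α β ≤ rate κ α (1 / 2) - c' * (2 * β - 1) ^ 2) :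
    Tendsto (fun N : ℕ => randomModel κ N ⌊α * (N : ℝ)⌋₊
      {ω | {σ' | σ' ∈ solutions κ ω.1 ∧ (hammingDist ω.2 σ' : ℝ) ≤ b * (N : ℝ)} = {ω.2}})
      atTop (𝓝 1) := by
  have hp := gaussProb_pos hκ
  have hsmall := tendsto_expect_small hκ hα hc' hgap
  have hlim : Tendsto (fun N : ℕ => (N : ℝ) ^ (1 / 16 : ℝ)) atTop atTop :=
    (tendsto_rpow_atTop (by norm_num)).comp tendsto_natCast_atTop_atTop
  set small : ℕ → ℝ := fun N => expect κ N ⌊α * (N : ℝ)⌋₊ fun T =>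
    if cnt T / (2 ^ N * gaussProb κ ^ ⌊α * (N : ℝ)⌋₊) < Real.exp (-((N : ℝ) ^ (1 / 16 : ℝ)) ^ 4)
      then 1 else 0
  refine tendsto_randomModel (m := fun N => ⌊α * (N : ℝ)⌋₊)
    (fun N T => {σ | {σ' | σ' ∈ T ∧ (hammingDist σ σ' : ℝ) ≤ b * N} = {σ}}) ?_ ?_
  · refine squeeze_zero (fun N => ?_) (fun N => ?_) hsmall
    · exact expect_nonneg _ _ _ fun T => by split_ifs <;> norm_num
    · refine expect_mono _ _ _ fun T => ?_
      by_cases h : cnt T = 0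
      · simp [h, Real.exp_pos]
      · rw [if_neg h]; split_ifs <;> norm_num
  · have hexp : Tendsto (fun N : ℕ => Real.exp (-((N : ℝ) ^ (1 / 16 : ℝ))) / gaussProb κ)
        atTop (𝓝 0) := by
      have := (Real.tendsto_exp_neg_atTop_nhds_zero.comp hlim).div_const (gaussProb κ)
      simpa using this
    have hsum := hsmall.add hexp
    rw [add_zero] at hsum
    refine squeeze_zero' (Eventually.of_forall fun N => ?_) ?_ hsum
    · exact expect_nonneg _ _ _ fun T => div_nonneg (cnt_nonneg _) (cnt_nonneg _)
    filter_upwards [eventually_gt_atTop 0, hlim.eventually (eventually_ge_atTop 1),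
      hlim.eventually (eventually_ge_atTop (19 / c))] with N hN hx1 hxc
    set x := (N : ℝ) ^ (1 / 16 : ℝ) with hx
    have hxN : x ^ 16 = N := by
      rw [hx, ← Real.rpow_natCast, ← Real.rpow_mul (by positivity)]; norm_num
    have hsqrt : √(N : ℝ) = x ^ 8 := by
      rw [← hxN, show x ^ 16 = (x ^ 8) ^ 2 by ring, Real.sqrt_sq (by positivity)]
    set m := ⌊α * (N : ℝ)⌋₊
    set D : ℝ := 2 ^ N * gaussProb κ ^ m with hD
    have hDpos : 0 < D := by positivity
    set τ := Real.exp (-x ^ 4) with hτ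
    have hτpos : 0 < τ := Real.exp_pos _
    have hmono := expect_mono κ N m
      (f := fun T => cnt (T ∩ {σ | {σ' | σ' ∈ T ∧ (hammingDist σ σ' : ℝ) ≤ b * N} = {σ}}ᶜ) / cnt T)
      (g := fun T => (if cnt T / D < τ then 1 else 0) + 1 / (τ * D) *
        pairSum (fun σ τ => if σ ≠ τ ∧ (hammingDist σ τ : ℝ) ≤ b * N then 1 else 0) T)
      fun T => by
        have h1 := cnt_not_isolated_le hb T
        have h2 := (cnt_nonneg _).trans h1
        split_ifs with h
        · have h3 : cnt (T ∩ {σ | {σ' | σ' ∈ T ∧ (hammingDist σ σ' : ℝ) ≤ b * N} = {σ}}ᶜ) /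
              cnt T ≤ 1 := div_le_one_of_le₀ (cnt_mono Set.inter_subset_left) (cnt_nonneg T)
          have h4 := mul_nonneg (show 0 ≤ 1 / (τ * D) by positivity) h2
          linarith
        · rw [zero_add, one_div_mul_eq_div]
          have h3 : τ * D ≤ cnt T := (le_div_iff₀ hDpos).1 (not_lt.1 h)
          exact div_le_div₀ h2 h1 (by positivity) h3
    rw [expect_add, expect_const_mul] at hmono
    refine hmono.trans (add_le_add le_rfl ?_)
    have h1 := expect_pairSum_close_le hκ hb1 hc hclose hN
    rw [← hD] at h1
    have hx2 : x ≤ x ^ 4 := le_self_pow₀ hx1 (by norm_num)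
    have hexp2 : x ^ 4 + (16 * x + 1) + -c * x ^ 8 ≤ -x := by
      have h6 : 19 ≤ c * x ^ 4 := by
        rw [div_le_iff₀ hc] at hxc
        nlinarith
      have h7 : 19 * x ^ 4 ≤ c * x ^ 4 * x ^ 4 := by gcongr
      nlinarith
    calc _ ≤ 1 / (τ * D) * (D * ((N + 1) * (Real.exp (-c * √N) / gaussProb κ))) := by gcongr
      _ = Real.exp (x ^ 4) * (x ^ 16 + 1) * Real.exp (-c * x ^ 8) / gaussProb κ := by
          rw [hsqrt, hxN, hτ, Real.exp_neg]; field_simp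
      _ ≤ Real.exp (x ^ 4) * Real.exp (16 * x + 1) * Real.exp (-c * x ^ 8) / gaussProb κ := by
          have := pow_sixteen_add_one_le (zero_le_one.trans hx1)
          gcongr
      _ = Real.exp (x ^ 4 + (16 * x + 1) + -c * x ^ 8) / gaussProb κ := by
          simp only [Real.exp_add]
      _ ≤ _ := by gcongr

/-- Flipping a coordinate moves by distance one, so that isolation at distance at least one implies
freezing. -/
theorem isCompletelyFrozen_of_isolated {c : ℝ} {N : ℕ} (hN : 1 ≤ c * N) {S : Set (Cube N)}
    {σ : Cube N} (h : {σ' | σ' ∈ S ∧ (hammingDist σ σ' : ℝ) ≤ c * N} = {σ}) :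
    IsCompletelyFrozen c S σ := by
  have hσ : σ ∈ {σ' | σ' ∈ S ∧ (hammingDist σ σ' : ℝ) ≤ c * N} := by rw [h]; rfl
  refine ⟨hσ.1, fun i hi => ?_, fun σ' hσ' hne => ?_⟩
  · have hd : hammingDist σ (Function.update σ i (-σ i)) ≤ 1 := by
      refine (Finset.card_le_card (t := {i}) fun j hj => ?_).trans_eq (Finset.card_singleton i)
      by_contra hji
      rw [Finset.mem_singleton] at hji
      simp [Function.update_of_ne hji] at hj
    have hd' : (hammingDist σ (Function.update σ i (-σ i)) : ℝ) ≤ 1 := by exact_mod_cast hd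
    have hmem : Function.update σ i (-σ i) ∈ ({σ} : Set (Cube N)) := by
      rw [← h]; exact ⟨hi, hd'.trans hN⟩
    have h1 : -σ i = σ i := by simpa using congrFun (Set.mem_singleton_iff.1 hmem) i
    rcases Int.units_eq_one_or (σ i) with h2 | h2 <;> rw [h2] at h1 <;> exact absurd h1 (by decide)
  · by_contra hcon
    have hmem : σ' ∈ ({σ} : Set (Cube N)) := by rw [← h]; exact ⟨hσ', not_lt.1 hcon⟩
    exact hne hmem

end SymPerceptron

end

theorem theorem1p1 (κ α : ℝ) (hκ : 0 < κ) (hα : 0 < α)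
    (hαc : α < SymPerceptron.criticalDensity κ)
    (hF : SymPerceptron.SingleCriticalPoint κ α) :
    ∃ βc : ℝ,
      SymPerceptron.IsCriticalDistance κ α βc ∧
      (∀ β : ℝ, SymPerceptron.IsCriticalDistance κ α β → β = βc) ∧
      (∀ δ ∈ Set.Ioo (0 : ℝ) βc,
        Tendsto
          (fun N : ℕ => SymPerceptron.randomModel κ N ⌊α * (N : ℝ)⌋₊
            {ω | {σ' | σ' ∈ SymPerceptron.solutions κ ω.1 ∧
                (hammingDist ω.2 σ' : ℝ) ≤ (βc - δ) * (N : ℝ)} = {ω.2}})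
          atTop (𝓝 1)) ∧
      ∃ c : ℝ, 0 < c ∧
        Tendsto
          (fun N : ℕ => SymPerceptron.randomModel κ N ⌊α * (N : ℝ)⌋₊
            {ω | SymPerceptron.IsCompletelyFrozen c
              (SymPerceptron.solutions κ ω.1) ω.2})
          atTop (𝓝 1) := by
  obtain ⟨βc, hβc, huniq, hclose⟩ := SymPerceptron.exists_criticalDistance hκ hα hαc hF
  obtain ⟨c', hc', hgap⟩ := SymPerceptron.rate_quadratic_gap hκ hα hαc hF
  have hisolated : ∀ δ ∈ Set.Ioo (0 : ℝ) βc,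
      Tendsto
        (fun N : ℕ => SymPerceptron.randomModel κ N ⌊α * (N : ℝ)⌋₊
          {ω | {σ' | σ' ∈ SymPerceptron.solutions κ ω.1 ∧
              (hammingDist ω.2 σ' : ℝ) ≤ (βc - δ) * (N : ℝ)} = {ω.2}})
        atTop (𝓝 1) := by
    intro δ hδ
    obtain ⟨c, hc, hrate⟩ := hclose δ hδ
    exact SymPerceptron.tendsto_randomModel_isolated hκ hα (by linarith [hδ.2])
      (by linarith [hδ.1, hβc.1.2]) hc hc' hrate hgap
  refine ⟨βc, hβc, huniq, hisolated, βc / 2, half_pos hβc.1.1, ?_⟩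
  have h := hisolated (βc / 2) ⟨half_pos hβc.1.1, half_lt_self hβc.1.1⟩
  refine tendsto_of_tendsto_of_tendsto_of_le_of_le' h tendsto_const_nhds ?_
    (Eventually.of_forall fun N => SymPerceptron.randomModel_le_one _ _ _ _)
  have hlarge : Tendsto (fun N : ℕ => βc / 2 * (N : ℝ)) atTop atTop :=
    tendsto_natCast_atTop_atTop.const_mul_atTop (half_pos hβc.1.1)
  filter_upwards [hlarge.eventually (eventually_ge_atTop 1)] with N hN
  refine measure_mono fun ω hω => SymPerceptron.isCompletelyFrozen_of_isolated hN ?_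
  rw [← hω.out, show βc - βc / 2 = βc / 2 by ring]
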